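/- Let $n\ge 1$, $m\ge 0$, $d\ge 1$ be integers, and let $\boldsymbol a_1,\dots,\boldsymbol a_m\in\mathbb Z_{\ge 0}^n$ be vectors with $|\boldsymbol a_i|=a_{1i}+\dots+a_{ni}=d$. For $\boldsymbol z=(z_1,\dots,z_{m+n})\in\mathbb C^{m+n}$ put $$F(\boldsymbol x;\boldsymbol z)=\sum_{i=1}^m z_i\boldsymbol x^{\boldsymbol a_i}+\sum_{j=1}^n z_{m+j}x_j^d,\qquad U_{\boldsymbol z}=\{[\boldsymbol x]\in\mathbb P^{n-1}(\mathbb C)\mid F(\boldsymbol x;\boldsymbol z)\neq 0\},$$ and for $\boldsymbol c\in\mathbb Z_{>0}^n$ with $|\boldsymbol c|=dr$, $r\in\mathbb Z$, put $$\omega_{\boldsymbol c}=\frac{x_1^{c_1-1}\cdots x_n^{c_n-1}}{F^r}\,\Omega,\qquad \Omega=\sum_{i=1}^n(-1)^i x_i\,dx_1\wedge\cdots\wedge\widehat{dx_i}\wedge\cdots\wedge dx_n .$$ *The Fermat cycle.* Let $\Delta=\{[\boldsymbol x]\in\mathbb P^{n-1}(\mathbb C)\mid x_1,\dots,x_n\in\mathbb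 R_{\ge 0}\}$ be the $(n-1)$-simplex, oriented so that the restriction of $\Omega$ is positive (that is, oppositely to the order of its vertices), and let $\sigma_i$ be the automorphism of $\mathbb P^{n-1}$ that multiplies the coordinate $x_i$ by $e^{2\pi\sqrt{-1}/d}$. The Fermat cycle is $$\delta_0=d^{\,n-1}\prod_{i=1}^n(\sigma_i-1)[\Delta],$$ a cycle in $U_{\boldsymbol z}$ for $\boldsymbol z=(0,\dots,0,1,\dots,1)$ with rational coefficients. *Its deformation.* Given $\varepsilon>0$, consider the space of all $(z_1,\dots,z_m;\log z_{m+1},\dots,\log z_{m+n})\in\mathbb C^m\times\mathbb C^n$ such that $|z_i|<\varepsilon|z_{m+j}|$ for all $1\le i\le m$ and $1\le j\le n$. Let $\delta_{\boldsymbol z}$ denote a cycle in $U_{\boldsymbol z}$ whose class in $H_{n-1}(U_{\boldsymbol z},\mathbb Q)$ is obtained from the class of $\delta_0$ by continuous deformation (parallel transport) along a path in this space from $(0,\dots,0;0,\dots,0)$ to the point given by $\boldsymbol z$ and the chosen logarithms. (Cycles and homologies are taken in the complex of smooth singular chains.) *Gamma series.* Let $A=[\boldsymbol a_1\ \cdots\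 \boldsymbol a_m\ \ d\boldsymbol e_1\ \cdots\ d\boldsymbol e_n]$, where $\boldsymbol e_1,\dots,\boldsymbol e_n$ are the standard vectors of $\mathbb Z^n$, and let $L_A=\{\boldsymbol u\in\mathbb Z^{m+n}\mid A\boldsymbol u=0\}$. For $\boldsymbol p\in\mathbb Z^m$ put $$\boldsymbol\gamma^{\boldsymbol c}_{\boldsymbol p}=\Bigl(p_1,\dots,p_m,\,-\tfrac1d\bigl(\boldsymbol c+p_1\boldsymbol a_1+\cdots+p_m\boldsymbol a_m\bigr)\Bigr)\in\mathbb Q^{m+n},\qquad \varphi(\boldsymbol\gamma;\boldsymbol z)=\sum_{\boldsymbol u\in L_A}\ \prod_{i=1}^{m+n}\frac{z_i^{u_i+\gamma_i}}{\Gamma(1+u_i+\gamma_i)},$$ where $1/\Gamma=0$ at the poles of $\Gamma$ and $z_i^{\alpha}=\exp(\alpha\log z_i)$. Let $h:\mathbb Z^m\to(\mathbb Z/d\mathbb Z)^n$ be $h(\boldsymbol q)=\sum_i q_i\boldsymbol a_i \bmod d$. For a set $\{\boldsymbol q_1,\dots,\boldsymbol q_\ell\}$ of representatives of $\mathbb Z^m/\operatorname{Ker}h$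 let $$P_{\boldsymbol c}=\bigl\{\boldsymbol p\in\{\boldsymbol q_1,\dots,\boldsymbol q_\ell\}\ \bigm|\ \text{no entry of } (\boldsymbol c\bmod d)+h(\boldsymbol p)\text{ is zero}\bigr\}.$$ **Lemma.** There is $\varepsilon>0$, depending only on $n,m,d,\boldsymbol a_1,\dots,\boldsymbol a_m$, such that the following holds for every $\boldsymbol z$ with $0<|z_i|<\varepsilon|z_{m+j}|$ for all $1\le i\le m$, $1\le j\le n$ and $z_{m+j}\ne0$ for all $j$, and every choice of the logarithms $\log z_1,\dots,\log z_{m+n}$. The deformation $\delta_{\boldsymbol z}$ exists, and for every such $\delta_{\boldsymbol z}$, every $\boldsymbol c\in\mathbb Z_{>0}^n$ with $|\boldsymbol c|=dr$, and every choice of representatives of $\mathbb Z^m/\operatorname{Ker}h$, the Gamma series $\varphi(\boldsymbol\gamma^{\boldsymbol c}_{\boldsymbol p};\boldsymbol z)$, $\boldsymbol p\in P_{\boldsymbol c}$, converge absolutely and $$\int_{\delta_{\boldsymbol z}}\omega_{\boldsymbol c}=\frac{(-1)^r}{(r-1)!}\,(2\pi\sqrt{-1})^n\sum_{\boldsymbol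 p\in P_{\boldsymbol c}}\varphi(\boldsymbol\gamma^{\boldsymbol c}_{\boldsymbol p};\boldsymbol z).$$ -/

import Mathlib

noncomputable section

namespace FermatPeriod

/-! ### Smooth singular chains in projective space -/

/-- Complex projective space with homogeneous coordinates indexed by `Fin n`. -/
abbrev Proj (n : ℕ) : Type := Projectivization ℂ (Fin n → ℂ)

/-- `x` is a smooth lift to `ℂⁿ ∖ {0}` of the map `σ` from the standard `q`-simplex to `ℙⁿ⁻¹`.
(The simplex is contractible, so a map to `ℙⁿ⁻¹` is smooth up to the boundary exactly when it has
such a lift.) -/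
def IsSmoothLift {n q : ℕ} (σ : stdSimplex ℝ (Fin (q + 1)) → Proj n)
    (x : (Fin (q + 1) → ℝ) → (Fin n → ℂ)) : Prop :=
  ContDiff ℝ (⊤ : ℕ∞) x ∧
    ∀ t : stdSimplex ℝ (Fin (q + 1)), ∃ h : x t.1 ≠ 0, Projectivization.mk ℂ (x t.1) h = σ t

/-- Smooth singular `q`-simplices in `ℙⁿ⁻¹`. -/
@[ext] structure SmoothSimplex (n q : ℕ) where
  toFun : stdSimplex ℝ (Fin (q + 1)) → Proj n
  smooth : ∃ x, IsSmoothLift toFun x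

/-- The inclusion of the `i`-th face (`t_i = 0`) of the standard simplex. -/
def faceMap {q : ℕ} (i : Fin (q + 2)) (t : stdSimplex ℝ (Fin (q + 1))) :
    stdSimplex ℝ (Fin (q + 2)) :=
  ⟨i.insertNth (0 : ℝ) t.1, by
    constructor
    · intro j
      rcases Fin.eq_self_or_eq_succAbove i j with rfl | ⟨j, rfl⟩
      · simp
      · simpa using t.2.1 j
    · rw [Fin.sum_univ_succAbove _ i]
      simpa using t.2.2⟩

/-- The `i`-th face of a smooth singular simplex. -/
def SmoothSimplex.face {n q : ℕ} (σ : SmoothSimplex n (q + 1)) (i : Fin (q + 2)) :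
    SmoothSimplex n q where
  toFun t := σ.toFun (faceMap i t)
  smooth := by
    obtain ⟨x, hx, hl⟩ := σ.smooth
    refine ⟨fun t => x (i.insertNth (0 : ℝ) t), hx.comp ?_, fun t => hl (faceMap i t)⟩
    rw [contDiff_pi]
    intro j
    rcases Fin.eq_self_or_eq_succAbove i j with rfl | ⟨j, rfl⟩
    · simpa using contDiff_const
    · simpa using contDiff_apply ℝ ℝ j

/-- Smooth singular `q`-chains in `ℙⁿ⁻¹` with rational coefficients. -/
abbrev Chain (n q : ℕ) : Type := SmoothSimplex n q →₀ ℚ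

/-- The boundary operator `∂ σ = ∑ i, (-1)ⁱ σ|_{t_i = 0}`. -/
def boundary {n q : ℕ} : Chain n (q + 1) →ₗ[ℚ] Chain n q :=
  Finsupp.linearCombination ℚ fun σ =>
    ∑ i : Fin (q + 2), Finsupp.single (σ.face i) ((-1 : ℚ) ^ (i : ℕ))

/-- All simplices of the chain `δ` are contained in `U`. -/
def Chain.LiesIn {n q : ℕ} (δ : Chain n q) (U : Set (Proj n)) : Prop :=
  ∀ σ ∈ δ.support, ∀ t, σ.toFun t ∈ U

/-- `δ` and `δ'` differ by the boundary of a chain in `U`. -/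
def HomologousIn {n q : ℕ} (U : Set (Proj n)) (δ δ' : Chain n q) : Prop :=
  ∃ b : Chain n (q + 1), b.LiesIn U ∧ δ' - δ = boundary b

/-! ### The family of hypersurfaces and the rational forms -/

/-- `F(x; z) = ∑_{i ≤ m} z_i x^{a_i} + ∑_{j ≤ n} z_{m+j} x_j^d`. The `m + n` parameters are
indexed by `Fin m ⊕ Fin n`. -/
def fermatDeformation {n m : ℕ} (d : ℕ) (a : Fin m → Fin n → ℕ) (z : Fin m ⊕ Fin n → ℂ)
    (x : Fin n → ℂ) : ℂ :=
  ∑ i, z (Sum.inl i) * ∏ j, x j ^ a i j + ∑ j, z (Sum.inr j) * x j ^ d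

/-- The complement `U_z` in `ℙⁿ⁻¹` of the hypersurface `F(x; z) = 0`. (`F` is homogeneous, so
the choice of the representative is irrelevant.) -/
def hypersurfaceCompl {n m : ℕ} (d : ℕ) (a : Fin m → Fin n → ℕ) (z : Fin m ⊕ Fin n → ℂ) :
    Set (Proj n) :=
  {P | fermatDeformation d a z P.rep ≠ 0}

/-- The value at the point `x` and the tangent vectors `v_1, …, v_k` of the `k`-form
`Ω = ∑_{i=1}^{n} (-1)^i x_i dx_1 ∧ ⋯ ∧ \hat{dx_i} ∧ ⋯ ∧ dx_n`, where `n = k + 1`.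
(The index `i` below starts from `0`.) -/
def eulerForm {k : ℕ} (x : Fin (k + 1) → ℂ) (v : Fin k → Fin (k + 1) → ℂ) : ℂ :=
  ∑ i : Fin (k + 1), (-1 : ℂ) ^ ((i : ℕ) + 1) * x i *
    Matrix.det (Matrix.of fun p q : Fin k => v q (i.succAbove p))

/-- The form `ω_c = (x^c / F^r) Ω / (x_1 ⋯ x_n) = x_1^{c_1 - 1} ⋯ x_n^{c_n - 1} Ω / F^r`
(for `c_j ≥ 1`). -/
def omegaForm {k m : ℕ} (d : ℕ) (a : Fin m → Fin (k + 1) → ℕ) (c : Fin (k + 1) → ℕ) (r : ℕ)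
    (z : Fin m ⊕ Fin (k + 1) → ℂ) (x : Fin (k + 1) → ℂ) (v : Fin k → Fin (k + 1) → ℂ) : ℂ :=
  (∏ j, x j ^ (c j - 1)) / fermatDeformation d a z x ^ r * eulerForm x v

/-- The coordinates `(s_1, …, s_k) ↦ (1 - ∑ s_j, s_1, …, s_k)` on the standard `k`-simplex. -/
def simplexChart {k : ℕ} (s : Fin k → ℝ) : Fin (k + 1) → ℝ :=
  Fin.cons (1 - ∑ j, s j) s

/-- The range of the coordinates `(s_1, …, s_k)`. -/
def cornerSimplex (k : ℕ) : Set (Fin k → ℝ) :=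
  {s | (∀ j, 0 ≤ s j) ∧ ∑ j, s j ≤ 1}

/-- The integral of `ω_c` over a smooth simplex: the integral of the pullback of `ω_c` under a
smooth lift. (When `|c| = d r` the form `ω_c` on `{F ≠ 0}` descends to projective space, so the
choice of the lift is irrelevant.) -/
def simplexPeriod {k m : ℕ} (d : ℕ) (a : Fin m → Fin (k + 1) → ℕ) (c : Fin (k + 1) → ℕ) (r : ℕ)
    (z : Fin m ⊕ Fin (k + 1) → ℂ) (σ : SmoothSimplex (k + 1) k) : ℂ :=
  let x := σ.smooth.choose
  ∫ s in cornerSimplex k, omegaForm d a c r z (x (simplexChart s))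
    fun j => fderiv ℝ (fun s' => x (simplexChart s')) s (Pi.single j 1)

/-- The integral `∫_δ ω_c` over a smooth chain. -/
def period {k m : ℕ} (d : ℕ) (a : Fin m → Fin (k + 1) → ℕ) (c : Fin (k + 1) → ℕ) (r : ℕ)
    (z : Fin m ⊕ Fin (k + 1) → ℂ) (δ : Chain (k + 1) k) : ℂ :=
  δ.sum fun σ q => (q : ℂ) * simplexPeriod d a c r z σ

/-! ### The Fermat cycle -/

/-- For a set `I` of coordinates, the translate by `∏_{i ∈ I} σ_i` of the simplex
`{[x_1 : ⋯ : x_n] | x_j ≥ 0}`, where `σ_i` multiplies the `i`-th homogeneous coordinate by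
`e^{2πi/d}`. The simplex is parametrized by the homogeneous coordinates normalized to have
sum `1`, a parametrization that is smooth up to the boundary. -/
def fermatSimplex (k d : ℕ) (I : Finset (Fin (k + 1))) : SmoothSimplex (k + 1) k :=
  have hne : ∀ t : stdSimplex ℝ (Fin (k + 1)),
      (fun j => (if j ∈ I then Complex.exp (2 * Real.pi * Complex.I / d) else 1) *
        ((t.1 j : ℝ) : ℂ)) ≠ 0 := by
    intro t h
    have h0 : ∀ j, t.1 j = 0 := by
      intro j
      have hj := congrFun h j
      simp only [Pi.zero_apply, mul_eq_zero] at hj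
      rcases hj with hj | hj
      · split_ifs at hj
        · exact absurd hj (Complex.exp_ne_zero _)
        · exact absurd hj one_ne_zero
      · exact_mod_cast hj
    have hs := t.2.2
    simp [h0] at hs
  { toFun := fun t => Projectivization.mk ℂ _ (hne t)
    smooth := ⟨fun t j => (if j ∈ I then Complex.exp (2 * Real.pi * Complex.I / d) else 1) *
        ((t j : ℝ) : ℂ), by
      rw [contDiff_pi]
      intro j
      exact contDiff_const.mul (Complex.ofRealCLM.contDiff.comp (contDiff_apply ℝ ℝ j)),
      fun t => ⟨hne t, rfl⟩⟩ }

/-- The Fermat cycle `δ₀ = d^{n-1} ∏_{i=1}^{n} (σ_i - 1) [Δ]`, with `n = k + 1`, the product being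
expanded over the subsets of the set of coordinates. The simplex `Δ` carries the orientation for
which the restriction of `Ω` is positive; it is opposite to the one given by the order of the
vertices, whence the sign. -/
def fermatCycle (k d : ℕ) : Chain (k + 1) k :=
  -(d : ℚ) ^ k • ∑ I : Finset (Fin (k + 1)),
    Finsupp.single (fermatSimplex k d I) ((-1 : ℚ) ^ (k + 1 - I.card))

/-! ### Deformation of the Fermat cycle -/

/-- The parameters of the family, with logarithms of the nonvanishing coordinates:
`(z_1, …, z_m)` and `(log z_{m+1}, …, log z_{m+n})`. -/
abbrev Param (n m : ℕ) : Type := (Fin m → ℂ) × (Fin n → ℂ)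

/-- The point `z` underlying a parameter. -/
def Param.toZ {n m : ℕ} (p : Param n m) : Fin m ⊕ Fin n → ℂ :=
  Sum.elim p.1 fun j => Complex.exp (p.2 j)

/-- The region `|z_i| < ε |z_{m+j}|` for all `i ≤ m`, `j ≤ n`, in the space of parameters; it is
contractible. -/
def nearFermat (n m : ℕ) (ε : ℝ) : Set (Param n m) :=
  {p | ∀ i j, ‖p.toZ (Sum.inl i)‖ < ε * ‖p.toZ (Sum.inr j)‖}

/-- `IsDeformation d a ε p δ`: the class of the cycle `δ` in the homology of `U_z`, `z = p.toZ`,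
is obtained from the class of the Fermat cycle at `z = (0, …, 0, 1, …, 1)` by continuous
deformation (parallel transport in the local system of the homology groups of the fibres `U_z`)
along a path in the region `nearFermat`. Parallel transport is generated by the constant
transport of a chain along a path of parameters for which the chain stays in `U_z`, and by the
replacement of a cycle by a homologous one in the same fibre. -/
inductive IsDeformation {k m : ℕ} (d : ℕ) (a : Fin m → Fin (k + 1) → ℕ) (ε : ℝ) :
    Param (k + 1) m → Chain (k + 1) k → Prop
  | base : IsDeformation d a ε (0, 0) (fermatCycle k d)
  | homologous {p : Param (k + 1) m} {δ δ' : Chain (k + 1) k} :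
      IsDeformation d a ε p δ → HomologousIn (hypersurfaceCompl d a p.toZ) δ δ' →
        IsDeformation d a ε p δ'
  | transport {p p' : Param (k + 1) m} {δ : Chain (k + 1) k} :
      IsDeformation d a ε p δ →
        JoinedIn {q | q ∈ nearFermat (k + 1) m ε ∧ δ.LiesIn (hypersurfaceCompl d a q.toZ)} p p' →
        IsDeformation d a ε p' δ

/-! ### Gamma series -/

/-- The matrix `A = [a_1 ⋯ a_m  d e_1 ⋯ d e_n]`. -/
def matrixA {n m : ℕ} (d : ℕ) (a : Fin m → Fin n → ℕ) : Matrix (Fin n) (Fin m ⊕ Fin n) ℤ :=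
  Matrix.of fun j => Sum.elim (fun i => (a i j : ℤ)) fun j' => if j = j' then (d : ℤ) else 0

/-- The lattice `L_A = ker (A : ℤ^N → ℤ^n)`. -/
def latticeL {n : ℕ} {ι : Type} [Fintype ι] (A : Matrix (Fin n) ι ℤ) : Submodule ℤ (ι → ℤ) :=
  LinearMap.ker A.mulVecLin

/-- The term `z^{u+γ} / Γ(1+u+γ)` of a Gamma series, where `l i` is the chosen value of
`log z_i`. (Mathlib's `Complex.Gamma` is `0` at the poles and `1 / 0 = 0`, in accordance with
the convention `1/Γ = 0` at the poles of `Γ`.) -/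
def gammaTerm {ι : Type} [Fintype ι] (γ l : ι → ℂ) (u : ι → ℤ) : ℂ :=
  Complex.exp (∑ i, ((u i : ℂ) + γ i) * l i) / ∏ i, Complex.Gamma (1 + (u i : ℂ) + γ i)

/-- The Gamma series `φ(γ; z) = ∑_{u ∈ L_A} z^{u+γ} / Γ(1+u+γ)`. -/
def gammaSeries {n : ℕ} {ι : Type} [Fintype ι] (A : Matrix (Fin n) ι ℤ) (γ l : ι → ℂ) : ℂ :=
  ∑' u : latticeL A, gammaTerm γ l u.1

/-- The exponent `γ_p^c = (p, -(c + p_1 a_1 + ⋯ + p_m a_m) / d)`. -/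
def gammaExponent {n m : ℕ} (d : ℕ) (a : Fin m → Fin n → ℕ) (c : Fin n → ℕ) (p : Fin m → ℤ) :
    Fin m ⊕ Fin n → ℂ :=
  Sum.elim (fun i => (p i : ℂ)) fun j => -((c j : ℂ) + ∑ i, (p i : ℂ) * (a i j : ℂ)) / (d : ℂ)

/-- The homomorphism `h : ℤ^m → (ℤ/dℤ)^n`, `q ↦ ∑ q_i a_i mod d`. -/
def hMap {n m : ℕ} (d : ℕ) (a : Fin m → Fin n → ℕ) (q : Fin m → ℤ) : Fin n → ZMod d :=
  fun j => ∑ i, (q i : ZMod d) * (a i j : ZMod d)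

/-- `Q` is a set of representatives of `ℤ^m / ker h`. -/
def IsRepresentatives {n m : ℕ} (d : ℕ) (a : Fin m → Fin n → ℕ) (Q : Finset (Fin m → ℤ)) : Prop :=
  ∀ v : Fin m → ℤ, ∃! q, q ∈ Q ∧ hMap d a q = hMap d a v

open Classical in
/-- The set `P_c` of the representatives `p` for which no entry of `c + h(p)` is zero
modulo `d`. -/
def setP {n m : ℕ} (d : ℕ) (a : Fin m → Fin n → ℕ) (c : Fin n → ℕ) (Q : Finset (Fin m → ℤ)) :
    Finset (Fin m → ℤ) :=
  Q.filter fun p => ∀ j, (c j : ZMod d) + hMap d a p j ≠ 0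

end FermatPeriod

end

/-!
# Periods of a deformed Fermat hypersurface complement

The period is computed near the base point `z = (0, …, 0, 1, …, 1)` with principal logarithms, and
then continued analytically.

Near the base point the Fermat cycle itself lies in `U_z`. Over a simplex of this cycle, which is a
translate of the real simplex by roots of unity, the integral of `ω_c` is the polar coordinate form
of the integral of `y^c / (y_1 ⋯ y_n) exp (-F(y; z))` over the orthant
(`integral_orthantIntegrand`). Expanding `exp (-∑ z_i y^{a_i})` reduces the latter to products of
one-dimensional Gamma integrals (`hasSum_orthantTerm`). The alternating sum over the roots of unity
multiplies `Γ(b_j / d)`, `b = c + ∑ κ_i a_i`, by `e^{2πi b_j / d} - 1`, and the reflection formula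
turns this product into `2πi e^{πi b_j / d} / Γ(1 - b_j / d)`
(`sum_orthantTerm_eq_seriesTerm`). This gives the period as a series over `κ ∈ ℕ^m`
(`period_fermatCycle_eq_periodSeries`). The terms of the series are those of the Gamma series for
all `p ∈ P_c` together, as `κ` runs through the cosets of `ker h`; all other terms of the Gamma
series, and all other cosets, vanish by the poles of `Γ`
(`summable_gammaTerm_and_sum_gammaSeries`).

For the continuation, `ω_c` is closed, so that its periods only depend on homology classes. This is
Stokes' theorem on the standard simplex (`period_boundary`); closedness is Euler's equation for
the homogeneous coefficient of `ω_c` (`extDeriv_radialForm`). For a fixed chain the period is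
holomorphic in the parameters as long as the chain avoids the hypersurface
(`holomorphicOnLines_period`). The series is holomorphic on the whole region
`|z_i| < ε |z_{m+j}|` if `m ε ≤ 1` (`holomorphicOnLines_periodSeries`): it is dominated by the
expansion of the orthant integral with real parameters. By the identity theorem along paths, period
and series agree for every deformation of the Fermat cycle (`IsDeformation.period_eq`).

A deformation exists (`exists_isDeformation`): along the path `(0, s l)` of parameters the Fermat
cycle is rescaled by the diagonal matrices `exp (-s l_j / d)`, in small steps and moving one vertex
at a time. Each move is a homology by prisms, since the unwanted faces cancel in the alternating
sum (`homologousIn_scaledCycle_update`). The rescaled cycle then stays in `U_z` while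
`z_1, …, z_m` grow from `0` to their values.
-/

open MeasureTheory Set
open scoped ENNReal ContDiff Topology

noncomputable section

namespace FermatPeriod

/-! ### Integration in polar coordinates over an orthant -/

/-- The point of the hyperplane `∑ y_i = 1` whose coordinates other than the `j`-th are `s`. -/
def bary {k : ℕ} (j : Fin (k + 1)) (s : Fin k → ℝ) : Fin (k + 1) → ℝ :=
  j.insertNth (1 - ∑ i, s i) s

theorem simplexChart_eq_bary {k : ℕ} (s : Fin k → ℝ) : simplexChart s = bary 0 s := by
  simp [simplexChart, bary]

theorem sum_bary {k : ℕ} (j : Fin (k + 1)) (s : Fin k → ℝ) : ∑ i, bary j s i = 1 := by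
  rw [Fin.sum_univ_succAbove _ j]
  simp [bary]

theorem continuous_bary {k : ℕ} (j : Fin (k + 1)) : Continuous (bary (k := k) j) := by
  refine continuous_pi fun i => ?_
  rcases Fin.eq_self_or_eq_succAbove j i with rfl | ⟨i, rfl⟩
  · simp only [bary, Fin.insertNth_apply_same]; fun_prop
  · simp only [bary, Fin.insertNth_apply_succAbove]; fun_prop

theorem bary_nonneg {k : ℕ} (j : Fin (k + 1)) {s : Fin k → ℝ} (hs : s ∈ cornerSimplex k)
    (i : Fin (k + 1)) : 0 ≤ bary j s i := by
  rcases Fin.eq_self_or_eq_succAbove j i with rfl | ⟨i, rfl⟩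
  · simpa [bary] using hs.2
  · simpa [bary] using hs.1 i

theorem isClosed_cornerSimplex (k : ℕ) : IsClosed (cornerSimplex k) := by
  have : cornerSimplex k = (⋂ j, {s | 0 ≤ s j}) ∩ {s | ∑ j, s j ≤ 1} := by
    ext s; simp [cornerSimplex]
  rw [this]
  exact (isClosed_iInter fun j => isClosed_le continuous_const (continuous_apply j)).inter
    (isClosed_le (by fun_prop) continuous_const)

theorem measurableSet_cornerSimplex (k : ℕ) : MeasurableSet (cornerSimplex k) :=
  (isClosed_cornerSimplex k).measurableSet

theorem isCompact_cornerSimplex (k : ℕ) : IsCompact (cornerSimplex k) := by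
  refine (isCompact_univ_pi fun _ : Fin k =>
    isCompact_Icc (a := (0 : ℝ)) (b := 1)).of_isClosed_subset
    (isClosed_cornerSimplex k) fun s hs j _ => ⟨hs.1 j, ?_⟩
  exact (Finset.single_le_sum (fun i _ => hs.1 i) (Finset.mem_univ j)).trans hs.2

/-- The closed nonnegative orthant. -/
def orthant (k : ℕ) : Set (Fin k → ℝ) := {y | ∀ j, 0 ≤ y j}

theorem measurableSet_orthant (k : ℕ) : MeasurableSet (orthant k) := by
  have : orthant k = ⋂ j, {s | 0 ≤ s j} := by ext s; simp [orthant]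
  rw [this]
  exact (isClosed_iInter fun j => isClosed_le continuous_const (continuous_apply j)).measurableSet

theorem lintegral_comp_smul {k : ℕ} (f : (Fin k → ℝ) → ℝ≥0∞) (hf : Measurable f) {S : ℝ}
    (hS : 0 < S) : ENNReal.ofReal (S ^ k) * ∫⁻ s, f (S • s) = ∫⁻ s, f s := by
  have h := Measure.map_addHaar_smul (volume : Measure (Fin k → ℝ)) hS.ne'
  have h2 : ∫⁻ s, f (S • s) = ENNReal.ofReal |(S ^ k)⁻¹| * ∫⁻ s, f s := by
    rw [← lintegral_map hf (measurable_const_smul S), h]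
    simp
  rw [h2, ← mul_assoc, ← ENNReal.ofReal_mul (by positivity), abs_of_pos (by positivity),
    mul_inv_cancel₀ (by positivity), ENNReal.ofReal_one, one_mul]

/-- Integration over the orthant in the coordinates `y = S • bary j s`, where `S = ∑ y_i`. -/
theorem lintegral_orthant {k : ℕ} (j : Fin (k + 1)) (G : (Fin (k + 1) → ℝ) → ℝ≥0∞)
    (hG : Measurable G) :
    ∫⁻ y in orthant (k + 1), G y =
      ∫⁻ S in Ioi (0 : ℝ), ENNReal.ofReal (S ^ k) * ∫⁻ s in cornerSimplex k, G (S • bary j s) := by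
  set G' : (Fin (k + 1) → ℝ) → ℝ≥0∞ := (orthant (k + 1)).indicator G with hG'
  have hG'm : Measurable G' := hG.indicator (measurableSet_orthant _)
  have hins : Measurable fun p : ℝ × (Fin k → ℝ) =>
      (j.insertNth p.1 p.2 : Fin (k + 1) → ℝ) :=
    (MeasurableEquiv.piFinSuccAbove (fun _ : Fin (k + 1) => ℝ) j).symm.measurable
  rw [← lintegral_indicator (measurableSet_orthant _)]
  have e1 : ∫⁻ y, G' y = ∫⁻ p : ℝ × (Fin k → ℝ), G' (j.insertNth p.1 p.2) :=
    (((volume_preserving_piFinSuccAbove (fun _ => ℝ) j).symm _).lintegral_comp hG'm).symm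
  rw [e1, Measure.volume_eq_prod,
    lintegral_prod_symm (fun p : ℝ × (Fin k → ℝ) => G' (j.insertNth p.1 p.2))
      (hG'm.comp hins).aemeasurable]
  -- for fixed `s`, replace the `j`-th coordinate by the sum `S` of all coordinates
  have e2 : ∀ s : Fin k → ℝ, ∫⁻ t : ℝ, G' (j.insertNth t s) =
      ∫⁻ S : ℝ, G' (j.insertNth (S - ∑ i, s i) s) := fun s =>
    (lintegral_sub_right_eq_self (fun t : ℝ => G' (j.insertNth t s)) (∑ i, s i)).symm
  simp only [e2]
  have hins2 : Measurable fun p : ℝ × (Fin k → ℝ) =>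
      (j.insertNth (p.1 - ∑ i, p.2 i) p.2 : Fin (k + 1) → ℝ) :=
    hins.comp (f := fun p : ℝ × (Fin k → ℝ) => (p.1 - ∑ i, p.2 i, p.2)) (by fun_prop)
  rw [lintegral_lintegral_swap (f := fun (s : Fin k → ℝ) (S : ℝ) =>
    G' (j.insertNth (S - ∑ i, s i) s))
    ((hG'm.comp hins2).comp measurable_swap).aemeasurable]
  rw [← lintegral_indicator measurableSet_Ioi]
  refine lintegral_congr_ae ?_
  have h0 : ∀ᵐ S : ℝ, S ≠ 0 := by simp [ae_iff]
  filter_upwards [h0] with S hS0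
  rcases lt_or_gt_of_ne hS0 with hS | hS
  · rw [indicator_of_notMem (by simp [hS.le])]
    have : ∀ s : Fin k → ℝ, G' (j.insertNth (S - ∑ i, s i) s) = 0 := by
      intro s
      refine indicator_of_notMem (fun h => ?_) _
      have h1 : 0 ≤ S - ∑ i, s i := by simpa using h j
      have h2 : 0 ≤ ∑ i, s i := Finset.sum_nonneg fun i _ => by simpa using h (j.succAbove i)
      linarith
    simp [this]
  · rw [indicator_of_mem (mem_Ioi.2 hS), ← lintegral_indicator (measurableSet_cornerSimplex k),
      ← lintegral_comp_smul (fun s => G' (j.insertNth (S - ∑ i, s i) s))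
        (hG'm.comp (hins2.comp measurable_prodMk_left)) hS]
    congr 1
    refine lintegral_congr fun s => ?_
    have e3 : (j.insertNth (S - ∑ i, (S • s) i) (S • s) : Fin (k + 1) → ℝ) = S • bary j s := by
      ext i
      rcases Fin.eq_self_or_eq_succAbove j i with rfl | ⟨i, rfl⟩
      · simp [bary, mul_sub, Finset.mul_sum]
      · simp [bary]
    simp only [e3]
    by_cases hs : s ∈ cornerSimplex k
    · rw [indicator_of_mem hs]
      have hmem : S • bary j s ∈ orthant (k + 1) :=
        fun i => mul_nonneg hS.le (bary_nonneg j hs i)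
      exact indicator_of_mem hmem _
    · rw [indicator_of_notMem hs]
      refine indicator_of_notMem (fun h => hs ?_) _
      have h' : ∀ i, 0 ≤ bary j s i := fun i => by
        have := h i
        simp only [Pi.smul_apply, smul_eq_mul] at this
        exact nonneg_of_mul_nonneg_right this hS
      exact ⟨fun i => by simpa [bary] using h' (j.succAbove i), by simpa [bary] using h' j⟩

/-- The measure `S^k dS` on the positive half-line. -/
def powMeasure (k : ℕ) : Measure ℝ :=
  (volume.restrict (Ioi (0 : ℝ))).withDensity fun S => ENNReal.ofReal (S ^ k)

instance (k : ℕ) : SFinite (powMeasure k) := by unfold powMeasure; infer_instance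

theorem measurable_smul_bary {k : ℕ} (j : Fin (k + 1)) :
    Measurable fun p : ℝ × (Fin k → ℝ) => p.1 • bary j p.2 := by
  have := continuous_bary (k := k) j
  exact Continuous.measurable (by fun_prop)

/-- The polar coordinates `(S, s) ↦ S • bary j s` on the orthant. -/
theorem measurePreserving_smul_bary {k : ℕ} (j : Fin (k + 1)) :
    MeasurePreserving (fun p : ℝ × (Fin k → ℝ) => p.1 • bary j p.2)
      ((powMeasure k).prod (volume.restrict (cornerSimplex k)))
      (volume.restrict (orthant (k + 1))) := by
  refine ⟨measurable_smul_bary j, ?_⟩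
  refine Measure.ext_of_lintegral _ fun G hG => ?_
  rw [lintegral_map hG (measurable_smul_bary j), lintegral_orthant j G hG,
    lintegral_prod (fun p : ℝ × (Fin k → ℝ) => G (p.1 • bary j p.2))
      (hG.comp (measurable_smul_bary j)).aemeasurable, powMeasure,
    lintegral_withDensity_eq_lintegral_mul _ (by fun_prop)]
  · rfl
  · exact Measurable.lintegral_prod_right' (hG.comp (measurable_smul_bary j))

theorem lintegral_bary_eq {k : ℕ} (i j : Fin (k + 1)) (g : (Fin (k + 1) → ℝ) → ℝ≥0∞)
    (hg : Measurable g) :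
    ∫⁻ s in cornerSimplex k, g (bary i s) = ∫⁻ s in cornerSimplex k, g (bary j s) := by
  -- integrate the extension of `g` that is constant on rays, cut off at `∑ y_i = 1`
  set G : (Fin (k + 1) → ℝ) → ℝ≥0∞ := {y | ∑ i, y i ≤ 1}.indicator
    fun y => g ((∑ i, y i)⁻¹ • y) with hG
  have hGm : Measurable G :=
    Measurable.indicator (hg.comp (by fun_prop)) (measurableSet_le (by fun_prop) measurable_const)
  have key : ∀ j, ∫⁻ y in orthant (k + 1), G y =
      (∫⁻ S in Ioc (0 : ℝ) 1, ENNReal.ofReal (S ^ k)) * ∫⁻ s in cornerSimplex k, g (bary j s) := by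
    intro j
    rw [lintegral_orthant j G hGm, ← lintegral_mul_const _ (by fun_prop),
      ← lintegral_indicator measurableSet_Ioi, ← lintegral_indicator measurableSet_Ioc]
    refine lintegral_congr fun S => ?_
    by_cases h0 : 0 < S
    swap
    · rw [indicator_of_notMem (by simpa using h0), indicator_of_notMem (by simp [h0])]
    have hsum : ∀ s, ∑ i, (S • bary j s) i = S := fun s => by
      simp only [Pi.smul_apply, smul_eq_mul, ← Finset.mul_sum, sum_bary, mul_one]
    by_cases h1 : S ≤ 1
    · rw [indicator_of_mem (mem_Ioi.2 h0), indicator_of_mem (mem_Ioc.2 ⟨h0, h1⟩)]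
      congr 1
      refine lintegral_congr fun s => ?_
      rw [hG, indicator_of_mem (by simpa only [mem_ofPred_eq, hsum] using h1), hsum, smul_smul,
        inv_mul_cancel₀ h0.ne', one_smul]
    · rw [indicator_of_mem (mem_Ioi.2 h0), indicator_of_notMem (by simp [h1])]
      have : ∀ s, G (S • bary j s) = 0 := fun s => by
        rw [hG, indicator_of_notMem (by simpa only [mem_ofPred_eq, hsum] using h1)]
      simp [this]
  have hc0 : (∫⁻ S in Ioc (0 : ℝ) 1, ENNReal.ofReal (S ^ k)) ≠ 0 := by
    refine (setLIntegral_pos_iff (by fun_prop)).2 ?_ |>.ne'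
    have : Ioc (0 : ℝ) 1 ⊆ Function.support (fun S : ℝ => ENNReal.ofReal (S ^ k)) ∩ Ioc 0 1 :=
      fun S hS => ⟨by simpa using pow_pos hS.1 k, hS⟩
    exact lt_of_lt_of_le (by simp) (measure_mono this)
  have hc1 : (∫⁻ S in Ioc (0 : ℝ) 1, ENNReal.ofReal (S ^ k)) ≠ ⊤ := by
    refine ne_top_of_le_ne_top (b := ∫⁻ S in Ioc (0 : ℝ) 1, 1) (by simp) ?_
    refine setLIntegral_mono measurable_const fun S hS => ?_
    simpa using pow_le_one₀ hS.1.le hS.2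
  have h := (key i).symm.trans (key j)
  exact (ENNReal.mul_right_inj hc0 hc1).1 h

theorem map_bary_eq {k : ℕ} (i j : Fin (k + 1)) :
    (volume.restrict (cornerSimplex k)).map (bary i) =
      (volume.restrict (cornerSimplex k)).map (bary j) := by
  refine Measure.ext_of_lintegral _ fun g hg => ?_
  rw [lintegral_map hg (continuous_bary i).measurable,
    lintegral_map hg (continuous_bary j).measurable, lintegral_bary_eq i j g hg]

theorem bary_mem_stdSimplex {k : ℕ} (j : Fin (k + 1)) {s : Fin k → ℝ} (hs : s ∈ cornerSimplex k) :
    bary j s ∈ stdSimplex ℝ (Fin (k + 1)) :=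
  ⟨bary_nonneg j hs, sum_bary j s⟩

/-- The integral over a face of a simplex does not depend on the barycentric coordinate that is
eliminated. -/
theorem integral_bary_eq {k : ℕ} (i j : Fin (k + 1)) (g : (Fin (k + 1) → ℝ) → ℂ)
    (hg : ContinuousOn g (stdSimplex ℝ (Fin (k + 1)))) :
    ∫ s in cornerSimplex k, g (bary i s) = ∫ s in cornerSimplex k, g (bary j s) := by
  have hm : ∀ j, AEStronglyMeasurable g ((volume.restrict (cornerSimplex k)).map (bary j)) := by
    intro j
    have hT : MeasurableSet (stdSimplex ℝ (Fin (k + 1))) := (isClosed_stdSimplex ℝ _).measurableSet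
    have h : ∀ᵐ y ∂((volume.restrict (cornerSimplex k)).map (bary j)),
        y ∈ stdSimplex ℝ (Fin (k + 1)) := by
      refine (ae_map_iff (continuous_bary j).aemeasurable hT).2 ?_
      exact (ae_restrict_iff' (measurableSet_cornerSimplex k)).2
        (Filter.Eventually.of_forall fun s hs => bary_mem_stdSimplex j hs)
    rw [← Measure.restrict_eq_self_of_ae_mem h]
    exact hg.aestronglyMeasurable hT
  rw [← integral_map (continuous_bary i).aemeasurable (hm i), map_bary_eq i j,
    integral_map (continuous_bary j).aemeasurable (hm j)]

/-! ### Stokes' theorem on the standard simplex -/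

theorem insertNth_mem_cornerSimplex {k : ℕ} (j : Fin (k + 1)) (t : ℝ) (s : Fin k → ℝ) :
    (j.insertNth t s : Fin (k + 1) → ℝ) ∈ cornerSimplex (k + 1) ↔
      s ∈ cornerSimplex k ∧ t ∈ Icc 0 (1 - ∑ i, s i) := by
  have h1 : (∀ i, 0 ≤ (j.insertNth t s : Fin (k + 1) → ℝ) i) ↔ 0 ≤ t ∧ ∀ i, 0 ≤ s i := by
    rw [Fin.forall_iff_succAbove j]; simp
  have h2 : ∑ i, (j.insertNth t s : Fin (k + 1) → ℝ) i = t + ∑ i, s i := by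
    rw [Fin.sum_univ_succAbove _ j]; simp
  change (_ ∧ _ ≤ _) ↔ (_ ∧ _ ≤ _) ∧ _
  rw [h1, h2, mem_Icc]
  constructor
  · rintro ⟨⟨h, h'⟩, h''⟩; exact ⟨⟨h', by linarith⟩, h, by linarith⟩
  · rintro ⟨⟨h, h'⟩, h'', h3⟩; exact ⟨⟨h'', h⟩, by linarith⟩

theorem hasDerivAt_insertNth {k : ℕ} (j : Fin (k + 1)) (s : Fin k → ℝ) (t : ℝ) :
    HasDerivAt (fun t : ℝ => (j.insertNth t s : Fin (k + 1) → ℝ)) (Pi.single j 1) t := by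
  rw [hasDerivAt_pi]
  intro i
  rcases Fin.eq_self_or_eq_succAbove j i with rfl | ⟨i, rfl⟩
  · simpa using hasDerivAt_id' t
  · simpa using hasDerivAt_const t (s i)

/-- The fundamental theorem of calculus in one coordinate, integrated over the simplex. -/
theorem integral_fderiv_cornerSimplex {k : ℕ} (j : Fin (k + 1)) (f : (Fin (k + 1) → ℝ) → ℂ)
    (hf : ∀ s ∈ cornerSimplex (k + 1), ContDiffAt ℝ 1 f s) :
    ∫ s in cornerSimplex (k + 1), fderiv ℝ f s (Pi.single j 1) =
      ∫ s in cornerSimplex k, (f (bary j s) - f (j.insertNth 0 s)) := by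
  have hcont : ContinuousOn (fun s => fderiv ℝ f s (Pi.single j 1)) (cornerSimplex (k + 1)) := by
    intro s hs
    have : ContinuousAt (fderiv ℝ f) s :=
      ((hf s hs).fderiv_right (m := 0) (by norm_num)).continuousAt
    exact (this.clm_apply continuousAt_const).continuousWithinAt
  have hint : IntegrableOn (fun s => fderiv ℝ f s (Pi.single j 1)) (cornerSimplex (k + 1)) :=
    hcont.integrableOn_compact (isCompact_cornerSimplex _)
  set g := (cornerSimplex (k + 1)).indicator fun s => fderiv ℝ f s (Pi.single j 1) with hg
  have hgint : Integrable g := hint.integrable_indicator (measurableSet_cornerSimplex _)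
  have hmp := (volume_preserving_piFinSuccAbove (fun _ : Fin (k + 1) => ℝ) j).symm
  rw [← integral_indicator (measurableSet_cornerSimplex _), ← hg,
    ← integral_indicator (measurableSet_cornerSimplex _)]
  have e1 : ∫ y, g y = ∫ p : ℝ × (Fin k → ℝ), g (j.insertNth p.1 p.2) :=
    (hmp.integral_comp' g).symm
  have hint2 : Integrable (fun p : ℝ × (Fin k → ℝ) => g (j.insertNth p.1 p.2)) :=
    (hmp.integrable_comp_emb (MeasurableEquiv.measurableEmbedding _)).2 hgint
  rw [e1, Measure.volume_eq_prod, integral_prod_symm _ hint2]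
  refine integral_congr_ae (Filter.Eventually.of_forall fun s => ?_)
  by_cases hs : s ∈ cornerSimplex k
  swap
  · rw [indicator_of_notMem hs]
    have : ∀ t, g (j.insertNth t s) = 0 := fun t =>
      indicator_of_notMem (fun h => hs ((insertNth_mem_cornerSimplex j t s).1 h).1) _
    simp [this]
  rw [indicator_of_mem hs]
  have e2 : (fun t => g (j.insertNth t s)) = (Icc 0 (1 - ∑ i, s i)).indicator
      fun t => fderiv ℝ f (j.insertNth t s) (Pi.single j 1) := by
    ext t
    by_cases ht : t ∈ Icc 0 (1 - ∑ i, s i)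
    · rw [indicator_of_mem ht]
      exact indicator_of_mem ((insertNth_mem_cornerSimplex j t s).2 ⟨hs, ht⟩) _
    · rw [indicator_of_notMem ht]
      exact indicator_of_notMem (fun h => ht ((insertNth_mem_cornerSimplex j t s).1 h).2) _
  have h0 : (0 : ℝ) ≤ 1 - ∑ i, s i := by linarith [hs.2]
  change ∫ t, g (j.insertNth t s) = _
  rw [e2, integral_indicator measurableSet_Icc, integral_Icc_eq_integral_Ioc,
    ← intervalIntegral.integral_of_le h0]
  have hmaps : MapsTo (fun t : ℝ => (j.insertNth t s : Fin (k + 1) → ℝ))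
      (Icc 0 (1 - ∑ i, s i)) (cornerSimplex (k + 1)) := fun t ht =>
    (insertNth_mem_cornerSimplex j t s).2 ⟨hs, ht⟩
  have hc : Continuous fun t : ℝ => (j.insertNth t s : Fin (k + 1) → ℝ) :=
    continuous_iff_continuousAt.2 fun t => (hasDerivAt_insertNth j s t).continuousAt
  refine intervalIntegral.integral_eq_sub_of_hasDerivAt
    (f := fun t : ℝ => f (j.insertNth t s)) ?_ ?_
  · intro t ht
    rw [uIcc_of_le h0] at ht
    exact (((hf _ (hmaps ht)).differentiableAt one_ne_zero).hasFDerivAt).comp_hasDerivAt t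
      (hasDerivAt_insertNth j s t)
  · refine ContinuousOn.intervalIntegrable ?_
    rw [uIcc_of_le h0]
    exact hcont.comp hc.continuousOn hmaps

/-- Stokes' theorem on the standard simplex, each face being parametrized by the coordinates of the
simplex that do not vanish identically on it; the face `∑ s_i = 1` appears once for each
coordinate that can be eliminated. -/
theorem integral_extDeriv_cornerSimplex {k : ℕ}
    (η : (Fin (k + 1) → ℝ) → (Fin (k + 1) → ℝ) [⋀^Fin k]→L[ℝ] ℂ)
    (e : Fin (k + 1) → Fin (k + 1) → ℝ) (he : e = fun i => Pi.single i 1)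
    (hη : ∀ s ∈ cornerSimplex (k + 1), DifferentiableAt ℝ η s)
    (hj : ∀ j : Fin (k + 1), ∀ s ∈ cornerSimplex (k + 1),
      ContDiffAt ℝ 1 (fun s => η s (j.removeNth e)) s) :
    ∫ s in cornerSimplex (k + 1), extDeriv η s e =
      ∑ j : Fin (k + 1), (-1 : ℂ) ^ (j : ℕ) *
        ∫ s in cornerSimplex k, (η (bary j s) (j.removeNth e) -
          η (j.insertNth 0 s) (j.removeNth e)) := by
  have e1 : ∫ s in cornerSimplex (k + 1), extDeriv η s e =
      ∫ s in cornerSimplex (k + 1), ∑ j : Fin (k + 1), (-1 : ℂ) ^ (j : ℕ) *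
        fderiv ℝ (fun s => η s (j.removeNth e)) s (Pi.single j 1) := by
    refine setIntegral_congr_fun (measurableSet_cornerSimplex _) fun s hs => ?_
    rw [extDeriv_apply (hη s hs)]
    refine Finset.sum_congr rfl fun j _ => ?_
    simp [he]
  rw [e1, integral_finsetSum]
  · refine Finset.sum_congr rfl fun j _ => ?_
    rw [integral_const_mul, integral_fderiv_cornerSimplex j _ (hj j)]
  · intro j _
    have hc : ContinuousOn (fun s => fderiv ℝ (fun s => η s (j.removeNth e)) s (Pi.single j 1))
        (cornerSimplex (k + 1)) := by
      intro s hs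
      have : ContinuousAt (fderiv ℝ (fun s => η s (j.removeNth e))) s :=
        ((hj j s hs).fderiv_right (m := 0) (by norm_num)).continuousAt
      exact (this.clm_apply continuousAt_const).continuousWithinAt
    exact Integrable.const_mul (hc.integrableOn_compact (isCompact_cornerSimplex _)) _

/-! ### Determinants -/

/-- The determinant of the `(k + 1) × (k + 1)` matrix with first row `y` and further rows `v`. -/
def consDet {k : ℕ} (y : Fin (k + 1) → ℂ) (v : Fin k → Fin (k + 1) → ℂ) : ℂ :=
  Matrix.det (Matrix.of (Fin.cons y v : Fin (k + 1) → Fin (k + 1) → ℂ))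

/-- The Euler form is minus the determinant with first row `y`: the signs of `Ω` start with `-1`,
those of the expansion along the first row with `+1`. -/
theorem eulerForm_eq_neg_consDet {k : ℕ} (y : Fin (k + 1) → ℂ) (v : Fin k → Fin (k + 1) → ℂ) :
    eulerForm y v = -consDet y v := by
  rw [eulerForm, consDet, Matrix.det_succ_row_zero, ← Finset.sum_neg_distrib]
  refine Finset.sum_congr rfl fun i _ => ?_
  rw [← Matrix.det_transpose, pow_succ]
  simp only [Matrix.of_apply, Fin.cons_zero, mul_neg, mul_one, neg_mul]
  rfl

/-- Multiplying the first row by `c`, and the other rows by `c` up to multiples of the first. -/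
theorem consDet_smul_add {k : ℕ} (c : ℂ) (μ : Fin k → ℂ) (y : Fin (k + 1) → ℂ)
    (v : Fin k → Fin (k + 1) → ℂ) :
    consDet (c • y) (fun i => c • v i + μ i • y) = c ^ (k + 1) * consDet y v := by
  by_cases hc : c = 0
  · subst hc
    rw [zero_smul, consDet, Matrix.det_eq_zero_of_row_eq_zero 0 (by simp)]
    simp
  have h1 : consDet (c • y) (fun i => c • v i + μ i • y) = consDet (c • y) (fun i => c • v i) := by
    refine Matrix.det_eq_of_forall_row_eq_smul_add_const
      (Fin.cons 0 fun i => μ i / c) 0 (by simp) fun i j => ?_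
    refine Fin.cases ?_ (fun i => ?_) i
    · simp
    · simp only [Matrix.of_apply, Fin.cons_succ, Fin.cons_zero, Pi.add_apply, Pi.smul_apply,
        smul_eq_mul]
      field_simp
  rw [h1, consDet, consDet]
  have : (Matrix.of (Fin.cons (c • y) (fun i => c • v i) : Fin (k + 1) → Fin (k + 1) → ℂ)) =
      c • Matrix.of (Fin.cons y v : Fin (k + 1) → Fin (k + 1) → ℂ) := by
    ext i j
    refine Fin.cases ?_ (fun i => ?_) i <;> simp
  rw [this, Matrix.det_smul, Fintype.card_fin]

/-- The alternating sum over the faces of a parallelepiped equals the value on the face spanned by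
the differences. -/
theorem sum_consDet_removeNth {k : ℕ} (y : Fin (k + 1) → ℂ)
    (D : Fin (k + 1) → Fin (k + 1) → ℂ) :
    ∑ j : Fin (k + 1), (-1 : ℂ) ^ (j : ℕ) * consDet y (j.removeNth D) =
      consDet y fun i => D i.succ - D 0 := by
  -- expand a bordered determinant along its first column, before and after the row of `D 0` is
  -- subtracted from the later ones
  set M : Matrix (Fin (k + 2)) (Fin (k + 2)) ℂ :=
    Matrix.of (Fin.cons (Fin.cons 0 y) fun i => Fin.cons 1 (D i)) with hM
  set M' : Matrix (Fin (k + 2)) (Fin (k + 2)) ℂ :=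
    Matrix.of (Fin.cons (Fin.cons 0 y) (Fin.cons (Fin.cons 1 (D 0))
      fun i : Fin k => Fin.cons 0 (D i.succ - D 0))) with hM'
  have h : M.det = M'.det := by
    refine Matrix.det_eq_of_forall_row_eq_smul_add_const
      (Fin.cons 0 (Fin.cons 0 fun _ => 1)) (Fin.succ 0) rfl fun i j => ?_
    refine Fin.cases ?_ (fun i => Fin.cases ?_ (fun i => ?_) i) i <;>
    refine Fin.cases ?_ (fun j => ?_) j <;> simp [hM, hM']
  have e1 : ∀ j : Fin (k + 1), (M.submatrix j.succ.succAbove Fin.succ).det =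
      consDet y (j.removeNth D) := by
    intro j
    refine congrArg Matrix.det ?_
    ext p q
    refine Fin.cases ?_ (fun p => ?_) p
    · simp [hM]
    · simp [hM, Fin.removeNth]
  have e2 : (M'.submatrix (Fin.succ 0).succAbove Fin.succ).det =
      consDet y fun i => D i.succ - D 0 := by
    refine congrArg Matrix.det ?_
    ext p q
    refine Fin.cases ?_ (fun p => ?_) p
    · simp [hM']
    · rw [Matrix.submatrix_apply, Fin.succ_succAbove_succ]; simp [hM']
  have hL : M.det = -∑ j : Fin (k + 1), (-1 : ℂ) ^ (j : ℕ) * consDet y (j.removeNth D) := by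
    rw [Matrix.det_succ_column_zero, Fin.sum_univ_succ, ← Finset.sum_neg_distrib]
    simp only [e1]
    simp [hM, pow_succ]
  have hR : M'.det = -consDet y fun i => D i.succ - D 0 := by
    rw [Matrix.det_succ_column_zero, Fin.sum_univ_succ, Fin.sum_univ_succ, e2]
    simp [hM']
  rw [hL, hR, neg_inj] at h
  exact h

/-- Cramer's rule, as the relation between the `k + 2` vectors `y, D 0, …, D k` in dimension
`k + 1`. -/
theorem sum_linear_mul_consDet_removeNth {k : ℕ} (φ : (Fin (k + 1) → ℂ) →ₗ[ℂ] ℂ)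
    (y : Fin (k + 1) → ℂ) (D : Fin (k + 1) → Fin (k + 1) → ℂ) :
    ∑ j : Fin (k + 1), (-1 : ℂ) ^ (j : ℕ) * (φ (D j) * consDet y (j.removeNth D)) =
      φ y * Matrix.det (Matrix.of D) := by
  set M : Matrix (Fin (k + 2)) (Fin (k + 2)) ℂ :=
    Matrix.of (Fin.cons (Fin.cons (φ y) y) fun i => Fin.cons (φ (D i)) (D i)) with hM
  -- the first column is a combination of the others
  have h : M.det = 0 := by
    refine Matrix.exists_mulVec_eq_zero_iff.1
      ⟨Fin.cons (-1) fun c => φ (Pi.single c 1), fun h => by simpa using congrFun h 0, ?_⟩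
    have hφ : ∀ x : Fin (k + 1) → ℂ, ∑ c, x c * φ (Pi.single c 1) = φ x := fun x => by
      rw [LinearMap.pi_apply_eq_sum_univ φ x]
      refine Finset.sum_congr rfl fun c _ => ?_
      rw [smul_eq_mul]; congr 2
      ext j; simp [Pi.single_apply, eq_comm]
    ext i
    rw [Matrix.mulVec, dotProduct, Fin.sum_univ_succ]
    refine Fin.cases ?_ (fun i => ?_) i <;> simp [hM, hφ]
  rw [Matrix.det_succ_column_zero, Fin.sum_univ_succ] at h
  have e1 : ∀ j : Fin (k + 1), (M.submatrix j.succ.succAbove Fin.succ).det =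
      consDet y (j.removeNth D) := by
    intro j
    refine congrArg Matrix.det ?_
    ext p q
    refine Fin.cases ?_ (fun p => ?_) p
    · simp [hM]
    · simp [hM, Fin.removeNth]
  have e2 : (M.submatrix (Fin.succAbove 0) Fin.succ).det = Matrix.det (Matrix.of D) := by
    refine congrArg Matrix.det ?_
    ext p q
    simp [hM]
  rw [e2] at h
  simp only [e1] at h
  simp only [hM, Matrix.of_apply, Fin.cons_zero, Fin.cons_succ, Fin.val_zero, Fin.val_succ,
    pow_zero, pow_succ, mul_neg, neg_mul, one_mul, mul_one, Finset.sum_neg_distrib] at h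
  rw [← sub_eq_zero, ← neg_eq_zero, neg_sub, sub_eq_add_neg]
  simpa only [mul_assoc] using h

/-- The determinant as a continuous alternating map. -/
def detForm (k : ℕ) : (Fin k → ℂ) [⋀^Fin k]→L[ℂ] ℂ :=
  { (Matrix.detRowAlternating : (Fin k → ℂ) [⋀^Fin k]→ₗ[ℂ] ℂ) with
    cont := by
      change Continuous fun M : Fin k → Fin k → ℂ => Matrix.det (Matrix.of M)
      exact Continuous.matrix_det (by exact continuous_id) }

theorem detForm_apply {k : ℕ} (M : Fin k → Fin k → ℂ) :
    detForm k M = Matrix.det (Matrix.of M) := rfl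

/-- The `k`-form `(v_1, …, v_k) ↦ g(x) det(x, v_1, …, v_k)`. -/
def radialForm {k : ℕ} (g : (Fin (k + 1) → ℂ) → ℂ) (x : Fin (k + 1) → ℂ) :
    (Fin (k + 1) → ℂ) [⋀^Fin k]→L[ℝ] ℂ :=
  ContinuousAlternatingMap.restrictScalarsLI ℝ (g x • (detForm (k + 1)).curryLeft x)

theorem contDiffAt_radialForm {k : ℕ} {g : (Fin (k + 1) → ℂ) → ℂ} {x : Fin (k + 1) → ℂ}
    {r : WithTop ℕ∞} (hg : ContDiffAt ℂ r g x) : ContDiffAt ℝ r (radialForm g) x := by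
  have h1 : ContDiffAt ℂ r (fun x => g x • (detForm (k + 1)).curryLeft x) x :=
    hg.smul (detForm (k + 1)).curryLeft.contDiff.contDiffAt
  have h2 : ContDiff ℝ r (ContinuousAlternatingMap.restrictScalarsLI ℝ :
      ((Fin (k + 1) → ℂ) [⋀^Fin k]→L[ℂ] ℂ) →ₗᵢ[ℝ] _) := LinearIsometry.contDiff _
  exact h2.contDiffAt.comp x (h1.restrict_scalars ℝ)

/-- The form is closed if `g` satisfies Euler's equation for homogeneity of degree `-(k + 1)`. -/
theorem extDeriv_radialForm {k : ℕ} {g : (Fin (k + 1) → ℂ) → ℂ} {x : Fin (k + 1) → ℂ}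
    (hg : ContDiffAt ℂ 1 g x) (hE : fderiv ℂ g x x = -(k + 1) * g x) :
    extDeriv (radialForm g) x = 0 := by
  ext D
  rw [extDeriv_apply ((contDiffAt_radialForm hg).differentiableAt one_ne_zero)]
  have hgd := (hg.differentiableAt one_ne_zero).hasFDerivAt
  have hd : ∀ i : Fin (k + 1), fderiv ℝ (fun y => radialForm g y (i.removeNth D)) x (D i) =
      fderiv ℂ g x (D i) * consDet x (i.removeNth D) + g x * consDet (D i) (i.removeNth D) := by
    intro i
    set L : (Fin (k + 1) → ℂ) →L[ℂ] ℂ :=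
      (ContinuousAlternatingMap.apply ℂ (Fin (k + 1) → ℂ) ℂ (i.removeNth D)).comp
        (detForm (k + 1)).curryLeft with hL
    have hLa : ∀ y, L y = consDet y (i.removeNth D) := fun y => rfl
    have h2 : HasFDerivAt (fun y => g y * L y) (g x • L + L x • fderiv ℂ g x) x :=
      hgd.mul L.hasFDerivAt
    have h3 := (h2.restrictScalars ℝ).fderiv
    have : (fun y => radialForm g y (i.removeNth D)) = fun y => g y * L y := rfl
    rw [this, h3]
    simp [← hLa]
    ring
  simp only [hd]
  have hC : ∑ i : Fin (k + 1), (-1 : ℂ) ^ (i : ℕ) * consDet (D i) (i.removeNth D) =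
      (k + 1) * Matrix.det (Matrix.of D) := by
    have := congrArg (fun f => f D)
      (ContinuousAlternatingMap.alternatizeUncurryFin_curryLeft (detForm (k + 1)))
    simp only [ContinuousAlternatingMap.alternatizeUncurryFin_apply] at this
    simpa [detForm_apply, consDet, Matrix.vecCons] using this
  have hB := sum_linear_mul_consDet_removeNth (fderiv ℂ g x : (Fin (k + 1) → ℂ) →ₗ[ℂ] ℂ) x D
  simp only [ContinuousLinearMap.coe_coe] at hB
  have : ∀ i : Fin (k + 1), (-1 : ℤ) ^ (i : ℕ) • (fderiv ℂ g x (D i) * consDet x (i.removeNth D) +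
      g x * consDet (D i) (i.removeNth D)) =
      (-1 : ℂ) ^ (i : ℕ) * (fderiv ℂ g x (D i) * consDet x (i.removeNth D)) +
      g x * ((-1 : ℂ) ^ (i : ℕ) * consDet (D i) (i.removeNth D)) := by
    intro i
    simp; ring
  simp only [this, Finset.sum_add_distrib, ← Finset.mul_sum, hB, hC, hE]
  simp; ring

/-! ### The rational forms and their integrals -/

section

variable {k m d : ℕ} {a : Fin m → Fin (k + 1) → ℕ}

theorem fermatDeformation_smul (ha : ∀ i, ∑ j, a i j = d) (z : Fin m ⊕ Fin (k + 1) → ℂ) (t : ℂ)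
    (x : Fin (k + 1) → ℂ) :
    fermatDeformation d a z (t • x) = t ^ d * fermatDeformation d a z x := by
  simp only [fermatDeformation, Pi.smul_apply, smul_eq_mul, mul_pow, Finset.prod_mul_distrib,
    Finset.prod_pow_eq_pow_sum, ha, mul_add, Finset.mul_sum]
  congr 1 <;> exact Finset.sum_congr rfl fun i _ => by ring

theorem mk_mem_hypersurfaceCompl (ha : ∀ i, ∑ j, a i j = d) (z : Fin m ⊕ Fin (k + 1) → ℂ)
    {x : Fin (k + 1) → ℂ} (hx : x ≠ 0) :
    Projectivization.mk ℂ x hx ∈ hypersurfaceCompl d a z ↔ fermatDeformation d a z x ≠ 0 := by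
  obtain ⟨u, hu⟩ := Projectivization.exists_smul_eq_mk_rep ℂ x hx
  change fermatDeformation d a z (Projectivization.mk ℂ x hx).rep ≠ 0 ↔ _
  rw [← hu, Units.smul_def, fermatDeformation_smul ha]
  simp

/-- The coefficient of `-det(x, ·)` in the form `ω_c`. -/
def omegaCoeff (d : ℕ) (a : Fin m → Fin (k + 1) → ℕ) (c : Fin (k + 1) → ℕ) (r : ℕ)
    (z : Fin m ⊕ Fin (k + 1) → ℂ) (x : Fin (k + 1) → ℂ) : ℂ :=
  (∏ j, x j ^ (c j - 1)) / fermatDeformation d a z x ^ r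

theorem omegaForm_eq (c : Fin (k + 1) → ℕ) (r : ℕ)
    (z : Fin m ⊕ Fin (k + 1) → ℂ) (x : Fin (k + 1) → ℂ) (v : Fin k → Fin (k + 1) → ℂ) :
    omegaForm d a c r z x v = -(omegaCoeff d a c r z x * consDet x v) := by
  rw [omegaForm, eulerForm_eq_neg_consDet, omegaCoeff, mul_neg]

/-- The coefficient of `det(x, ·)` is homogeneous of degree `-n`, which is where `|c| = d r`
enters. -/
theorem omegaCoeff_smul (ha : ∀ i, ∑ j, a i j = d) {c : Fin (k + 1) → ℕ} {r : ℕ}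
    (hc : ∀ j, 0 < c j) (hcr : ∑ j, c j = d * r) (z : Fin m ⊕ Fin (k + 1) → ℂ) {t : ℂ}
    (ht : t ≠ 0) (x : Fin (k + 1) → ℂ) :
    t ^ (k + 1) * omegaCoeff d a c r z (t • x) = omegaCoeff d a c r z x := by
  have h : k + 1 + ∑ j, (c j - 1) = d * r := by
    rw [← hcr]
    calc k + 1 + ∑ j, (c j - 1) = ∑ j : Fin (k + 1), (1 + (c j - 1)) := by
          rw [Finset.sum_add_distrib]; simp
      _ = _ := Finset.sum_congr rfl fun j _ => by have := hc j; omega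
  rw [omegaCoeff, omegaCoeff, fermatDeformation_smul ha]
  simp only [Pi.smul_apply, smul_eq_mul, mul_pow, Finset.prod_mul_distrib,
    Finset.prod_pow_eq_pow_sum]
  rw [← pow_mul, ← h, pow_add t (k + 1), mul_div_assoc', ← mul_assoc, mul_div_mul_left]
  exact mul_ne_zero (pow_ne_zero _ ht) (pow_ne_zero _ ht)

theorem contDiff_fermatDeformation (z : Fin m ⊕ Fin (k + 1) → ℂ) {r : WithTop ℕ∞} :
    ContDiff ℂ r (fermatDeformation d a z) := by
  unfold fermatDeformation
  refine (ContDiff.sum fun i _ => contDiff_const.mul (contDiff_prod fun j _ => ?_)).add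
    (ContDiff.sum fun j _ => contDiff_const.mul ?_) <;>
  exact (contDiff_apply ℂ ℂ j).pow _

theorem contDiffAt_omegaCoeff (c : Fin (k + 1) → ℕ) (q : ℕ) (z : Fin m ⊕ Fin (k + 1) → ℂ)
    {x : Fin (k + 1) → ℂ} (hx : fermatDeformation d a z x ≠ 0) {r : WithTop ℕ∞} :
    ContDiffAt ℂ r (omegaCoeff d a c q z) x := by
  unfold omegaCoeff
  refine ContDiffAt.div (ContDiff.contDiffAt (contDiff_prod fun j _ => ?_))
    ((contDiff_fermatDeformation z).contDiffAt.pow _) (pow_ne_zero _ hx)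
  exact (contDiff_apply ℂ ℂ j).pow _

/-- Euler's equation for the coefficient of `ω_c`. -/
theorem fderiv_omegaCoeff_self (ha : ∀ i, ∑ j, a i j = d) {c : Fin (k + 1) → ℕ} {r : ℕ}
    (hc : ∀ j, 0 < c j) (hcr : ∑ j, c j = d * r) (z : Fin m ⊕ Fin (k + 1) → ℂ)
    {x : Fin (k + 1) → ℂ} (hx : fermatDeformation d a z x ≠ 0) :
    fderiv ℂ (omegaCoeff d a c r z) x x = -(k + 1) * omegaCoeff d a c r z x := by
  set g := omegaCoeff d a c r z
  have hg : HasFDerivAt g (fderiv ℂ g x) ((1 : ℂ) • x) := by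
    rw [one_smul]
    exact ((contDiffAt_omegaCoeff c r z hx).differentiableAt one_ne_zero).hasFDerivAt
  have h1 : HasDerivAt (fun t : ℂ => g (t • x)) (fderiv ℂ g x x) 1 := by
    have h := (hasDerivAt_id' (1 : ℂ)).smul_const x
    rw [one_smul] at h
    exact hg.comp_hasDerivAt 1 h
  have h2 := (hasDerivAt_pow (k + 1) (1 : ℂ)).mul h1
  -- differentiate the constant function `t^(k + 1) g(t x)` at `t = 1`
  have h3 : (fun _ : ℂ => g x) =ᶠ[𝓝 1] (fun t => t ^ (k + 1)) * fun t : ℂ => g (t • x) := by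
    filter_upwards [isOpen_ne.mem_nhds (one_ne_zero : (1 : ℂ) ≠ 0)] with t ht
    exact (omegaCoeff_smul ha hc hcr z ht x).symm
  have h4 := (h2.congr_of_eventuallyEq h3).unique (hasDerivAt_const _ _)
  simp only [one_pow, mul_one, one_smul, one_mul] at h4
  push_cast at h4
  linear_combination h4

/-- The integral of the pullback of `ω_c` under a map `y` to `ℂⁿ`. -/
def liftPeriod (d : ℕ) (a : Fin m → Fin (k + 1) → ℕ) (c : Fin (k + 1) → ℕ) (r : ℕ)
    (z : Fin m ⊕ Fin (k + 1) → ℂ) (y : (Fin k → ℝ) → Fin (k + 1) → ℂ) : ℂ :=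
  ∫ s in cornerSimplex k, omegaForm d a c r z (y s) fun j => fderiv ℝ y s (Pi.single j 1)

theorem simplexChart_mem {s : Fin k → ℝ} (hs : s ∈ cornerSimplex k) :
    simplexChart s ∈ stdSimplex ℝ (Fin (k + 1)) := by
  rw [simplexChart_eq_bary]; exact bary_mem_stdSimplex 0 hs

theorem contDiff_simplexChart {r : WithTop ℕ∞} : ContDiff ℝ r (simplexChart (k := k)) := by
  rw [contDiff_pi]
  intro j
  refine Fin.cases ?_ (fun j => ?_) j
  · simp only [simplexChart, Fin.cons_zero]
    exact contDiff_const.sub (ContDiff.sum fun j _ => contDiff_apply ℝ ℝ j)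
  · simp only [simplexChart, Fin.cons_succ]
    exact contDiff_apply ℝ ℝ j

theorem convex_cornerSimplex (k : ℕ) : Convex ℝ (cornerSimplex k) := by
  have : cornerSimplex k = (⋂ j, {s | 0 ≤ s j}) ∩ {s | ∑ j, s j ≤ 1} := by
    ext s; simp [cornerSimplex]
  rw [this]
  refine (convex_iInter fun j => convex_halfSpace_ge ⟨fun _ _ => rfl, fun _ _ => rfl⟩ _).inter
    (convex_halfSpace_le ⟨fun x y => ?_, fun c x => ?_⟩ _)
  · simp [Finset.sum_add_distrib]
  · simp [Finset.mul_sum]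

theorem ae_mem_interior_cornerSimplex (k : ℕ) :
    ∀ᵐ s ∂(volume.restrict (cornerSimplex k)), s ∈ interior (cornerSimplex k) := by
  rw [ae_restrict_iff' (measurableSet_cornerSimplex k)]
  have h : ∀ᵐ s : Fin k → ℝ, s ∉ frontier (cornerSimplex k) :=
    measure_eq_zero_iff_ae_notMem.1 ((convex_cornerSimplex k).addHaar_frontier volume)
  filter_upwards [h] with s hs hsc
  by_contra hi
  exact hs ⟨subset_closure hsc, hi⟩

/-- The pullback of `ω_c` to the simplex does not depend on the lift. Two lifts differ by a smooth
factor `q`, and the derivative of `q` only contributes multiples of the first row of the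
determinant. The comparison is made in the interior, as the lifts are only related over the
simplex. -/
theorem simplexPeriod_eq_liftPeriod (ha : ∀ i, ∑ j, a i j = d) {c : Fin (k + 1) → ℕ} {r : ℕ}
    (hc : ∀ j, 0 < c j) (hcr : ∑ j, c j = d * r) (z : Fin m ⊕ Fin (k + 1) → ℂ)
    (σ : SmoothSimplex (k + 1) k) {x : (Fin (k + 1) → ℝ) → Fin (k + 1) → ℂ}
    (hx : IsSmoothLift σ.toFun x) :
    simplexPeriod d a c r z σ = liftPeriod d a c r z fun s => x (simplexChart s) := by
  rw [simplexPeriod, liftPeriod]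
  have hx' := σ.smooth.choose_spec
  set x' := σ.smooth.choose
  set u := fun s => x (simplexChart s) with hu
  set u' := fun s => x' (simplexChart s) with hu'
  have hud : Differentiable ℝ u :=
    (hx.1.comp contDiff_simplexChart).differentiable (by simp)
  have hud' : Differentiable ℝ u' :=
    (hx'.1.comp contDiff_simplexChart).differentiable (by simp)
  have hprop : ∀ s ∈ cornerSimplex k, u s ≠ 0 ∧ ∃ t : ℂ, t ≠ 0 ∧ u' s = t • u s := by
    intro s hs
    obtain ⟨h1, h2⟩ := hx.2 ⟨_, simplexChart_mem hs⟩
    obtain ⟨h3, h4⟩ := hx'.2 ⟨_, simplexChart_mem hs⟩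
    obtain ⟨t, ht⟩ := (Projectivization.mk_eq_mk_iff ℂ _ _ h3 h1).1 (h4.trans h2.symm)
    exact ⟨h1, t, t.ne_zero, ht.symm⟩
  refine integral_congr_ae ?_
  filter_upwards [ae_mem_interior_cornerSimplex k] with s hs
  obtain ⟨h0, t, ht, htu⟩ := hprop s (interior_subset hs)
  obtain ⟨j, hj⟩ : ∃ j, u s j ≠ 0 := by
    by_contra! h
    exact h0 (funext h)
  set q : (Fin k → ℝ) → ℂ := fun s => u' s j / u s j with hq
  have hcoord : ∀ s, DifferentiableAt ℝ (fun s => u s j) s := fun s =>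
    (differentiableAt_pi.1 (hud s)) j
  have hcoord' : ∀ s, DifferentiableAt ℝ (fun s => u' s j) s := fun s =>
    (differentiableAt_pi.1 (hud' s)) j
  have hqd : DifferentiableAt ℝ q s := by
    simp only [hq, div_eq_mul_inv]
    exact (hcoord' s).mul ((hcoord s).inv hj)
  have hqs : q s = t := by
    simp only [hq, htu, Pi.smul_apply, smul_eq_mul]
    field_simp
  have heq : u' =ᶠ[𝓝 s] fun s => q s • u s := by
    filter_upwards [isOpen_interior.mem_nhds hs,
      (hcoord s).continuousAt.eventually_ne hj] with s' hs' hj'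
    obtain ⟨-, t', -, ht'⟩ := hprop s' (interior_subset hs')
    have : q s' = t' := by
      simp only [hq, ht', Pi.smul_apply, smul_eq_mul]
      field_simp
    rw [this, ht']
  have hD : ∀ v, fderiv ℝ u' s v = t • fderiv ℝ u s v + (fderiv ℝ q s v) • u s := by
    intro v
    rw [heq.fderiv_eq, (hqd.hasFDerivAt.fun_smul (hud s).hasFDerivAt).fderiv, hqs]
    simp
  change omegaForm d a c r z (u' s) (fun j => fderiv ℝ u' s (Pi.single j 1)) =
    omegaForm d a c r z (u s) (fun j => fderiv ℝ u s (Pi.single j 1))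
  simp only [hD]
  rw [htu, omegaForm_eq, omegaForm_eq,
    consDet_smul_add t (fun j => fderiv ℝ q s (Pi.single j 1)), ← mul_assoc, mul_comm _ (t ^ _),
    omegaCoeff_smul ha hc hcr z ht]

end

/-! ### Periods over boundaries -/

section

theorem two_le_infty : (2 : WithTop ℕ∞) ≤ (⊤ : ℕ∞) :=
  WithTop.coe_le_coe.2 (le_top : (2 : ℕ∞) ≤ ⊤)

variable {k m d : ℕ} {a : Fin m → Fin (k + 1) → ℕ}

theorem IsSmoothLift.face {n q : ℕ} {σ : SmoothSimplex n (q + 1)}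
    {x : (Fin (q + 2) → ℝ) → Fin n → ℂ} (hx : IsSmoothLift σ.toFun x) (i : Fin (q + 2)) :
    IsSmoothLift (σ.face i).toFun fun t => x (i.insertNth (0 : ℝ) t) := by
  refine ⟨hx.1.comp ?_, fun t => hx.2 (faceMap i t)⟩
  rw [contDiff_pi]
  intro j
  rcases Fin.eq_self_or_eq_succAbove i j with rfl | ⟨j, rfl⟩
  · simpa using contDiff_const
  · simpa using contDiff_apply ℝ ℝ j

theorem fderiv_comp_insertNth {y : (Fin (k + 1) → ℝ) → Fin (k + 1) → ℂ}
    (hy : Differentiable ℝ y) (j : Fin (k + 1)) (s : Fin k → ℝ) (i : Fin k) :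
    fderiv ℝ (fun s : Fin k → ℝ => y (j.insertNth 0 s)) s (Pi.single i 1) =
      fderiv ℝ y (j.insertNth 0 s) (Pi.single (j.succAbove i) 1) := by
  set L : (Fin k → ℝ) →L[ℝ] Fin (k + 1) → ℝ := ContinuousLinearMap.pi
    (j.insertNth 0 fun i => ContinuousLinearMap.proj i) with hL
  have hLa : ∀ s : Fin k → ℝ, L s = j.insertNth 0 s := by
    intro s
    ext p
    rcases Fin.eq_self_or_eq_succAbove j p with rfl | ⟨p, rfl⟩ <;> simp [hL]
  have h : HasFDerivAt (fun s : Fin k → ℝ => y (j.insertNth 0 s))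
      ((fderiv ℝ y (j.insertNth 0 s)).comp L) s := by
    have h1 := (hy (L s)).hasFDerivAt.comp s L.hasFDerivAt
    simpa only [Function.comp_def, hLa] using h1
  rw [h.fderiv, ContinuousLinearMap.comp_apply, hLa]
  congr 1
  ext p
  rcases Fin.eq_self_or_eq_succAbove j p with rfl | ⟨p, rfl⟩
  · simp
  · simp [Pi.single_apply]

theorem fderiv_comp_bary_zero {y : (Fin (k + 1) → ℝ) → Fin (k + 1) → ℂ}
    (hy : Differentiable ℝ y) (s : Fin k → ℝ) (i : Fin k) :
    fderiv ℝ (fun s : Fin k → ℝ => y (bary 0 s)) s (Pi.single i 1) =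
      fderiv ℝ y (bary 0 s) (Pi.single i.succ 1) - fderiv ℝ y (bary 0 s) (Pi.single 0 1) := by
  set L : (Fin k → ℝ) →L[ℝ] Fin (k + 1) → ℝ := ContinuousLinearMap.pi
    (Fin.cons (-∑ i, ContinuousLinearMap.proj i) fun i => ContinuousLinearMap.proj i) with hL
  have hLa : ∀ s : Fin k → ℝ, bary 0 s = Pi.single 0 1 + L s := by
    intro s
    ext p
    refine Fin.cases ?_ (fun p => ?_) p <;> simp [hL, bary, sub_eq_add_neg]
  have h : HasFDerivAt (fun s : Fin k → ℝ => y (bary 0 s))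
      ((fderiv ℝ y (bary 0 s)).comp L) s := by
    have h2 : HasFDerivAt (fun s : Fin k → ℝ => bary 0 s) L s := by
      simp only [hLa]
      exact L.hasFDerivAt.const_add _
    exact (hy (bary 0 s)).hasFDerivAt.comp s h2
  rw [h.fderiv, ContinuousLinearMap.comp_apply, ← map_sub]
  congr 1
  ext p
  refine Fin.cases ?_ (fun p => ?_) p
  · simp [hL]
  · simp [hL, Pi.single_apply]

theorem bary_mem_cornerSimplex (j : Fin (k + 1)) {s : Fin k → ℝ} (hs : s ∈ cornerSimplex k) :
    bary j s ∈ cornerSimplex (k + 1) :=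
  ⟨bary_nonneg j hs, (sum_bary j s).le⟩

theorem insertNth_zero_mem_cornerSimplex (j : Fin (k + 1)) {s : Fin k → ℝ}
    (hs : s ∈ cornerSimplex k) : (j.insertNth 0 s : Fin (k + 1) → ℝ) ∈ cornerSimplex (k + 1) :=
  (insertNth_mem_cornerSimplex j 0 s).2 ⟨hs, le_rfl, by linarith [hs.2]⟩

theorem continuous_insertNth_zero (j : Fin (k + 1)) :
    Continuous fun s : Fin k → ℝ => (j.insertNth 0 s : Fin (k + 1) → ℝ) := by
  refine continuous_pi fun i => ?_
  rcases Fin.eq_self_or_eq_succAbove j i with rfl | ⟨i, rfl⟩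
  · simpa using continuous_const
  · simpa using continuous_apply i

/-- Stokes' theorem for the form `g(x) det(x, ·)` pulled back to a simplex. -/
theorem sum_integral_faces {g : (Fin (k + 1) → ℂ) → ℂ} {y : (Fin (k + 1) → ℝ) → Fin (k + 1) → ℂ}
    (hy : ContDiff ℝ (⊤ : ℕ∞) y)
    (hg : ∀ s ∈ cornerSimplex (k + 1), ContDiffAt ℂ (⊤ : ℕ∞) g (y s))
    (hE : ∀ s ∈ cornerSimplex (k + 1), fderiv ℂ g (y s) (y s) = -(k + 1) * g (y s)) :
    ∫ s in cornerSimplex k, g (y (bary 0 s)) * consDet (y (bary 0 s))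
        (fun i => fderiv ℝ (fun s => y (bary 0 s)) s (Pi.single i 1)) =
      ∑ j : Fin (k + 1), (-1 : ℂ) ^ (j : ℕ) * ∫ s in cornerSimplex k,
        g (y (j.insertNth 0 s)) * consDet (y (j.insertNth 0 s))
          (fun i => fderiv ℝ (fun s : Fin k → ℝ => y (j.insertNth 0 s)) s (Pi.single i 1)) := by
  have hyd : Differentiable ℝ y := hy.differentiable (by simp)
  set e : Fin (k + 1) → Fin (k + 1) → ℝ := fun i => Pi.single i 1 with he
  set D : (Fin (k + 1) → ℝ) → Fin (k + 1) → Fin (k + 1) → ℂ := fun s i => fderiv ℝ y s (e i)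
    with hD
  set η : (Fin (k + 1) → ℝ) → (Fin (k + 1) → ℝ) [⋀^Fin k]→L[ℝ] ℂ := fun s =>
    (radialForm g (y s)).compContinuousLinearMap (fderiv ℝ y s) with hη
  have hηa : ∀ (j : Fin (k + 1)) s, η s (j.removeNth e) =
      g (y s) * consDet (y s) (j.removeNth (D s)) := fun j s => rfl
  have hfy : ContDiff ℝ 1 (fderiv ℝ y) := hy.fderiv_right
    (by rw [one_add_one_eq_two]; exact two_le_infty)
  have hgy : ∀ s ∈ cornerSimplex (k + 1), ContDiffAt ℝ 1 (fun s => g (y s)) s := fun s hs =>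
    (((hg s hs).restrict_scalars ℝ).comp s hy.contDiffAt).of_le (by exact_mod_cast le_top)
  have hηd : ∀ s ∈ cornerSimplex (k + 1), DifferentiableAt ℝ η s := fun s hs =>
    DifferentiableAt.continuousAlternatingMapCompContinuousLinearMap
      (((contDiffAt_radialForm (hg s hs)).differentiableAt (by simp)).comp s (hyd s))
      (hfy.differentiable one_ne_zero s)
  have hdet : ∀ j : Fin (k + 1), ContDiff ℝ 1 fun s => consDet (y s) (j.removeNth (D s)) := by
    intro j
    have h1 : ContDiff ℝ 1 fun s => (Fin.cons (y s) (j.removeNth (D s)) :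
        Fin (k + 1) → Fin (k + 1) → ℂ) := by
      rw [contDiff_pi]
      intro p
      refine Fin.cases ?_ (fun p => ?_) p
      · simpa using hy.of_le (by exact_mod_cast le_top)
      · simpa [Fin.removeNth, hD] using hfy.clm_apply contDiff_const
    exact ((detForm (k + 1)).toContinuousMultilinearMap.contDiff.restrict_scalars ℝ).comp h1
  have hj : ∀ j : Fin (k + 1), ∀ s ∈ cornerSimplex (k + 1),
      ContDiffAt ℝ 1 (fun s => η s (j.removeNth e)) s := fun j s hs => by
    simp only [hηa]
    exact (hgy s hs).mul (hdet j).contDiffAt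
  have hcont : ∀ j : Fin (k + 1), ContinuousOn (fun s => η s (j.removeNth e))
      (cornerSimplex (k + 1)) := fun j s hs => (hj j s hs).continuousAt.continuousWithinAt
  have hclosed : ∀ s ∈ cornerSimplex (k + 1), extDeriv η s e = 0 := by
    intro s hs
    rw [hη, extDeriv_pullback ((contDiffAt_radialForm (hg s hs)).differentiableAt (by simp))
      (hy.contDiffAt (x := s)) (by simpa using two_le_infty),
      extDeriv_radialForm ((hg s hs).of_le (by exact_mod_cast le_top)) (hE s hs)]
    rfl
  have hS := integral_extDeriv_cornerSimplex η e he hηd hj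
  rw [setIntegral_congr_fun (measurableSet_cornerSimplex _) hclosed] at hS
  have hi1 : ∀ i j : Fin (k + 1), IntegrableOn (fun s => η (bary i s) (j.removeNth e))
      (cornerSimplex k) := fun i j =>
    ((hcont j).comp (continuous_bary i).continuousOn fun s hs =>
      bary_mem_cornerSimplex i hs).integrableOn_compact (isCompact_cornerSimplex k)
  have hi2 : ∀ j : Fin (k + 1), IntegrableOn (fun s => η (j.insertNth 0 s) (j.removeNth e))
      (cornerSimplex k) := fun j =>
    ((hcont j).comp (continuous_insertNth_zero j).continuousOn fun s hs =>
      insertNth_zero_mem_cornerSimplex j hs).integrableOn_compact (isCompact_cornerSimplex k)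
  have hstd : stdSimplex ℝ (Fin (k + 1)) ⊆ cornerSimplex (k + 1) := fun s hs => ⟨hs.1, hs.2.le⟩
  have hsplit : ∀ j : Fin (k + 1), ∫ s in cornerSimplex k, (η (bary j s) (j.removeNth e) -
      η (j.insertNth 0 s) (j.removeNth e)) =
      (∫ s in cornerSimplex k, η (bary 0 s) (j.removeNth e)) -
        ∫ s in cornerSimplex k, η (j.insertNth 0 s) (j.removeNth e) := by
    intro j
    rw [integral_sub (hi1 j j) (hi2 j),
      integral_bary_eq j 0 (fun s => η s (j.removeNth e)) ((hcont j).mono hstd)]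
  simp only [hsplit, mul_sub, Finset.sum_sub_distrib, integral_zero] at hS
  have hS' := sub_eq_zero.1 hS.symm
  have hR : ∀ (j : Fin (k + 1)) (s : Fin k → ℝ), g (y (j.insertNth 0 s)) *
      consDet (y (j.insertNth 0 s))
        (fun i => fderiv ℝ (fun s : Fin k → ℝ => y (j.insertNth 0 s)) s (Pi.single i 1)) =
      η (j.insertNth 0 s) (j.removeNth e) := by
    intro j s
    simp only [fderiv_comp_insertNth hyd]
    rw [hηa]; rfl
  simp only [hR]
  rw [← hS']
  simp only [← integral_const_mul]
  rw [← integral_finsetSum _ fun j _ => (hi1 0 j).const_mul _]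
  refine integral_congr_ae (Filter.Eventually.of_forall fun s => ?_)
  simp only [fderiv_comp_bary_zero hyd, hηa]
  rw [show (fun i : Fin k => fderiv ℝ y (bary 0 s) (Pi.single i.succ 1) -
    fderiv ℝ y (bary 0 s) (Pi.single 0 1)) = fun i => D (bary 0 s) i.succ - D (bary 0 s) 0 from rfl,
    ← sum_consDet_removeNth, Finset.mul_sum]
  exact Finset.sum_congr rfl fun j _ => by ring

theorem period_eq_sum (c : Fin (k + 1) → ℕ) (r : ℕ) (z : Fin m ⊕ Fin (k + 1) → ℂ)
    (δ : Chain (k + 1) k) :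
    period d a c r z δ = Finsupp.linearCombination ℚ (simplexPeriod d a c r z) δ := by
  rw [period, Finsupp.linearCombination_apply]
  exact Finset.sum_congr rfl fun σ _ => by simp [Rat.smul_def]

/-- Stokes' theorem for the closed form `ω_c` and one simplex in `U_z`. -/
theorem sum_simplexPeriod_face (ha : ∀ i, ∑ j, a i j = d) {c : Fin (k + 1) → ℕ} {r : ℕ}
    (hc : ∀ j, 0 < c j) (hcr : ∑ j, c j = d * r) (z : Fin m ⊕ Fin (k + 1) → ℂ)
    (σ : SmoothSimplex (k + 1) (k + 1)) (hσ : ∀ t, σ.toFun t ∈ hypersurfaceCompl d a z) :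
    ∑ i : Fin (k + 2), (-1 : ℂ) ^ (i : ℕ) * simplexPeriod d a c r z (σ.face i) = 0 := by
  obtain ⟨x, hx⟩ := σ.smooth
  set y : (Fin (k + 1) → ℝ) → Fin (k + 1) → ℂ := fun s => x (simplexChart s) with hy
  have hys : ContDiff ℝ (⊤ : ℕ∞) y := hx.1.comp contDiff_simplexChart
  have hF : ∀ s ∈ cornerSimplex (k + 1), fermatDeformation d a z (y s) ≠ 0 := by
    intro s hs
    obtain ⟨h1, h2⟩ := hx.2 ⟨_, simplexChart_mem hs⟩
    have h3 := hσ ⟨_, simplexChart_mem hs⟩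
    rw [← h2] at h3
    exact (mk_mem_hypersurfaceCompl ha z h1).1 h3
  have hS := sum_integral_faces (g := omegaCoeff d a c r z) hys
    (fun s hs => contDiffAt_omegaCoeff c r z (hF s hs))
    (fun s hs => fderiv_omegaCoeff_self ha hc hcr z (hF s hs))
  simp only [simplexPeriod_eq_liftPeriod ha hc hcr z _ (hx.face _)]
  have h0 : (fun s : Fin k → ℝ => x ((0 : Fin (k + 2)).insertNth 0 (simplexChart s))) =
      fun s => y (bary 0 s) := by
    ext1 s
    simp only [hy]
    rw [simplexChart_eq_bary s, simplexChart_eq_bary (bary 0 s), bary.eq_1 0 (bary 0 s),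
      sum_bary 0 s, sub_self]
  have h1 : ∀ j : Fin (k + 1), (fun s : Fin k → ℝ => x (j.succ.insertNth 0 (simplexChart s))) =
      fun s => y (j.insertNth 0 s) := by
    intro j
    ext1 s
    simp only [hy, simplexChart]
    rw [Fin.insertNth_succ_cons, Fin.sum_univ_succAbove _ j]
    simp
  rw [Fin.sum_univ_succ, h0]
  simp only [h1]
  simp only [liftPeriod, omegaForm_eq, integral_neg, Fin.val_zero, Fin.val_succ, pow_zero,
    one_mul, pow_succ, mul_neg, mul_one, neg_mul, neg_neg]
  rw [hS]
  simp

/-- Stokes' theorem for the closed form `ω_c` and a chain in `U_z`. -/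
theorem period_boundary (ha : ∀ i, ∑ j, a i j = d) {c : Fin (k + 1) → ℕ} {r : ℕ}
    (hc : ∀ j, 0 < c j) (hcr : ∑ j, c j = d * r) (z : Fin m ⊕ Fin (k + 1) → ℂ)
    (b : Chain (k + 1) (k + 1)) (hb : b.LiesIn (hypersurfaceCompl d a z)) :
    period d a c r z (boundary b) = 0 := by
  have h1 : boundary b = b.sum fun σ q =>
      q • ∑ i : Fin (k + 2), Finsupp.single (σ.face i) ((-1 : ℚ) ^ (i : ℕ)) :=
    Finsupp.linearCombination_apply _ _
  rw [period_eq_sum, h1, Finsupp.sum, map_sum]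
  refine Finset.sum_eq_zero fun σ hσ => ?_
  rw [map_smul, map_sum]
  have h := sum_simplexPeriod_face ha hc hcr z σ (hb σ hσ)
  simp only [Finsupp.linearCombination_single, Rat.smul_def]
  push_cast
  rw [h, mul_zero]

end

/-! ### Analytic continuation along paths -/

/-- The restrictions of `f` to the complex lines are holomorphic on the traces of `A`. This weak
form of holomorphy in several variables is enough for the identity theorem, and it only involves
one complex variable. -/
def HolomorphicOnLines {E : Type*} [NormedAddCommGroup E] [NormedSpace ℂ E] (f : E → ℂ)
    (A : Set E) : Prop :=
  ∀ c v : E, DifferentiableOn ℂ (fun t : ℂ => f (c + t • v)) {t | c + t • v ∈ A}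

section

variable {E : Type*} [NormedAddCommGroup E] [NormedSpace ℂ E] {f g : E → ℂ} {A : Set E}

theorem HolomorphicOnLines.mono (hf : HolomorphicOnLines f A) {B : Set E} (h : B ⊆ A) :
    HolomorphicOnLines f B :=
  fun c v => (hf c v).mono fun _ ht => h ht

/-- The identity theorem on a ball, by restriction to the line through `p` and the given point. -/
theorem HolomorphicOnLines.eqOn_ball {c : E} {ρ : ℝ} (hf : HolomorphicOnLines f (Metric.ball c ρ))
    (hg : HolomorphicOnLines g (Metric.ball c ρ)) {p : E} (hp : p ∈ Metric.ball c ρ)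
    (h : f =ᶠ[𝓝 p] g) : EqOn f g (Metric.ball c ρ) := by
  intro q hq
  set φ : ℂ → E := fun t => p + t • (q - p) with hφ
  have hφc : Continuous φ := by fun_prop
  have ho : IsOpen {t | φ t ∈ Metric.ball c ρ} := Metric.isOpen_ball.preimage hφc
  have hconv : Convex ℝ {t | φ t ∈ Metric.ball c ρ} := by
    intro t ht t' ht' α β hα hβ hαβ
    have h1 := convex_ball c ρ ht ht' hα hβ hαβ
    have h2 : φ (α • t + β • t') = α • φ t + β • φ t' := by
      have : p = α • p + β • p := by rw [← add_smul, hαβ, one_smul]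
      simp only [hφ, add_smul, smul_add, smul_assoc]
      nth_rewrite 1 [this]
      abel
    change φ _ ∈ Metric.ball c ρ
    rw [h2]; exact h1
  have h0 : φ 0 = p := by simp [hφ]
  have h1 : φ 1 = q := by simp [hφ]
  have key := AnalyticOnNhd.eqOn_of_preconnected_of_eventuallyEq
    ((hf p (q - p)).analyticOnNhd ho) ((hg p (q - p)).analyticOnNhd ho) hconv.isPreconnected
    (z₀ := 0) (by change φ 0 ∈ Metric.ball c ρ; rwa [h0])
    (by
      have : Filter.Tendsto φ (𝓝 0) (𝓝 p) := by simpa [h0] using hφc.tendsto 0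
      exact this.eventually h)
  have h2 := key (x := 1) (by change φ 1 ∈ Metric.ball c ρ; rwa [h1])
  change f (φ 1) = g (φ 1) at h2
  rwa [h1] at h2

/-- The identity theorem along a path. -/
theorem HolomorphicOnLines.eventuallyEq_of_joinedIn (hA : IsOpen A)
    (hf : HolomorphicOnLines f A) (hg : HolomorphicOnLines g A) {p p' : E}
    (hpp : JoinedIn A p p') (h : f =ᶠ[𝓝 p] g) : f =ᶠ[𝓝 p'] g := by
  obtain ⟨γ, hγ⟩ := hpp
  set T : Set unitInterval := {t | f =ᶠ[𝓝 (γ t)] g} with hT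
  have hopen : IsOpen T := by
    have : IsOpen {x : E | f =ᶠ[𝓝 x] g} := isOpen_setOfPred_eventually_nhds
    exact this.preimage γ.continuous
  have hclosed : IsClosed T := by
    refine isClosed_of_closure_subset fun t ht => ?_
    obtain ⟨ρ, hρ, hball⟩ := Metric.isOpen_iff.1 hA _ (hγ t)
    have hn : γ ⁻¹' Metric.ball (γ t) ρ ∈ 𝓝 t :=
      γ.continuous.continuousAt.preimage_mem_nhds (Metric.ball_mem_nhds _ hρ)
    obtain ⟨t', ht', ht'T⟩ := mem_closure_iff_nhds.1 ht _ hn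
    exact ((hf.mono hball).eqOn_ball (hg.mono hball) ht' ht'T).eventuallyEq_of_mem
      (Metric.ball_mem_nhds _ hρ)
  have hu : T = univ := IsClopen.eq_univ ⟨hclosed, hopen⟩ ⟨0, by simpa [hT] using h⟩
  have : (1 : unitInterval) ∈ T := hu ▸ mem_univ _
  simpa [hT] using this

end

/-! ### Dependence of the periods on the parameters -/

section

variable {k m d : ℕ} {a : Fin m → Fin (k + 1) → ℕ}

theorem continuous_fermatDeformation_toZ :
    Continuous fun w : Param (k + 1) m × (Fin (k + 1) → ℂ) =>
      fermatDeformation d a w.1.toZ w.2 := by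
  simp only [fermatDeformation, Param.toZ, Sum.elim_inl, Sum.elim_inr]
  fun_prop

/-- The condition that a simplex lies in `U_z`, in terms of a lift. -/
theorem liesIn_iff {n : ℕ} (ha : ∀ i, ∑ j, a i j = d) (z : Fin m ⊕ Fin (k + 1) → ℂ)
    (σ : SmoothSimplex (k + 1) n) {x : (Fin (n + 1) → ℝ) → Fin (k + 1) → ℂ}
    (hx : IsSmoothLift σ.toFun x) :
    (∀ t, σ.toFun t ∈ hypersurfaceCompl d a z) ↔
      ∀ t ∈ stdSimplex ℝ (Fin (n + 1)), fermatDeformation d a z (x t) ≠ 0 := by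
  constructor
  · intro h t ht
    obtain ⟨h1, h2⟩ := hx.2 ⟨t, ht⟩
    rw [← mk_mem_hypersurfaceCompl ha z h1, h2]
    exact h _
  · intro h t
    obtain ⟨h1, h2⟩ := hx.2 t
    rw [← h2, mk_mem_hypersurfaceCompl ha z h1]
    exact h _ t.2

/-- A chain in `U_z` stays in the complement of the hypersurface for parameters near `z`. -/
theorem eventually_liesIn {n : ℕ} (ha : ∀ i, ∑ j, a i j = d) {p : Param (k + 1) m}
    {δ : Chain (k + 1) n} (h : δ.LiesIn (hypersurfaceCompl d a p.toZ)) :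
    ∀ᶠ q : Param (k + 1) m in 𝓝 p, δ.LiesIn (hypersurfaceCompl d a q.toZ) := by
  unfold Chain.LiesIn
  rw [Filter.eventually_all_finset]
  intro σ hσ
  obtain ⟨x, hx⟩ := σ.smooth
  simp only [liesIn_iff ha _ σ hx]
  have h' := (liesIn_iff ha _ σ hx).1 (h σ hσ)
  refine (isCompact_stdSimplex ℝ (Fin (n + 1))).eventually_forall_of_forall_eventually
    fun t ht => ?_
  have hc : Continuous fun w : Param (k + 1) m × (Fin (n + 1) → ℝ) =>
      fermatDeformation d a w.1.toZ (x w.2) :=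
    continuous_fermatDeformation_toZ.comp
      (continuous_fst.prodMk (hx.1.continuous.comp continuous_snd))
  exact hc.continuousAt.eventually_ne (h' t ht)

theorem isOpen_nearFermat (n m : ℕ) (ε : ℝ) : IsOpen (nearFermat n m ε) := by
  have : nearFermat n m ε = ⋂ i, ⋂ j, {p : Param n m | ‖p.1 i‖ < ε * ‖Complex.exp (p.2 j)‖} := by
    ext p; simp [nearFermat, Param.toZ]
  rw [this]
  exact isOpen_iInter_of_finite fun i => isOpen_iInter_of_finite fun j =>
    isOpen_lt (by fun_prop) (by fun_prop)

theorem isOpen_liesIn {n : ℕ} (ha : ∀ i, ∑ j, a i j = d) (δ : Chain (k + 1) n) :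
    IsOpen {q : Param (k + 1) m | δ.LiesIn (hypersurfaceCompl d a q.toZ)} :=
  isOpen_iff_mem_nhds.2 fun _ hq => eventually_liesIn ha hq

theorem hasDerivAt_inv_pow (r : ℕ) {w : ℂ} (hw : w ≠ 0) :
    HasDerivAt (fun w : ℂ => (w ^ r)⁻¹) (-(r * w ^ (r - 1)) / (w ^ r) ^ 2) w :=
  (hasDerivAt_pow r w).inv (pow_ne_zero _ hw)

theorem continuous_consDet_fderiv {y : (Fin k → ℝ) → Fin (k + 1) → ℂ}
    (hy : ContDiff ℝ (⊤ : ℕ∞) y) :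
    Continuous fun s => consDet (y s) fun j => fderiv ℝ y s (Pi.single j 1) := by
  have h1 : Continuous fun s => (Fin.cons (y s) (fun j => fderiv ℝ y s (Pi.single j 1)) :
      Fin (k + 1) → Fin (k + 1) → ℂ) := by
    refine continuous_pi fun p => ?_
    refine Fin.cases ?_ (fun p => ?_) p
    · simpa using hy.continuous
    · simpa using (hy.continuous_fderiv (by simp)).clm_apply continuous_const
  exact (detForm (k + 1)).cont.comp h1

/-- Differentiation under the integral sign for `N / F_t^r` on a compact set without
zeros of `F`. -/
theorem differentiableAt_integral_mul_inv_pow {K : Set (Fin k → ℝ)} (hK : IsCompact K) (r : ℕ)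
    {F F' : ℂ → (Fin k → ℝ) → ℂ} {N : (Fin k → ℝ) → ℂ}
    (hFc : Continuous fun w : ℂ × (Fin k → ℝ) => F w.1 w.2)
    (hF'c : Continuous fun w : ℂ × (Fin k → ℝ) => F' w.1 w.2)
    (hFd : ∀ t s, HasDerivAt (fun t => F t s) (F' t s) t) (hNc : Continuous N) {t₀ : ℂ}
    (h : ∀ s ∈ K, F t₀ s ≠ 0) :
    DifferentiableAt ℂ (fun t : ℂ => ∫ s in K, N s * (F t s ^ r)⁻¹) t₀ := by
  have hKm : MeasurableSet K := hK.isClosed.measurableSet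
  set G' : ℂ → (Fin k → ℝ) → ℂ := fun t s =>
    N s * (-(r * F t s ^ (r - 1)) / (F t s ^ r) ^ 2 * F' t s) with hG'
  have hev : ∀ᶠ t in 𝓝 t₀, ∀ s ∈ K, F t s ≠ 0 :=
    hK.eventually_forall_of_forall_eventually fun s hs =>
      hFc.continuousAt.eventually_ne (h s hs)
  obtain ⟨ρ, hρ, hball⟩ := Metric.nhds_basis_closedBall.mem_iff.1 hev
  have hmeas : ∀ {g : (Fin k → ℝ) → ℂ}, ContinuousOn g K →
      AEStronglyMeasurable g (volume.restrict K) := fun hg => hg.aestronglyMeasurable hKm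
  have hGc : ∀ t ∈ Metric.closedBall t₀ ρ, ContinuousOn (fun s => N s * (F t s ^ r)⁻¹) K := by
    intro t ht
    have h1 : Continuous fun s => F t s := hFc.comp (by fun_prop : Continuous fun s => (t, s))
    exact hNc.continuousOn.mul ((h1.pow r).continuousOn.inv₀ fun s hs =>
      pow_ne_zero _ (hball ht s hs))
  have hG'c : ContinuousOn (fun w : ℂ × (Fin k → ℝ) => G' w.1 w.2)
      (Metric.closedBall t₀ ρ ×ˢ K) := by
    refine (hNc.comp continuous_snd).continuousOn.mul ((ContinuousOn.div ?_ ?_ ?_).mul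
      hF'c.continuousOn)
    · exact (continuous_const.mul (hFc.pow _)).neg.continuousOn
    · exact ((hFc.pow _).pow _).continuousOn
    · exact fun w hw => pow_ne_zero _ (pow_ne_zero _ (hball hw.1 w.2 hw.2))
  obtain ⟨C, hC⟩ := ((isCompact_closedBall t₀ ρ).prod hK).exists_bound_of_continuousOn hG'c
  have ht₀ : t₀ ∈ Metric.closedBall t₀ ρ := Metric.mem_closedBall_self hρ.le
  have hcomp : ∀ t s, F t s ≠ 0 → HasDerivAt (fun t => (F t s ^ r)⁻¹)
      (-(r * F t s ^ (r - 1)) / (F t s ^ r) ^ 2 * F' t s) t := fun t s h =>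
    HasDerivAt.comp (h := fun t => F t s) t (hasDerivAt_inv_pow r h) (hFd t s)
  have key := hasDerivAt_integral_of_dominated_loc_of_deriv_le (μ := volume.restrict K)
    (F := fun t s => N s * (F t s ^ r)⁻¹) (F' := G') (x₀ := t₀) (bound := fun _ => C)
    (Metric.closedBall_mem_nhds t₀ hρ)
    (Filter.eventually_of_mem (Metric.closedBall_mem_nhds t₀ hρ) fun t ht => hmeas (hGc t ht))
    ((hGc t₀ ht₀).integrableOn_compact hK)
    (hmeas (hG'c.comp (by fun_prop : Continuous fun s => (t₀, s)).continuousOn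
      fun s hs => ⟨ht₀, hs⟩))
    ((ae_restrict_iff' hKm).2
      (Filter.Eventually.of_forall fun s hs t ht => hC (t, s) ⟨ht, hs⟩))
    (integrableOn_const hK.measure_lt_top.ne)
    ((ae_restrict_iff' hKm).2
      (Filter.Eventually.of_forall fun s hs t ht =>
        (hcomp t s (hball ht s hs)).const_mul (N s)))
  exact key.2.differentiableAt

theorem hasDerivAt_fermatDeformation_toZ (p v : Param (k + 1) m) (x : Fin (k + 1) → ℂ) (t : ℂ) :
    HasDerivAt (fun t : ℂ => fermatDeformation d a (p + t • v : Param (k + 1) m).toZ x)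
      (∑ i, v.1 i * ∏ j, x j ^ a i j +
        ∑ j, (Complex.exp (p.2 j + t * v.2 j) * v.2 j) * x j ^ d) t := by
  simp only [fermatDeformation, Param.toZ, Sum.elim_inl, Sum.elim_inr, Prod.fst_add,
    Prod.snd_add, Prod.smul_fst, Prod.smul_snd, Pi.add_apply, Pi.smul_apply, smul_eq_mul]
  have hl : ∀ α β : ℂ, HasDerivAt (fun t : ℂ => α + t * β) β t := fun α β => by
    simpa using ((hasDerivAt_id' t).mul_const β).const_add α
  exact (HasDerivAt.fun_sum fun i _ => (hl _ _).mul_const _).fun_add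
    (HasDerivAt.fun_sum fun j _ => ((hl _ _).cexp).mul_const _)

theorem differentiableAt_liftPeriod (c : Fin (k + 1) → ℕ) (r : ℕ)
    {y : (Fin k → ℝ) → Fin (k + 1) → ℂ} (hy : ContDiff ℝ (⊤ : ℕ∞) y) (p v : Param (k + 1) m)
    (t₀ : ℂ) (h : ∀ s ∈ cornerSimplex k,
      fermatDeformation d a (p + t₀ • v : Param (k + 1) m).toZ (y s) ≠ 0) :
    DifferentiableAt ℂ
      (fun t : ℂ => liftPeriod d a c r (p + t • v : Param (k + 1) m).toZ y) t₀ := by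
  have hyc : Continuous y := hy.continuous
  have hFc : Continuous fun w : ℂ × (Fin k → ℝ) =>
      fermatDeformation d a (p + w.1 • v : Param (k + 1) m).toZ (y w.2) :=
    continuous_fermatDeformation_toZ.comp (f := fun w : ℂ × (Fin k → ℝ) =>
      ((p + w.1 • v : Param (k + 1) m), y w.2))
      (Continuous.prodMk (by fun_prop) (hyc.comp continuous_snd))
  have hNc : Continuous fun s => (∏ j, y s j ^ (c j - 1)) *
      -(consDet (y s) fun j => fderiv ℝ y s (Pi.single j 1)) :=
    (by fun_prop : Continuous fun s => ∏ j, y s j ^ (c j - 1)).mul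
      (continuous_consDet_fderiv hy).neg
  refine (differentiableAt_integral_mul_inv_pow (isCompact_cornerSimplex k) r hFc
    (F' := fun t s => ∑ i, v.1 i * ∏ j, y s j ^ a i j +
      ∑ j, (Complex.exp (p.2 j + t * v.2 j) * v.2 j) * y s j ^ d) (by fun_prop)
    (fun t s => hasDerivAt_fermatDeformation_toZ p v (y s) t) hNc h).congr_of_eventuallyEq
    (Filter.Eventually.of_forall fun t => ?_)
  refine integral_congr_ae (Filter.Eventually.of_forall fun s => ?_)
  simp only [omegaForm_eq, omegaCoeff]
  ring

/-- The integral of `ω_c` over a fixed chain is holomorphic in the parameters for which the chain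
avoids the hypersurface. -/
theorem holomorphicOnLines_period (ha : ∀ i, ∑ j, a i j = d) {c : Fin (k + 1) → ℕ} {r : ℕ}
    (hc : ∀ j, 0 < c j) (hcr : ∑ j, c j = d * r) (δ : Chain (k + 1) k) :
    HolomorphicOnLines (fun q : Param (k + 1) m => period d a c r q.toZ δ)
      {q | δ.LiesIn (hypersurfaceCompl d a q.toZ)} := by
  intro p v t ht
  refine DifferentiableAt.differentiableWithinAt ?_
  simp only [period, Finsupp.sum]
  refine DifferentiableAt.fun_sum fun σ hσ => DifferentiableAt.const_mul ?_ _
  obtain ⟨x, hx⟩ := σ.smooth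
  simp only [simplexPeriod_eq_liftPeriod ha hc hcr _ σ hx]
  refine differentiableAt_liftPeriod c r (hx.1.comp contDiff_simplexChart) p v t fun s hs => ?_
  exact (liesIn_iff ha _ σ hx).1 (ht σ hσ) _ (simplexChart_mem hs)

/-- Periods are invariant under homology and continue analytically under parallel transport: an
analytic function which agrees with the periods of the Fermat cycle near the base
point agrees with the periods of all its deformations. -/
theorem IsDeformation.period_eq (ha : ∀ i, ∑ j, a i j = d) {c : Fin (k + 1) → ℕ} {r : ℕ}
    (hc : ∀ j, 0 < c j) (hcr : ∑ j, c j = d * r) {ε : ℝ}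
    {R : Param (k + 1) m → ℂ} (hR : HolomorphicOnLines R (nearFermat (k + 1) m ε))
    (hbase : (fermatCycle k d).LiesIn
      (hypersurfaceCompl d a (Param.toZ ((0, 0) : Param (k + 1) m))))
    (hR0 : ∀ᶠ q : Param (k + 1) m in 𝓝 (0, 0), period d a c r q.toZ (fermatCycle k d) = R q)
    {p : Param (k + 1) m} {δ : Chain (k + 1) k} (hδ : IsDeformation d a ε p δ) :
    δ.LiesIn (hypersurfaceCompl d a p.toZ) ∧
      ∀ᶠ q : Param (k + 1) m in 𝓝 p, period d a c r q.toZ δ = R q := by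
  induction hδ with
  | base => exact ⟨hbase, hR0⟩
  | @homologous p δ δ' hδ hh ih =>
    obtain ⟨b, hb, hδb⟩ := hh
    have hadd : δ' = δ + boundary b := by rw [← hδb]; abel
    constructor
    · classical
      intro σ hσ t
      rw [hadd] at hσ
      rcases Finset.mem_union.1 (Finsupp.support_add hσ) with hσ | hσ
      · exact ih.1 σ hσ t
      · have h1 : boundary b = b.sum fun σ q =>
            q • ∑ i : Fin (k + 2), Finsupp.single (σ.face i) ((-1 : ℚ) ^ (i : ℕ)) :=
          Finsupp.linearCombination_apply _ _
        rw [h1] at hσ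
        obtain ⟨τ, hτ, hστ⟩ := Finset.mem_biUnion.1 (Finsupp.support_sum hσ)
        obtain ⟨i, -, hi⟩ := Finset.mem_biUnion.1
          (Finsupp.support_finsetSum (Finsupp.support_smul hστ))
        rw [Finset.mem_singleton.1 (Finsupp.support_single_subset hi)]
        exact hb τ hτ _
    · filter_upwards [ih.2, eventually_liesIn ha hb] with q hq hqb
      rw [← hq, hadd, period_eq_sum, map_add, ← period_eq_sum, ← period_eq_sum,
        period_boundary ha hc hcr _ _ hqb, add_zero]
  | @transport p p' δ hδ hj ih =>
    refine ⟨hj.target_mem.2, ?_⟩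
    exact HolomorphicOnLines.eventuallyEq_of_joinedIn
      ((isOpen_nearFermat _ _ ε).inter (isOpen_liesIn ha δ))
      ((holomorphicOnLines_period ha hc hcr δ).mono fun _ h => h.2) (hR.mono fun _ h => h.1)
      hj ih.2

end

/-! ### Gamma integrals -/

theorem integrableOn_pow_mul_exp (p : ℕ) {d : ℕ} (hd : 0 < d) {β : ℝ} (hβ : 0 < β) :
    IntegrableOn (fun y : ℝ => y ^ p * Real.exp (-β * y ^ d)) (Ioi 0) := by
  have h := integrableOn_rpow_mul_exp_neg_mul_rpow (s := p) (p := d) (b := β)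
    (by linarith [(Nat.cast_nonneg p : (0 : ℝ) ≤ p)]) (by exact_mod_cast hd) hβ
  simpa only [Real.rpow_natCast] using h

theorem norm_pow_mul_cexp (p d : ℕ) (w : ℂ) {y : ℝ} (hy : 0 ≤ y) :
    ‖(y : ℂ) ^ p * Complex.exp (-w * (y : ℂ) ^ d)‖ = y ^ p * Real.exp (-w.re * y ^ d) := by
  rw [norm_mul, norm_pow, Complex.norm_exp, Complex.norm_real, Real.norm_of_nonneg hy]
  congr 2
  rw [← Complex.ofReal_pow, Complex.re_mul_ofReal, Complex.neg_re]

theorem integrableOn_pow_mul_cexp (p : ℕ) {d : ℕ} (hd : 0 < d) {w : ℂ} (hw : 0 < w.re) :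
    IntegrableOn (fun y : ℝ => (y : ℂ) ^ p * Complex.exp (-w * (y : ℂ) ^ d)) (Ioi 0) := by
  refine (integrableOn_pow_mul_exp p hd hw).mono'
    (Continuous.aestronglyMeasurable (by fun_prop)) ?_
  refine (ae_restrict_iff' measurableSet_Ioi).2 (Filter.Eventually.of_forall fun y hy => ?_)
  exact (norm_pow_mul_cexp p d w (mem_Ioi.1 hy).le).le

theorem differentiableOn_integral_pow_mul_cexp (p : ℕ) {d : ℕ} (hd : 0 < d) :
    DifferentiableOn ℂ (fun w : ℂ => ∫ y : ℝ in Ioi 0, (y : ℂ) ^ p * Complex.exp (-w * (y : ℂ) ^ d))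
      {w | 0 < w.re} := by
  intro w₀ hw₀
  have hw₀' : 0 < w₀.re := hw₀
  have hs : {w : ℂ | w₀.re / 2 < w.re} ∈ 𝓝 w₀ :=
    (isOpen_lt continuous_const Complex.continuous_re).mem_nhds (half_lt_self hw₀')
  have key := hasDerivAt_integral_of_dominated_loc_of_deriv_le
    (μ := volume.restrict (Ioi (0 : ℝ)))
    (F := fun (w : ℂ) (y : ℝ) => (y : ℂ) ^ p * Complex.exp (-w * (y : ℂ) ^ d))
    (F' := fun (w : ℂ) (y : ℝ) => -((y : ℂ) ^ (p + d) * Complex.exp (-w * (y : ℂ) ^ d)))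
    (bound := fun y => y ^ (p + d) * Real.exp (-(w₀.re / 2) * y ^ d)) hs
    (Filter.Eventually.of_forall fun w => Continuous.aestronglyMeasurable (by fun_prop))
    (integrableOn_pow_mul_cexp p hd hw₀') (Continuous.aestronglyMeasurable (by fun_prop))
    ((ae_restrict_iff' measurableSet_Ioi).2 (Filter.Eventually.of_forall fun y hy w hw => ?_))
    (integrableOn_pow_mul_exp (p + d) hd (half_pos hw₀'))
    (Filter.Eventually.of_forall fun y w hw => ?_)
  · exact key.2.differentiableAt.differentiableWithinAt
  · have hy' : (0 : ℝ) ≤ y := (mem_Ioi.1 hy).le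
    rw [norm_neg, norm_pow_mul_cexp _ _ _ hy']
    have hw' : w₀.re / 2 ≤ w.re := le_of_lt hw
    gcongr
  · have h := ((((hasDerivAt_id' w).neg.mul_const ((y : ℂ) ^ d)).cexp).const_mul ((y : ℂ) ^ p))
    convert! h using 1
    simp only [Pi.neg_apply]
    ring

/-- The Gamma integral with a complex coefficient `w` in the exponent, by analytic continuation
from positive `w`. -/
theorem integral_pow_mul_cexp (p : ℕ) {d : ℕ} (hd : 0 < d) {w : ℂ} (hw : 0 < w.re) :
    ∫ y : ℝ in Ioi 0, (y : ℂ) ^ p * Complex.exp (-w * (y : ℂ) ^ d) =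
      1 / d * Complex.Gamma ((p + 1 : ℂ) / d) *
        Complex.exp (-((p + 1 : ℂ) / d) * Complex.log w) := by
  have ho : IsOpen {w : ℂ | 0 < w.re} := isOpen_lt continuous_const Complex.continuous_re
  have hconv : Convex ℝ {w : ℂ | 0 < w.re} := convex_halfSpace_re_gt 0
  have hR : DifferentiableOn ℂ (fun w : ℂ => 1 / d * Complex.Gamma ((p + 1 : ℂ) / d) *
      Complex.exp (-((p + 1 : ℂ) / d) * Complex.log w)) {w | 0 < w.re} := by
    intro w hw
    have : w ∈ Complex.slitPlane := Or.inl hw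
    exact ((((differentiableAt_id.clog this).const_mul _).cexp).const_mul
      _).differentiableWithinAt
  have hd' : (0 : ℝ) < d := by exact_mod_cast hd
  have hreal : ∀ β : ℝ, 0 < β →
      ∫ y : ℝ in Ioi 0, (y : ℂ) ^ p * Complex.exp (-(β : ℂ) * (y : ℂ) ^ d) =
      1 / d * Complex.Gamma ((p + 1 : ℂ) / d) *
        Complex.exp (-((p + 1 : ℂ) / d) * Complex.log β) := by
    intro β hβ
    have h := integral_rpow_mul_exp_neg_mul_rpow (p := d) (q := p) (b := β) hd'
      (by linarith [(Nat.cast_nonneg p : (0 : ℝ) ≤ p)]) hβ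
    simp only [Real.rpow_natCast] at h
    have h2 : ∫ y : ℝ in Ioi 0, (y : ℂ) ^ p * Complex.exp (-(β : ℂ) * (y : ℂ) ^ d) =
        ((∫ y : ℝ in Ioi 0, y ^ p * Real.exp (-β * y ^ d) : ℝ) : ℂ) := by
      rw [← integral_complex_ofReal]
      exact integral_congr_ae (Filter.Eventually.of_forall fun y => by simp)
    rw [h2, h, Real.rpow_def_of_pos hβ]
    push_cast
    rw [← Complex.Gamma_ofReal, Complex.ofReal_log hβ.le]
    push_cast
    rw [show (-(p + 1 : ℂ) / d) = -((p + 1 : ℂ) / d) by ring, mul_comm (Complex.log β)]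
    ring
  refine AnalyticOnNhd.eqOn_of_preconnected_of_frequently_eq
    ((differentiableOn_integral_pow_mul_cexp p hd).analyticOnNhd ho) (hR.analyticOnNhd ho)
    hconv.isPreconnected (z₀ := 1) (by simp) ?_ hw
  have ht : Filter.Tendsto (fun n : ℕ => ((1 + 1 / ((n : ℝ) + 1) : ℝ) : ℂ)) Filter.atTop
      (𝓝[≠] 1) := by
    refine tendsto_nhdsWithin_iff.2 ⟨?_, Filter.Eventually.of_forall fun n h => ?_⟩
    · have := (tendsto_one_div_add_atTop_nhds_zero_nat (𝕜 := ℝ)).const_add 1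
      rw [add_zero] at this
      exact_mod_cast (Complex.continuous_ofReal.tendsto (1 : ℝ)).comp this
    · have h1 : (1 + 1 / ((n : ℝ) + 1) : ℝ) = 1 :=
        Complex.ofReal_injective (h.trans Complex.ofReal_one.symm)
      have h2 : 0 < 1 / ((n : ℝ) + 1) := by positivity
      linarith
  refine ht.frequently (Filter.Frequently.of_forall fun n => ?_)
  exact hreal _ (by positivity)

theorem restrict_orthant (n : ℕ) : (volume : Measure (Fin n → ℝ)).restrict (orthant n) =
    Measure.pi fun _ => volume.restrict (Ioi (0 : ℝ)) := by
  have h : orthant n = Set.pi univ fun _ => Ici (0 : ℝ) := by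
    ext y; simp [orthant, Pi.le_def]
  rw [h, volume_pi, Measure.restrict_pi_pi]
  congr 1
  ext1 i
  exact restrict_Ioi_eq_restrict_Ici.symm

section

variable {n : ℕ}

theorem integrable_prod_pow_mul_cexp (b : Fin n → ℕ) {d : ℕ} (hd : 0 < d) {w : Fin n → ℂ}
    (hw : ∀ j, 0 < (w j).re) :
    IntegrableOn (fun y : Fin n → ℝ =>
      ∏ j, ((y j : ℂ) ^ (b j - 1) * Complex.exp (-w j * (y j : ℂ) ^ d))) (orthant n) := by
  rw [IntegrableOn, restrict_orthant]
  exact Integrable.fintype_prod fun j => integrableOn_pow_mul_cexp (b j - 1) hd (hw j)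

theorem integral_prod_pow_mul_cexp {b : Fin n → ℕ} (hb : ∀ j, 0 < b j) {d : ℕ} (hd : 0 < d)
    {w : Fin n → ℂ} (hw : ∀ j, 0 < (w j).re) :
    ∫ y in orthant n, ∏ j, ((y j : ℂ) ^ (b j - 1) * Complex.exp (-w j * (y j : ℂ) ^ d)) =
      ∏ j, (1 / d * Complex.Gamma ((b j : ℂ) / d) *
        Complex.exp (-((b j : ℂ) / d) * Complex.log (w j))) := by
  rw [restrict_orthant, integral_fintype_prod_eq_prod (μ := fun _ => volume.restrict (Ioi (0 : ℝ)))
    (fun j (y : ℝ) => (y : ℂ) ^ (b j - 1) * Complex.exp (-w j * (y : ℂ) ^ d))]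
  refine Finset.prod_congr rfl fun j _ => ?_
  rw [integral_pow_mul_cexp _ hd (hw j)]
  have : ((b j - 1 : ℕ) : ℂ) + 1 = b j := by
    exact_mod_cast congrArg (Nat.cast : ℕ → ℂ) (Nat.sub_add_cancel (hb j))
  rw [this]

end

/-! ### Products of exponential series -/

/-- A product of absolutely convergent series is the sum over all multi-indices. -/
theorem hasSum_pi_prod {m : ℕ} (f : Fin m → ℕ → ℂ) (hf : ∀ i, Summable fun e => ‖f i e‖) :
    (Summable fun κ : Fin m → ℕ => ‖∏ i, f i (κ i)‖) ∧
      HasSum (fun κ : Fin m → ℕ => ∏ i, f i (κ i)) (∏ i, ∑' e, f i e) := by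
  induction m with
  | zero =>
    have : (fun κ : Fin 0 → ℕ => ∏ i, f i (κ i)) = fun _ => 1 := by ext; simp
    simp only [this]
    exact ⟨(hasSum_unique _).summable, by simp⟩
  | succ m ih =>
    obtain ⟨h1, h2⟩ := ih (fun i => f i.succ) fun i => hf i.succ
    have hs := summable_mul_of_summable_norm (hf 0) h1
    have hsn := Summable.mul_norm (hf 0) h1
    have h3 := ((hf 0).of_norm.hasSum).mul h2 hs
    have he : ∀ κ : ℕ × (Fin m → ℕ), ∏ i, f i ((Fin.consEquiv fun _ => ℕ) κ i) =
        f 0 κ.1 * ∏ i : Fin m, f i.succ (κ.2 i) := fun κ => by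
      simp [Fin.consEquiv, Fin.prod_univ_succ]
    constructor
    · rw [← (Fin.consEquiv fun _ => ℕ).summable_iff]
      simpa only [Function.comp_def, he] using hsn
    · rw [← (Fin.consEquiv fun _ => ℕ).hasSum_iff, Fin.prod_univ_succ]
      simpa only [Function.comp_def, he] using h3

theorem hasSum_prod_exp {m : ℕ} (x : Fin m → ℂ) :
    HasSum (fun κ : Fin m → ℕ => ∏ i, (x i ^ κ i / (κ i).factorial : ℂ))
      (∏ i, Complex.exp (x i)) := by
  have h := (hasSum_pi_prod (fun i e => (x i ^ e / e.factorial : ℂ))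
    fun i => NormedSpace.norm_expSeries_div_summable (x i)).2
  have he : ∀ i, ∑' e : ℕ, (x i ^ e / e.factorial : ℂ) = Complex.exp (x i) := fun i => by
    rw [Complex.exp_eq_exp_ℂ, NormedSpace.exp_eq_tsum_div]
  simpa only [he] using h

theorem hasSum_prod_rexp {m : ℕ} (x : Fin m → ℝ) :
    HasSum (fun κ : Fin m → ℕ => ∏ i, (x i ^ κ i / (κ i).factorial : ℝ))
      (∏ i, Real.exp (x i)) := by
  have h := hasSum_prod_exp fun i => (x i : ℂ)
  rw [← Complex.hasSum_ofReal]
  simpa using h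

/-! ### The integral over the orthant -/

section

variable {k m d : ℕ} {a : Fin m → Fin (k + 1) → ℕ}

/-- A monomial of degree `d` is bounded by the Fermat polynomial. -/
theorem prod_pow_le_sum_pow {α : Fin (k + 1) → ℕ} (hα : ∑ j, α j = d) {y : Fin (k + 1) → ℝ}
    (hy : ∀ j, 0 ≤ y j) : ∏ j, y j ^ α j ≤ ∑ j, y j ^ d := by
  obtain ⟨j₀, -, hj₀⟩ := Finset.exists_max_image Finset.univ y Finset.univ_nonempty
  calc ∏ j, y j ^ α j ≤ ∏ j, y j₀ ^ α j :=
        Finset.prod_le_prod (fun j _ => pow_nonneg (hy j) _) fun j hj =>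
          pow_le_pow_left₀ (hy j) (hj₀ j hj) _
    _ = y j₀ ^ d := by rw [Finset.prod_pow_eq_pow_sum, hα]
    _ ≤ _ := Finset.single_le_sum (f := fun j => y j ^ d) (fun j _ => pow_nonneg (hy j) _)
        (Finset.mem_univ j₀)

/-- The exponents `c + ∑ κ_i a_i`. -/
def expVec (a : Fin m → Fin (k + 1) → ℕ) (c : Fin (k + 1) → ℕ) (κ : Fin m → ℕ)
    (j : Fin (k + 1)) : ℕ :=
  c j + ∑ i, κ i * a i j

theorem expVec_pos {c : Fin (k + 1) → ℕ} (hc : ∀ j, 0 < c j) (κ : Fin m → ℕ) (j : Fin (k + 1)) :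
    0 < expVec a c κ j := Nat.add_pos_left (hc j) _

theorem sum_expVec (ha : ∀ i, ∑ j, a i j = d) {c : Fin (k + 1) → ℕ} {r : ℕ}
    (hcr : ∑ j, c j = d * r) (κ : Fin m → ℕ) :
    ∑ j, expVec a c κ j = d * (r + ∑ i, κ i) := by
  simp only [expVec, Finset.sum_add_distrib, hcr, mul_add]
  rw [Finset.sum_comm]
  simp only [← Finset.mul_sum, ha]
  rw [Finset.mul_sum]
  congr 1
  exact Finset.sum_congr rfl fun i _ => mul_comm _ _

/-- The exponents `b - 1` are natural numbers because `c_j ≥ 1`. -/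
theorem prod_monomials {c : Fin (k + 1) → ℕ} (hc : ∀ j, 0 < c j) (κ : Fin m → ℕ)
    (y : Fin (k + 1) → ℂ) :
    (∏ i, (∏ j, y j ^ a i j) ^ κ i) * ∏ j, y j ^ (c j - 1) =
      ∏ j, y j ^ (expVec a c κ j - 1) := by
  simp only [← Finset.prod_pow, ← pow_mul]
  rw [Finset.prod_comm, ← Finset.prod_mul_distrib]
  refine Finset.prod_congr rfl fun j _ => ?_
  rw [Finset.prod_pow_eq_pow_sum, ← pow_add]
  congr 1
  have h : ∑ i, a i j * κ i = ∑ i, κ i * a i j := Finset.sum_congr rfl fun i _ => mul_comm _ _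
  have := hc j
  rw [expVec, h]
  omega

/-- The integrand `y^c / (y_1 ⋯ y_n) exp (-F(y; z))` of the orthant integral. -/
def orthantIntegrand (d : ℕ) (a : Fin m → Fin (k + 1) → ℕ) (c : Fin (k + 1) → ℕ)
    (z : Fin m ⊕ Fin (k + 1) → ℂ) (y : Fin (k + 1) → ℝ) : ℂ :=
  (∏ j, (y j : ℂ) ^ (c j - 1)) * Complex.exp (-fermatDeformation d a z fun j => (y j : ℂ))

/-- The term with index `κ` of the expansion of the orthant integral in powers of `z_1, …, z_m`:
a product of one-dimensional Gamma integrals. -/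
def orthantTerm (d : ℕ) (a : Fin m → Fin (k + 1) → ℕ) (c : Fin (k + 1) → ℕ)
    (z : Fin m ⊕ Fin (k + 1) → ℂ) (κ : Fin m → ℕ) : ℂ :=
  (∏ i, ((-z (Sum.inl i)) ^ κ i / (κ i).factorial : ℂ)) *
    ∏ j, (1 / d * Complex.Gamma ((expVec a c κ j : ℂ) / d) *
      Complex.exp (-((expVec a c κ j : ℂ) / d) * Complex.log (z (Sum.inr j))))

theorem sum_norm_mul_le (ha : ∀ i, ∑ j, a i j = d) (z : Fin m → ℂ) {y : Fin (k + 1) → ℝ}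
    (hy : ∀ j, 0 ≤ y j) :
    ∑ i, ‖z i * ∏ j, (y j : ℂ) ^ a i j‖ ≤ (∑ i, ‖z i‖) * ∑ j, y j ^ d := by
  rw [Finset.sum_mul]
  refine Finset.sum_le_sum fun i _ => ?_
  rw [norm_mul, norm_prod]
  refine mul_le_mul_of_nonneg_left ?_ (norm_nonneg _)
  calc ∏ j, ‖(y j : ℂ) ^ a i j‖ = ∏ j, y j ^ a i j :=
        Finset.prod_congr rfl fun j _ => by
          rw [norm_pow, Complex.norm_real, Real.norm_of_nonneg (hy j)]
    _ ≤ _ := prod_pow_le_sum_pow (ha i) hy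

/-- Expansion of the exponential of `-∑ z_i y^{a_i}` under the orthant integral. -/
theorem hasSum_orthantTerm (hd : 0 < d) (ha : ∀ i, ∑ j, a i j = d) {c : Fin (k + 1) → ℕ}
    (hc : ∀ j, 0 < c j) {z : Fin m ⊕ Fin (k + 1) → ℂ}
    (hz : ∀ j, ∑ i, ‖z (Sum.inl i)‖ < (z (Sum.inr j)).re) :
    IntegrableOn (orthantIntegrand d a c z) (orthant (k + 1)) ∧
      HasSum (orthantTerm d a c z) (∫ y in orthant (k + 1), orthantIntegrand d a c z y) := by
  set M := ∑ i, ‖z (Sum.inl i)‖ with hM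
  have hM0 : 0 ≤ M := Finset.sum_nonneg fun i _ => norm_nonneg _
  have hw : ∀ j, 0 < (z (Sum.inr j)).re := fun j => hM0.trans_lt (hz j)
  set P : (Fin (k + 1) → ℝ) → ℂ := fun y =>
    ∏ j, ((y j : ℂ) ^ (c j - 1) * Complex.exp (-z (Sum.inr j) * (y j : ℂ) ^ d)) with hP
  set u : Fin m → (Fin (k + 1) → ℝ) → ℂ := fun i y =>
    -z (Sum.inl i) * ∏ j, (y j : ℂ) ^ a i j with hu
  have hPc : Continuous P := by simp only [hP]; fun_prop
  have huc : ∀ i, Continuous (u i) := fun i => by simp only [hu]; fun_prop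
  set G : (Fin m → ℕ) → (Fin (k + 1) → ℝ) → ℂ := fun κ y =>
    (∏ i, (u i y ^ κ i / (κ i).factorial : ℂ)) * P y with hG
  have hGc : ∀ κ, Continuous (G κ) := fun κ => by simp only [hG]; fun_prop
  have hGe : ∀ κ y, G κ y = (∏ i, ((-z (Sum.inl i)) ^ κ i / (κ i).factorial : ℂ)) *
      ∏ j, ((y j : ℂ) ^ (expVec a c κ j - 1) *
        Complex.exp (-z (Sum.inr j) * (y j : ℂ) ^ d)) := by
    intro κ y
    simp only [hG, hu, hP, mul_pow, mul_div_right_comm, Finset.prod_mul_distrib]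
    rw [← prod_monomials hc κ fun j => (y j : ℂ)]
    ring
  have hsum : ∀ y, HasSum (fun κ => G κ y) (orthantIntegrand d a c z y) := by
    intro y
    have h := (hasSum_prod_exp fun i => u i y).mul_right (P y)
    convert! h using 1
    simp only [orthantIntegrand, fermatDeformation, hu, hP, Finset.prod_mul_distrib,
      ← Complex.exp_sum, neg_mul, Finset.sum_neg_distrib, neg_add, Complex.exp_add]
    ring
  have hnorm : ∀ κ y, ‖G κ y‖ = (∏ i, (‖u i y‖ ^ κ i / (κ i).factorial : ℝ)) * ‖P y‖ := by
    intro κ y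
    simp only [hG, norm_mul, norm_prod, norm_div, norm_pow, RCLike.norm_natCast]
  have hsumn : ∀ y, HasSum (fun κ => ‖G κ y‖) ((∏ i, Real.exp ‖u i y‖) * ‖P y‖) := by
    intro y
    simp only [hnorm]
    exact (hasSum_prod_rexp fun i => ‖u i y‖).mul_right _
  -- the sum of the norms is dominated by a product of one-dimensional integrands
  have hdom : IntegrableOn (fun y => (∏ i, Real.exp ‖u i y‖) * ‖P y‖) (orthant (k + 1)) := by
    have hI := (integrable_prod_pow_mul_cexp c hd (w := fun j => ((z (Sum.inr j)).re - M : ℝ))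
      fun j => by rw [Complex.ofReal_re]; linarith [hz j]).norm
    refine Integrable.mono' hI (Continuous.aestronglyMeasurable
      (by fun_prop)) ((ae_restrict_iff' (measurableSet_orthant _)).2
      (Filter.Eventually.of_forall fun y hy => ?_))
    rw [Real.norm_of_nonneg (by positivity)]
    have h1 : ∑ i, ‖u i y‖ ≤ M * ∑ j, y j ^ d := by
      have := sum_norm_mul_le ha (fun i => z (Sum.inl i)) hy
      simpa only [hu, neg_mul, norm_neg] using this
    rw [← Real.exp_sum]
    simp only [hP, norm_prod, norm_pow_mul_cexp _ _ _ (hy _), Complex.ofReal_re]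
    simp only [Finset.prod_mul_distrib, ← Real.exp_sum]
    rw [mul_left_comm, ← Real.exp_add]
    refine mul_le_mul_of_nonneg_left (Real.exp_le_exp.2 ?_)
      (Finset.prod_nonneg fun j _ => pow_nonneg (hy j) _)
    simp only [neg_sub, sub_mul, Finset.sum_sub_distrib, ← Finset.mul_sum, neg_mul,
      Finset.sum_neg_distrib]
    linarith
  have hint : IntegrableOn (orthantIntegrand d a c z) (orthant (k + 1)) := by
    refine Integrable.mono' hdom (Continuous.aestronglyMeasurable ?_)
      (Filter.Eventually.of_forall fun y => ?_)
    · unfold orthantIntegrand fermatDeformation; fun_prop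
    · rw [← (hsum y).tsum_eq, ← (hsumn y).tsum_eq]
      exact norm_tsum_le_tsum_norm (hsumn y).summable
  refine ⟨hint, ?_⟩
  have key := hasSum_integral_of_dominated_convergence (μ := volume.restrict (orthant (k + 1)))
    (F := G) (f := orthantIntegrand d a c z) (fun κ y => ‖G κ y‖)
    (fun κ => (hGc κ).aestronglyMeasurable)
    (fun κ => Filter.Eventually.of_forall fun y => le_rfl)
    (Filter.Eventually.of_forall fun y => (hsumn y).summable)
    (by simp only [(hsumn _).tsum_eq]; exact hdom)
    (Filter.Eventually.of_forall hsum)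
  have hterm : ∀ κ, ∫ y in orthant (k + 1), G κ y = orthantTerm d a c z κ := by
    intro κ
    simp only [hGe]
    rw [integral_const_mul, integral_prod_pow_mul_cexp (expVec_pos hc κ) hd hw]
    rfl
  simpa only [hterm] using key

/-- The orthant integral in polar coordinates: integration along the rays turns `exp (-F)` into
`F^{-r}` up to the factor `Γ(r) / d`, so that an integral of `ω_c` over a simplex remains. -/
theorem integral_orthantIntegrand (hd : 0 < d) (ha : ∀ i, ∑ j, a i j = d) {c : Fin (k + 1) → ℕ}
    {r : ℕ} (hc : ∀ j, 0 < c j) (hcr : ∑ j, c j = d * r) {z : Fin m ⊕ Fin (k + 1) → ℂ}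
    (hint : IntegrableOn (orthantIntegrand d a c z) (orthant (k + 1)))
    (hF : ∀ s ∈ cornerSimplex k, 0 < (fermatDeformation d a z fun j => (bary 0 s j : ℂ)).re) :
    ∫ y in orthant (k + 1), orthantIntegrand d a c z y =
      ((r - 1).factorial / d : ℂ) * ∫ s in cornerSimplex k,
        omegaCoeff d a c r z fun j => (bary 0 s j : ℂ) := by
  have hmp := measurePreserving_smul_bary (k := k) 0
  have hr : 0 < r := by
    rcases Nat.eq_zero_or_pos r with rfl | h
    · have := Finset.sum_eq_zero_iff.1 (hcr.trans (mul_zero d)) 0 (Finset.mem_univ _)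
      exact absurd this (hc 0).ne'
    · exact h
  have e1 : ∫ y in orthant (k + 1), orthantIntegrand d a c z y =
      ∫ p : ℝ × (Fin k → ℝ), orthantIntegrand d a c z (p.1 • bary 0 p.2)
        ∂((powMeasure k).prod (volume.restrict (cornerSimplex k))) := by
    rw [← hmp.map_eq, integral_map hmp.measurable.aemeasurable]
    rw [hmp.map_eq]; exact hint.aestronglyMeasurable
  have hint2 : Integrable (fun p : ℝ × (Fin k → ℝ) => orthantIntegrand d a c z (p.1 • bary 0 p.2))
      ((powMeasure k).prod (volume.restrict (cornerSimplex k))) :=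
    hmp.integrable_comp_of_integrable hint
  rw [e1, integral_prod_symm _ hint2, ← integral_const_mul]
  refine setIntegral_congr_fun (measurableSet_cornerSimplex k) fun s hs => ?_
  have hsum : k + ∑ j, (c j - 1) = d * r - 1 := by
    have : ∑ j : Fin (k + 1), (1 + (c j - 1)) = d * r := by
      rw [← hcr]
      exact Finset.sum_congr rfl fun j _ => by have := hc j; omega
    rw [Finset.sum_add_distrib] at this
    simp only [Finset.sum_const, Finset.card_univ, Fintype.card_fin, smul_eq_mul, mul_one] at this
    omega
  set x : Fin (k + 1) → ℂ := fun j => (bary 0 s j : ℂ) with hx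
  have hinner : ∀ S : ℝ, (ENNReal.ofReal (S ^ k)).toReal • orthantIntegrand d a c z (S • bary 0 s)
      = (ENNReal.ofReal (S ^ k)).toReal • ((S : ℂ) ^ (∑ j, (c j - 1)) * (∏ j, x j ^ (c j - 1)) *
        Complex.exp (-(fermatDeformation d a z x) * (S : ℂ) ^ d)) := by
    intro S
    have h1 : (fun j => (((S • bary 0 s) j : ℝ) : ℂ)) = (S : ℂ) • x := by
      ext j; simp [hx]
    have h2 : orthantIntegrand d a c z (S • bary 0 s) =
        (∏ j, ((S : ℂ) • x) j ^ (c j - 1)) *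
          Complex.exp (-fermatDeformation d a z ((S : ℂ) • x)) := by
      rw [← h1]; rfl
    rw [h2, fermatDeformation_smul ha]
    simp only [Pi.smul_apply, smul_eq_mul, mul_pow, Finset.prod_mul_distrib,
      Finset.prod_pow_eq_pow_sum]
    rw [neg_mul, mul_comm (fermatDeformation d a z x)]
  change ∫ S, orthantIntegrand d a c z (S • bary 0 s) ∂(powMeasure k) =
    ((r - 1).factorial / d : ℂ) * omegaCoeff d a c r z x
  rw [powMeasure, integral_withDensity_eq_integral_toReal_smul (by fun_prop) (by simp)]
  simp only [hinner]
  have e2 : ∫ S in Ioi (0 : ℝ), (ENNReal.ofReal (S ^ k)).toReal •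
      ((S : ℂ) ^ (∑ j, (c j - 1)) * (∏ j, x j ^ (c j - 1)) *
        Complex.exp (-(fermatDeformation d a z x) * (S : ℂ) ^ d)) =
      ∫ S : ℝ in Ioi 0, (∏ j, x j ^ (c j - 1)) * ((S : ℂ) ^ (d * r - 1) *
        Complex.exp (-(fermatDeformation d a z x) * (S : ℂ) ^ d)) := by
    refine setIntegral_congr_fun measurableSet_Ioi fun S hS => ?_
    have hS' : (0 : ℝ) < S := hS
    rw [ENNReal.toReal_ofReal (by positivity), ← hsum, pow_add, Complex.real_smul]
    push_cast
    ring
  have hdr : ((d * r - 1 : ℕ) : ℂ) + 1 = d * r := by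
    have : 0 < d * r := Nat.mul_pos hd hr
    exact_mod_cast congrArg (Nat.cast : ℕ → ℂ) (Nat.sub_add_cancel this)
  have hd' : (d : ℂ) ≠ 0 := by exact_mod_cast hd.ne'
  have hFne : fermatDeformation d a z x ≠ 0 := fun h => by
    have := hF s hs
    rw [← hx, h] at this
    simp at this
  rw [e2, integral_const_mul, integral_pow_mul_cexp _ hd (hF s hs), hdr,
    mul_div_cancel_left₀ _ hd', neg_mul, Complex.exp_neg, Complex.exp_nat_mul,
    Complex.exp_log hFne, omegaCoeff]
  obtain ⟨r', rfl⟩ := Nat.exists_eq_succ_of_ne_zero hr.ne'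
  have : Complex.Gamma ((r' + 1 : ℕ) : ℂ) = r'.factorial := by
    push_cast; exact Complex.Gamma_nat_eq_factorial r'
  rw [Nat.succ_eq_add_one, this, Nat.add_sub_cancel]
  ring

end

/-! ### The periods of the Fermat cycle -/

section

variable {k m d : ℕ} {a : Fin m → Fin (k + 1) → ℕ}

/-- The polynomial has positive real part on the closed orthant when the coefficients of the pure
powers dominate. -/
theorem re_fermatDeformation_pos (ha : ∀ i, ∑ j, a i j = d) {z : Fin m ⊕ Fin (k + 1) → ℂ}
    (hz : ∀ j, ∑ i, ‖z (Sum.inl i)‖ < (z (Sum.inr j)).re) {y : Fin (k + 1) → ℝ}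
    (hy : ∀ j, 0 ≤ y j) (hy0 : y ≠ 0) :
    0 < (fermatDeformation d a z fun j => (y j : ℂ)).re := by
  have h1 : -((∑ i, ‖z (Sum.inl i)‖) * ∑ j, y j ^ d) ≤
      (∑ i, z (Sum.inl i) * ∏ j, (y j : ℂ) ^ a i j).re := by
    refine neg_le_of_abs_le ((Complex.abs_re_le_norm _).trans ((norm_sum_le _ _).trans ?_))
    exact sum_norm_mul_le ha (fun i => z (Sum.inl i)) hy
  have h2 : (∑ j, z (Sum.inr j) * (y j : ℂ) ^ d).re = ∑ j, (z (Sum.inr j)).re * y j ^ d := by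
    rw [Complex.re_sum]
    refine Finset.sum_congr rfl fun j _ => ?_
    rw [← Complex.ofReal_pow, Complex.re_mul_ofReal]
  have h3 : (∑ i, ‖z (Sum.inl i)‖) * ∑ j, y j ^ d < ∑ j, (z (Sum.inr j)).re * y j ^ d := by
    rw [Finset.mul_sum]
    obtain ⟨j, hj⟩ : ∃ j, y j ≠ 0 := by
      by_contra! h
      exact hy0 (funext h)
    have hj' : 0 < y j := lt_of_le_of_ne (hy j) (Ne.symm hj)
    exact Finset.sum_lt_sum (fun j _ => mul_le_mul_of_nonneg_right (hz j).le (pow_nonneg (hy j) _))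
      ⟨j, Finset.mem_univ j, mul_lt_mul_of_pos_right (hz j) (pow_pos hj' _)⟩
  rw [fermatDeformation, Complex.add_re, h2]
  linarith

/-- The action on the parameters of the substitution `x_j ↦ ξ_j x_j`. -/
def twist (d : ℕ) (a : Fin m → Fin (k + 1) → ℕ) (ξ : Fin (k + 1) → ℂ)
    (z : Fin m ⊕ Fin (k + 1) → ℂ) : Fin m ⊕ Fin (k + 1) → ℂ :=
  Sum.elim (fun i => z (Sum.inl i) * ∏ j, ξ j ^ a i j) fun j => z (Sum.inr j) * ξ j ^ d

theorem fermatDeformation_twist (ξ : Fin (k + 1) → ℂ) (z : Fin m ⊕ Fin (k + 1) → ℂ)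
    (x : Fin (k + 1) → ℂ) :
    fermatDeformation d a (twist d a ξ z) x = fermatDeformation d a z fun j => ξ j * x j := by
  simp only [fermatDeformation, twist, Sum.elim_inl, Sum.elim_inr, mul_pow,
    Finset.prod_mul_distrib, mul_assoc]

theorem consDet_diagonal (ξ : Fin (k + 1) → ℂ) (hξ : ∀ j, ξ j ≠ 0) {y : Fin (k + 1) → ℂ}
    (hy : ∑ j, y j = 1) :
    consDet (fun j => ξ j * y j)
      (fun i : Fin k => Pi.single i.succ (ξ i.succ) - Pi.single 0 (ξ 0)) = ∏ j, ξ j := by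
  set D : Fin (k + 1) → Fin (k + 1) → ℂ := fun j => Pi.single j (ξ j)
  -- the functional which takes the value `1` on all rows of the diagonal matrix
  set φ : (Fin (k + 1) → ℂ) →ₗ[ℂ] ℂ := ∑ j, (ξ j)⁻¹ • LinearMap.proj j with hφ
  have h1 : ∀ j, φ (D j) = 1 := by
    intro j
    simp only [hφ, D, LinearMap.sum_apply, LinearMap.smul_apply, LinearMap.proj_apply, smul_eq_mul]
    rw [Finset.sum_eq_single j]
    · simp [hξ j]
    · intro i _ hi; simp [hi]
    · simp
  have h2 : φ (fun j => ξ j * y j) = 1 := by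
    simp only [hφ, LinearMap.sum_apply, LinearMap.smul_apply, LinearMap.proj_apply, smul_eq_mul,
      inv_mul_cancel_left₀ (hξ _), hy]
  have h3 := sum_linear_mul_consDet_removeNth φ (fun j => ξ j * y j) D
  simp only [h1, h2, one_mul, sum_consDet_removeNth] at h3
  have h4 : Matrix.of D = Matrix.diagonal ξ := by
    ext i j
    simp [D, Matrix.diagonal_apply, Pi.single_apply, eq_comm]
  rw [h4, Matrix.det_diagonal] at h3
  exact h3

/-- The integral over a diagonal translate of the real simplex is an integral over the real simplex
for the transformed parameters. -/
theorem liftPeriod_diagonal {c : Fin (k + 1) → ℕ} (hc : ∀ j, 0 < c j) (r : ℕ)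
    (z : Fin m ⊕ Fin (k + 1) → ℂ) (ξ : Fin (k + 1) → ℂ) (hξ : ∀ j, ξ j ≠ 0) :
    liftPeriod d a c r z (fun s j => ξ j * (simplexChart s j : ℂ)) =
      -((∏ j, ξ j ^ c j) * ∫ s in cornerSimplex k,
        omegaCoeff d a c r (twist d a ξ z) fun j => (bary 0 s j : ℂ)) := by
  rw [liftPeriod, ← integral_const_mul, ← integral_neg]
  refine integral_congr_ae (Filter.Eventually.of_forall fun s => ?_)
  simp only [simplexChart_eq_bary]
  set L : (Fin (k + 1) → ℝ) →L[ℝ] Fin (k + 1) → ℂ :=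
    ContinuousLinearMap.pi fun j => ξ j • Complex.ofRealCLM.comp (ContinuousLinearMap.proj j)
    with hL
  have hLa : ∀ v : Fin (k + 1) → ℝ, (fun j => ξ j * (v j : ℂ)) = L v := fun v => by
    ext j; simp [hL]
  have hs : ∀ i : Fin (k + 1), L (Pi.single i 1) = Pi.single i (ξ i) := by
    intro i
    rw [← hLa]
    ext j
    by_cases h : j = i
    · subst h; simp
    · simp [h]
  have hD : ∀ i : Fin k, fderiv ℝ (fun s (j : Fin (k + 1)) => ξ j * (bary 0 s j : ℂ)) s
      (Pi.single i 1) = Pi.single i.succ (ξ i.succ) - Pi.single 0 (ξ 0) := by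
    intro i
    have e : (fun s (j : Fin (k + 1)) => ξ j * (bary 0 s j : ℂ)) = fun s => L (bary 0 s) :=
      funext fun s => hLa _
    rw [e]
    rw [fderiv_comp_bary_zero L.differentiable s i, L.fderiv, hs, hs]
  simp only [hD]
  rw [omegaForm_eq, consDet_diagonal ξ hξ (by exact_mod_cast sum_bary 0 s), omegaCoeff, omegaCoeff,
    fermatDeformation_twist]
  have : ∏ j, ξ j ^ c j = (∏ j, ξ j ^ (c j - 1)) * ∏ j, ξ j := by
    rw [← Finset.prod_mul_distrib]
    refine Finset.prod_congr rfl fun j _ => ?_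
    rw [← pow_succ, Nat.sub_add_cancel (hc j)]
  rw [this]
  simp only [mul_pow, Finset.prod_mul_distrib]
  ring

/-- The diagonal entries of `∏_{i ∈ I} σ_i`. -/
def rootVec (d : ℕ) (I : Finset (Fin (k + 1))) (j : Fin (k + 1)) : ℂ :=
  if j ∈ I then Complex.exp (2 * Real.pi * Complex.I / d) else 1

theorem rootVec_ne_zero (I : Finset (Fin (k + 1))) (j : Fin (k + 1)) : rootVec d I j ≠ 0 := by
  unfold rootVec; split_ifs <;> simp

theorem rootVec_pow (hd : 0 < d) (I : Finset (Fin (k + 1))) (j : Fin (k + 1)) :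
    rootVec d I j ^ d = 1 := by
  unfold rootVec
  split_ifs
  · have : (d : ℂ) ≠ 0 := by exact_mod_cast hd.ne'
    rw [← Complex.exp_nat_mul, mul_div_cancel₀ _ this, Complex.exp_two_pi_mul_I]
  · simp

theorem norm_rootVec (hd : 0 < d) (I : Finset (Fin (k + 1))) (j : Fin (k + 1)) :
    ‖rootVec d I j‖ = 1 := by
  have h : ‖rootVec d I j‖ ^ d = 1 := by rw [← norm_pow, rootVec_pow hd, norm_one]
  exact (pow_eq_one_iff_of_nonneg (norm_nonneg _) hd.ne').1 h

theorem isSmoothLift_fermatSimplex (I : Finset (Fin (k + 1))) :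
    IsSmoothLift (fermatSimplex k d I).toFun fun t j => rootVec d I j * ((t j : ℝ) : ℂ) := by
  refine ⟨?_, fun t => ⟨?_, rfl⟩⟩
  · rw [contDiff_pi]
    intro j
    exact contDiff_const.mul (Complex.ofRealCLM.contDiff.comp (contDiff_apply ℝ ℝ j))
  · intro h
    have h0 : ∀ j, t.1 j = 0 := fun j => by
      have hj := congrFun h j
      simpa [rootVec_ne_zero] using hj
    have hs := t.2.2
    simp [h0] at hs

/-- The periods of the Fermat cycle as a sum over its simplices. The sign of `Ω = -det(x, ·)`
cancels the sign that expresses the orientation of `Δ`. -/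
theorem period_fermatCycle (ha : ∀ i, ∑ j, a i j = d) {c : Fin (k + 1) → ℕ} {r : ℕ}
    (hc : ∀ j, 0 < c j) (hcr : ∑ j, c j = d * r) (z : Fin m ⊕ Fin (k + 1) → ℂ) :
    period d a c r z (fermatCycle k d) = (d : ℂ) ^ k * ∑ I : Finset (Fin (k + 1)),
      (-1 : ℂ) ^ (k + 1 - I.card) * ((∏ j, rootVec d I j ^ c j) * ∫ s in cornerSimplex k,
        omegaCoeff d a c r (twist d a (rootVec d I) z) fun j => (bary 0 s j : ℂ)) := by
  rw [period_eq_sum, fermatCycle, map_smul, map_sum, Rat.smul_def]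
  push_cast
  rw [neg_mul, ← mul_neg, ← Finset.sum_neg_distrib]
  congr 1
  refine Finset.sum_congr rfl fun I _ => ?_
  rw [Finsupp.linearCombination_single, Rat.smul_def,
    simplexPeriod_eq_liftPeriod ha hc hcr z _ (isSmoothLift_fermatSimplex I),
    liftPeriod_diagonal hc r z _ (rootVec_ne_zero I)]
  push_cast
  ring

/-- The reflection formula, in a form which also holds at the integers, where both sides are `0`. -/
theorem Gamma_mul_sin (s : ℂ) (hs : 0 < s.re) :
    Complex.Gamma s * Complex.sin (Real.pi * s) = Real.pi / Complex.Gamma (1 - s) := by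
  have h := Complex.Gamma_mul_Gamma_one_sub s
  have hG := Complex.Gamma_ne_zero_of_re_pos hs
  have hpi : (Real.pi : ℂ) ≠ 0 := by exact_mod_cast Real.pi_ne_zero
  by_cases h0 : Complex.sin (Real.pi * s) = 0
  · rw [h0, div_zero] at h
    rw [h0, (mul_eq_zero.1 h).resolve_left hG, mul_zero, div_zero]
  · have h1 : Complex.Gamma (1 - s) ≠ 0 := by
      intro h1
      rw [h1, mul_zero] at h
      exact div_ne_zero hpi h0 h.symm
    rw [eq_div_iff h0] at h
    rw [eq_div_iff h1]
    linear_combination h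

/-- The factor of one coordinate: the difference of the integrals over two rays, rewritten with the
reflection formula. -/
theorem root_pow_sub_one_mul_Gamma (hd : 0 < d) {b : ℕ} (hb : 0 < b) :
    (Complex.exp (2 * Real.pi * Complex.I / d) ^ b - 1) * Complex.Gamma ((b : ℂ) / d) =
      2 * Real.pi * Complex.I * Complex.exp (Real.pi * Complex.I * b / d) /
        Complex.Gamma (1 - (b : ℂ) / d) := by
  have hs : 0 < ((b : ℂ) / d).re := by
    have : ((b : ℂ) / d) = ((b / d : ℝ) : ℂ) := by push_cast; rfl
    rw [this, Complex.ofReal_re]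
    have : (0 : ℝ) < d := by exact_mod_cast hd
    have : (0 : ℝ) < b := by exact_mod_cast hb
    positivity
  have h := Gamma_mul_sin _ hs
  set θ : ℂ := Real.pi * ((b : ℂ) / d) with hθ
  have h1 : Complex.exp (2 * Real.pi * Complex.I / d) ^ b =
      Complex.exp (θ * Complex.I) * Complex.exp (θ * Complex.I) := by
    rw [← Complex.exp_nat_mul, ← Complex.exp_add]
    congr 1
    rw [hθ]; ring
  have h2 : Complex.exp (Real.pi * Complex.I * b / d) = Complex.exp (θ * Complex.I) := by
    congr 1
    rw [hθ]; ring
  have h3 : Complex.exp (θ * Complex.I) * Complex.exp (-θ * Complex.I) = 1 := by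
    rw [← Complex.exp_add]; simp
  have h4 : Complex.exp (θ * Complex.I) * Complex.exp (θ * Complex.I) - 1 =
      2 * Complex.I * Complex.exp (θ * Complex.I) * Complex.sin θ := by
    rw [Complex.sin]
    linear_combination h3 + (-(Complex.exp (θ * Complex.I) * Complex.exp (-θ * Complex.I))
      + Complex.exp (θ * Complex.I) * Complex.exp (θ * Complex.I)) * Complex.I_sq
  rw [h1, h2, h4]
  calc _ = 2 * Complex.I * Complex.exp (θ * Complex.I) *
        (Complex.Gamma ((b : ℂ) / d) * Complex.sin θ) := by ring
    _ = _ := by rw [h]; ring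

/-- The term `z^γ / Γ(1 + γ)` with `γ = (κ, -(c + ∑ κ_i a_i) / d)`, the argument `q` holding
`z_1, …, z_m` and the logarithms of `z_{m+1}, …, z_{m+n}`. The sum over `κ` is the sum of all Gamma
series. -/
def seriesTerm (d : ℕ) (a : Fin m → Fin (k + 1) → ℕ) (c : Fin (k + 1) → ℕ) (κ : Fin m → ℕ)
    (q : Param (k + 1) m) : ℂ :=
  (∏ i, (q.1 i ^ κ i / (κ i).factorial : ℂ)) *
    ∏ j, (Complex.exp (-((expVec a c κ j : ℂ) / d) * q.2 j) /
      Complex.Gamma (1 - (expVec a c κ j : ℂ) / d))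

/-- A twist by roots of unity multiplies each term of the expansion by a root of unity. -/
theorem orthantTerm_twist (c : Fin (k + 1) → ℕ) {ξ : Fin (k + 1) → ℂ} (hξ : ∀ j, ξ j ^ d = 1)
    (z : Fin m ⊕ Fin (k + 1) → ℂ) (κ : Fin m → ℕ) :
    (∏ j, ξ j ^ c j) * orthantTerm d a c (twist d a ξ z) κ =
      (∏ j, ξ j ^ expVec a c κ j) * orthantTerm d a c z κ := by
  have h1 : ∏ j, ξ j ^ expVec a c κ j = (∏ j, ξ j ^ c j) * ∏ i, (∏ j, ξ j ^ a i j) ^ κ i := by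
    simp only [expVec, pow_add, Finset.prod_mul_distrib, ← Finset.prod_pow, ← pow_mul]
    rw [Finset.prod_comm (s := Finset.univ (α := Fin m))]
    congr 1
    refine Finset.prod_congr rfl fun j _ => ?_
    rw [Finset.prod_pow_eq_pow_sum]
    congr 1
    exact Finset.sum_congr rfl fun i _ => mul_comm _ _
  simp only [orthantTerm, twist, Sum.elim_inl, Sum.elim_inr, hξ, mul_one, ← neg_mul, mul_pow,
    mul_div_right_comm, Finset.prod_mul_distrib (f := fun i => (-z (Sum.inl i)) ^ κ i / _)]
  rw [h1]
  ring

/-- Expansion of `∏ (ζ^{b_j} - 1)` over the subsets of the set of coordinates. -/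
theorem sum_signs_prod (ζ : ℂ) (b : Fin (k + 1) → ℕ) :
    ∑ I : Finset (Fin (k + 1)), (-1 : ℂ) ^ (k + 1 - I.card) *
      ∏ j, (if j ∈ I then ζ else 1) ^ b j = ∏ j, (ζ ^ b j - 1) := by
  simp only [sub_eq_add_neg]
  rw [Finset.prod_add, Finset.powerset_univ]
  refine Finset.sum_congr rfl fun I _ => ?_
  rw [Finset.prod_const, ← Finset.compl_eq_univ_sdiff, Finset.card_compl, Fintype.card_fin,
    mul_comm]
  congr 1
  rw [← Finset.prod_subset (Finset.subset_univ I)]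
  · exact Finset.prod_congr rfl fun j hj => by rw [if_pos hj]
  · intro j _ hj; rw [if_neg hj, one_pow]

/-- The alternating sum over the roots of unity turns the factors `Γ(b_j / d)` into
`1 / Γ(1 - b_j / d)`. The factors `e^{πi b_j / d}` have product `(-1)^{r + |κ|}`, whose part
`(-1)^{|κ|}` cancels the signs of the exponential series. -/
theorem sum_orthantTerm_eq_seriesTerm (hd : 0 < d) (ha : ∀ i, ∑ j, a i j = d)
    {c : Fin (k + 1) → ℕ} {r : ℕ} (hc : ∀ j, 0 < c j) (hcr : ∑ j, c j = d * r)
    {q : Param (k + 1) m} (hq : ∀ j, Complex.log (Complex.exp (q.2 j)) = q.2 j) (κ : Fin m → ℕ) :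
    (d : ℂ) ^ (k + 1) * ∑ I : Finset (Fin (k + 1)), (-1 : ℂ) ^ (k + 1 - I.card) *
      ((∏ j, rootVec d I j ^ c j) * orthantTerm d a c (twist d a (rootVec d I) q.toZ) κ) =
      (-1) ^ r * (2 * Real.pi * Complex.I) ^ (k + 1) * seriesTerm d a c κ q := by
  have hd' : (d : ℂ) ≠ 0 := by exact_mod_cast hd.ne'
  simp only [orthantTerm_twist c (rootVec_pow hd _), ← mul_assoc, ← Finset.sum_mul]
  unfold rootVec
  rw [sum_signs_prod]
  have h1 : orthantTerm d a c q.toZ κ = (-1) ^ (∑ i, κ i) *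
      (∏ i, (q.1 i ^ κ i / (κ i).factorial : ℂ)) * ((1 / d) ^ (k + 1) *
      ((∏ j, Complex.Gamma ((expVec a c κ j : ℂ) / d)) *
      ∏ j, Complex.exp (-((expVec a c κ j : ℂ) / d) * q.2 j))) := by
    have e1 : ∀ i, (-q.toZ (Sum.inl i)) ^ κ i / (κ i).factorial =
        (-1) ^ κ i * (q.1 i ^ κ i / (κ i).factorial) := fun i => by
      rw [neg_pow]; simp only [Param.toZ, Sum.elim_inl]; ring
    rw [orthantTerm]
    simp only [e1]
    simp only [Param.toZ, Sum.elim_inr, hq, Finset.prod_mul_distrib, Finset.prod_const,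
      Finset.card_univ, Fintype.card_fin, Finset.prod_pow_eq_pow_sum]
    ring
  have h2 : (∏ j, (Complex.exp (2 * Real.pi * Complex.I / d) ^ expVec a c κ j - 1)) *
      (∏ j, Complex.Gamma ((expVec a c κ j : ℂ) / d)) =
      (2 * Real.pi * Complex.I) ^ (k + 1) * (-1) ^ (r + ∑ i, κ i) /
        ∏ j, Complex.Gamma (1 - (expVec a c κ j : ℂ) / d) := by
    rw [← Finset.prod_mul_distrib]
    simp only [root_pow_sub_one_mul_Gamma hd (expVec_pos hc κ _)]
    rw [Finset.prod_div_distrib, Finset.prod_mul_distrib, Finset.prod_const, Finset.card_univ,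
      Fintype.card_fin, ← Complex.exp_sum]
    congr 2
    have e2 : ∑ j, Real.pi * Complex.I * (expVec a c κ j : ℂ) / d =
        ((r + ∑ i, κ i : ℕ) : ℂ) * (Real.pi * Complex.I) := by
      have := congrArg (Nat.cast : ℕ → ℂ) (sum_expVec ha hcr κ)
      rw [← Finset.sum_div, ← Finset.mul_sum, ← Nat.cast_sum, this]
      push_cast
      field_simp
    rw [e2, Complex.exp_nat_mul, Complex.exp_pi_mul_I]
  have h3 : ((-1 : ℂ) ^ (∑ i, κ i)) * (-1) ^ (∑ i, κ i) = 1 := by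
    rw [← mul_pow]; simp
  have h4 : (d : ℂ) ^ (k + 1) * (1 / d) ^ (k + 1) = 1 := by
    rw [← mul_pow, mul_one_div_cancel hd', one_pow]
  have h5 : ∏ j, (Complex.exp (-((expVec a c κ j : ℂ) / d) * q.2 j) /
      Complex.Gamma (1 - (expVec a c κ j : ℂ) / d)) =
      (∏ j, Complex.exp (-((expVec a c κ j : ℂ) / d) * q.2 j)) /
        ∏ j, Complex.Gamma (1 - (expVec a c κ j : ℂ) / d) := Finset.prod_div_distrib ..
  rw [h1, seriesTerm, h5]
  set E := ∏ j, Complex.exp (-((expVec a c κ j : ℂ) / d) * q.2 j)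
  generalize ∏ i, (q.1 i ^ κ i / (κ i).factorial : ℂ) = Z
  calc _ = ((d : ℂ) ^ (k + 1) * (1 / d) ^ (k + 1)) * ((-1) ^ (∑ i, κ i) * Z * E *
        ((∏ j, (Complex.exp (2 * Real.pi * Complex.I / d) ^ expVec a c κ j - 1)) *
      (∏ j, Complex.Gamma ((expVec a c κ j : ℂ) / d)))) := by ring
    _ = ((-1) ^ (∑ i, κ i) * (-1) ^ (∑ i, κ i)) * ((-1) ^ r * (2 * Real.pi * Complex.I) ^ (k + 1) *
        (Z * (E / ∏ j, Complex.Gamma (1 - (expVec a c κ j : ℂ) / d)))) := by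
          rw [h4, h2, pow_add]; ring
    _ = _ := by rw [h3, one_mul]

/-- The sum of all Gamma series, with the factor of the period formula. -/
def periodSeries (d : ℕ) (a : Fin m → Fin (k + 1) → ℕ) (c : Fin (k + 1) → ℕ) (r : ℕ)
    (q : Param (k + 1) m) : ℂ :=
  (-1) ^ r / (r - 1).factorial * (2 * Real.pi * Complex.I) ^ (k + 1) *
    ∑' κ, seriesTerm d a c κ q

/-- The period formula near the base point, for the principal logarithms. -/
theorem period_fermatCycle_eq_periodSeries (hd : 0 < d) (ha : ∀ i, ∑ j, a i j = d)
    {c : Fin (k + 1) → ℕ} {r : ℕ} (hc : ∀ j, 0 < c j) (hcr : ∑ j, c j = d * r)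
    {q : Param (k + 1) m} (hq : ∀ j, Complex.log (Complex.exp (q.2 j)) = q.2 j)
    (hz : ∀ j, ∑ i, ‖q.1 i‖ < (Complex.exp (q.2 j)).re) :
    period d a c r q.toZ (fermatCycle k d) = periodSeries d a c r q := by
  have hd' : (d : ℂ) ≠ 0 := by exact_mod_cast hd.ne'
  have hf : ((r - 1).factorial : ℂ) ≠ 0 := by exact_mod_cast Nat.factorial_ne_zero _
  have hz' : ∀ (I : Finset (Fin (k + 1))) j, ∑ i, ‖twist d a (rootVec d I) q.toZ (Sum.inl i)‖ <
      (twist d a (rootVec d I) q.toZ (Sum.inr j)).re := by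
    intro I j
    simpa [twist, rootVec_pow hd, norm_rootVec hd, Param.toZ] using hz j
  have hI : ∀ I : Finset (Fin (k + 1)), HasSum
      (fun κ => (d / (r - 1).factorial : ℂ) * orthantTerm d a c (twist d a (rootVec d I) q.toZ) κ)
      (∫ s in cornerSimplex k,
        omegaCoeff d a c r (twist d a (rootVec d I) q.toZ) fun j => (bary 0 s j : ℂ)) := by
    intro I
    obtain ⟨h1, h2⟩ := hasSum_orthantTerm hd ha hc (hz' I)
    rw [integral_orthantIntegrand hd ha hc hcr h1 fun s hs => re_fermatDeformation_pos ha (hz' I)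
      (bary_nonneg 0 hs) fun h => by simpa [h] using sum_bary 0 s] at h2
    convert! h2.mul_left (d / (r - 1).factorial : ℂ) using 1
    field_simp
  have hS := (hasSum_sum (s := (Finset.univ : Finset (Finset (Fin (k + 1))))) fun I _ =>
    ((hI I).mul_left (∏ j, rootVec d I j ^ c j)).mul_left
      ((-1 : ℂ) ^ (k + 1 - I.card))).mul_left ((d : ℂ) ^ k)
  rw [← period_fermatCycle ha hc hcr] at hS
  have hterm : ∀ κ, (d : ℂ) ^ k * ∑ I : Finset (Fin (k + 1)), (-1 : ℂ) ^ (k + 1 - I.card) *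
      ((∏ j, rootVec d I j ^ c j) * ((d / (r - 1).factorial : ℂ) *
        orthantTerm d a c (twist d a (rootVec d I) q.toZ) κ)) =
      (-1) ^ r / (r - 1).factorial * (2 * Real.pi * Complex.I) ^ (k + 1) *
        seriesTerm d a c κ q := by
    intro κ
    have h := sum_orthantTerm_eq_seriesTerm hd ha hc hcr hq κ
    calc _ = (1 / (r - 1).factorial : ℂ) * ((d : ℂ) ^ (k + 1) * ∑ I : Finset (Fin (k + 1)),
          (-1 : ℂ) ^ (k + 1 - I.card) * ((∏ j, rootVec d I j ^ c j) *
            orthantTerm d a c (twist d a (rootVec d I) q.toZ) κ)) := by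
          simp only [Finset.mul_sum]
          refine Finset.sum_congr rfl fun I _ => ?_
          rw [pow_succ]; ring
      _ = _ := by rw [h]; ring
  simp only [hterm] at hS
  rw [← hS.tsum_eq, periodSeries, tsum_mul_left]

end

/-! ### Convergence and holomorphy of the series -/

section

variable {k m d : ℕ} {a : Fin m → Fin (k + 1) → ℕ}

theorem norm_inv_Gamma_one_sub_le {s : ℝ} (hs : 0 < s) :
    ‖(Complex.Gamma (1 - (s : ℂ)))⁻¹‖ ≤ ‖Complex.Gamma (s : ℂ)‖ := by
  have h := congrArg norm (Gamma_mul_sin (s : ℂ) (by simpa using hs))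
  have h1 : ‖Complex.sin (Real.pi * s)‖ ≤ 1 := by
    rw [← Complex.ofReal_mul, ← Complex.ofReal_sin, Complex.norm_real]
    exact Real.abs_sin_le_one _
  rw [norm_mul, div_eq_mul_inv, norm_mul, Complex.norm_real, Real.norm_of_nonneg Real.pi_pos.le]
    at h
  have h2 : 1 ≤ Real.pi := by linarith [Real.pi_gt_three]
  calc _ = 1 * ‖(Complex.Gamma (1 - (s : ℂ)))⁻¹‖ := (one_mul _).symm
    _ ≤ Real.pi * ‖(Complex.Gamma (1 - (s : ℂ)))⁻¹‖ :=
        mul_le_mul_of_nonneg_right h2 (norm_nonneg _)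
    _ = ‖Complex.Gamma (s : ℂ)‖ * ‖Complex.sin (Real.pi * s)‖ := h.symm
    _ ≤ _ := mul_le_of_le_one_right (norm_nonneg _) h1

/-- The series is dominated by the expansion of an orthant integral with real parameters, as
`|1 / Γ(1 - s)| ≤ Γ(s)` for `s > 0`. -/
theorem norm_seriesTerm_le (hd : 0 < d) {c : Fin (k + 1) → ℕ} (hc : ∀ j, 0 < c j)
    {q : Param (k + 1) m} {Z : Fin m → ℝ} {L : Fin (k + 1) → ℝ} (hZ : ∀ i, ‖q.1 i‖ ≤ Z i)
    (hL : ∀ j, L j ≤ (q.2 j).re) (κ : Fin m → ℕ) :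
    ‖seriesTerm d a c κ q‖ ≤ d ^ (k + 1) * ‖orthantTerm d a c
      (Param.toZ ((fun i => (Z i : ℂ), fun j => (L j : ℂ)) : Param (k + 1) m)) κ‖ := by
  have hd' : (0 : ℝ) < d := by exact_mod_cast hd
  have h1 : ‖∏ i, (q.1 i ^ κ i / (κ i).factorial : ℂ)‖ ≤
      ‖∏ i, ((-(Z i : ℂ)) ^ κ i / (κ i).factorial : ℂ)‖ := by
    rw [norm_prod, norm_prod]
    refine Finset.prod_le_prod (fun i _ => norm_nonneg _) fun i _ => ?_
    rw [norm_div, norm_div, norm_pow, norm_pow, norm_neg, Complex.norm_real]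
    gcongr
    exact (hZ i).trans (le_abs_self _)
  have h2 : ‖∏ j, (Complex.exp (-((expVec a c κ j : ℂ) / d) * q.2 j) /
      Complex.Gamma (1 - (expVec a c κ j : ℂ) / d))‖ ≤
      d ^ (k + 1) * ‖∏ j, (1 / d * Complex.Gamma ((expVec a c κ j : ℂ) / d) *
        Complex.exp (-((expVec a c κ j : ℂ) / d) * Complex.log (Complex.exp (L j))))‖ := by
    have e : (d : ℝ) ^ (k + 1) = ∏ _j : Fin (k + 1), (d : ℝ) := by simp
    rw [norm_prod, norm_prod, e, ← Finset.prod_mul_distrib]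
    refine Finset.prod_le_prod (fun i _ => norm_nonneg _) fun j _ => ?_
    have hb : (0 : ℝ) < (expVec a c κ j : ℝ) / d :=
      div_pos (by exact_mod_cast expVec_pos hc κ j) hd'
    have hb' : ((expVec a c κ j : ℂ) / d) = (((expVec a c κ j : ℝ) / d : ℝ) : ℂ) := by
      push_cast; rfl
    rw [hb', ← Complex.ofReal_exp, ← Complex.ofReal_log (Real.exp_pos _).le, Real.log_exp]
    generalize (expVec a c κ j : ℝ) / d = b at hb
    rw [div_eq_mul_inv, norm_mul, norm_mul, norm_mul, Complex.norm_exp, Complex.norm_exp,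
      norm_div, norm_one, Complex.norm_natCast]
    rw [← Complex.ofReal_neg, Complex.re_ofReal_mul, Complex.re_ofReal_mul, Complex.ofReal_re]
    have h3 : Real.exp (-b * (q.2 j).re) ≤ Real.exp (-b * L j) :=
      Real.exp_le_exp.2 (by nlinarith [hL j])
    calc _ ≤ Real.exp (-b * L j) * ‖Complex.Gamma (b : ℂ)‖ :=
          mul_le_mul h3 (norm_inv_Gamma_one_sub_le hb) (norm_nonneg _) (Real.exp_pos _).le
      _ = _ := by field_simp
  rw [seriesTerm, orthantTerm, norm_mul, norm_mul]
  calc _ ≤ _ := mul_le_mul h1 h2 (norm_nonneg _) (norm_nonneg _)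
    _ = _ := by simp only [Param.toZ, Sum.elim_inl, Sum.elim_inr]; ring

theorem summable_norm_orthantTerm (hd : 0 < d) (ha : ∀ i, ∑ j, a i j = d) {c : Fin (k + 1) → ℕ}
    (hc : ∀ j, 0 < c j) {Z : Fin m → ℝ} {L : Fin (k + 1) → ℝ}
    (h : ∀ j, ∑ i, |Z i| < Real.exp (L j)) :
    Summable fun κ => (d : ℝ) ^ (k + 1) * ‖orthantTerm d a c
      (Param.toZ ((fun i => (Z i : ℂ), fun j => (L j : ℂ)) : Param (k + 1) m)) κ‖ := by
  refine Summable.mul_left _ (summable_norm_iff.2 (hasSum_orthantTerm hd ha hc ?_).2.summable)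
  intro j
  simp only [Param.toZ, Sum.elim_inl, Sum.elim_inr, Complex.norm_real, Real.norm_eq_abs]
  rw [← Complex.ofReal_exp, Complex.ofReal_re]
  exact h j

theorem sum_norm_lt_of_mem_nearFermat {ε : ℝ} (hε : m * ε ≤ 1) {q : Param (k + 1) m}
    (hq : q ∈ nearFermat (k + 1) m ε) (j : Fin (k + 1)) :
    ∑ i, ‖q.1 i‖ < ‖Complex.exp (q.2 j)‖ := by
  have hpos : 0 < ‖Complex.exp (q.2 j)‖ := norm_pos_iff.2 (Complex.exp_ne_zero _)
  have hq' : ∀ i, ‖q.1 i‖ < ε * ‖Complex.exp (q.2 j)‖ := fun i => hq i j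
  rcases Nat.eq_zero_or_pos m with rfl | hm
  · simp
  · calc ∑ i, ‖q.1 i‖ < ∑ _i : Fin m, ε * ‖Complex.exp (q.2 j)‖ :=
          Finset.sum_lt_sum_of_nonempty ⟨⟨0, hm⟩, Finset.mem_univ _⟩ fun i _ => hq' i
      _ = m * ε * ‖Complex.exp (q.2 j)‖ := by simp [mul_assoc]
      _ ≤ _ := mul_le_of_le_one_left hpos.le hε

theorem summable_norm_seriesTerm (hd : 0 < d) (ha : ∀ i, ∑ j, a i j = d) {c : Fin (k + 1) → ℕ}
    (hc : ∀ j, 0 < c j) {ε : ℝ} (hε : m * ε ≤ 1) {q : Param (k + 1) m}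
    (hq : q ∈ nearFermat (k + 1) m ε) : Summable fun κ => ‖seriesTerm d a c κ q‖ := by
  refine Summable.of_nonneg_of_le (fun _ => norm_nonneg _)
    (norm_seriesTerm_le (Z := fun i => ‖q.1 i‖) (L := fun j => (q.2 j).re) hd hc
      (fun i => le_rfl) fun j => le_rfl) (summable_norm_orthantTerm hd ha hc fun j => ?_)
  simpa [Complex.norm_exp] using sum_norm_lt_of_mem_nearFermat hε hq j

theorem holomorphicOnLines_periodSeries (hd : 0 < d) (ha : ∀ i, ∑ j, a i j = d)
    {c : Fin (k + 1) → ℕ} (hc : ∀ j, 0 < c j) (r : ℕ) {ε : ℝ} (hε : m * ε ≤ 1) :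
    HolomorphicOnLines (periodSeries d a c r) (nearFermat (k + 1) m ε) := by
  intro p v t₀ ht₀
  refine DifferentiableAt.differentiableWithinAt ?_
  set q₀ : Param (k + 1) m := p + t₀ • v with hq₀
  -- the strict inequalities at `q₀` leave room for a polydisc on which the series is dominated
  obtain ⟨η, hη, hηq⟩ : ∃ η > 0, ∀ j, ∑ i, |‖q₀.1 i‖ + η| < Real.exp ((q₀.2 j).re - η) := by
    have h : ∀ᶠ η : ℝ in 𝓝 0, ∀ j, ∑ i, |‖q₀.1 i‖ + η| < Real.exp ((q₀.2 j).re - η) := by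
      rw [Filter.eventually_all]
      intro j
      refine ContinuousAt.eventually_lt (by fun_prop) (by fun_prop) ?_
      have := sum_norm_lt_of_mem_nearFermat hε (q := q₀) ht₀ j
      simpa [Complex.norm_exp] using this
    obtain ⟨ρ, hρ, h⟩ := Metric.eventually_nhds_iff.1 h
    exact ⟨ρ / 2, half_pos hρ,
      h (by rw [Real.dist_eq, sub_zero, abs_of_pos (half_pos hρ)]; linarith)⟩
  set S : Set ℂ := {t | ∀ i, ‖(p + t • v).1 i‖ < ‖q₀.1 i‖ + η} ∩
    {t | ∀ j, (q₀.2 j).re - η < ((p + t • v).2 j).re} with hS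
  have hSo : IsOpen S := by
    refine IsOpen.inter ?_ ?_
    · simp only [ofPred_forall]
      exact isOpen_iInter_of_finite fun i => isOpen_lt
        (by simp only [Prod.fst_add, Prod.smul_fst, Pi.add_apply, Pi.smul_apply]; fun_prop)
        continuous_const
    · simp only [ofPred_forall]
      exact isOpen_iInter_of_finite fun j => isOpen_lt continuous_const
        (Complex.continuous_re.comp
          (by simp only [Prod.snd_add, Prod.smul_snd, Pi.add_apply, Pi.smul_apply]; fun_prop))
  have hSt : t₀ ∈ S := ⟨fun i => by linarith, fun j => by linarith⟩
  have hdiff := Complex.differentiableOn_tsum_of_summable_norm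
    (F := fun κ t => seriesTerm d a c κ (p + t • v))
    (summable_norm_orthantTerm (c := c) hd ha hc hηq) (fun κ => ?_) hSo fun κ t ht =>
      norm_seriesTerm_le hd hc (fun i => (ht.1 i).le) (fun j => (ht.2 j).le) κ
  · exact (hdiff.differentiableAt (hSo.mem_nhds hSt)).const_mul _
  · simp only [seriesTerm, Prod.fst_add, Prod.smul_fst, Prod.snd_add, Prod.smul_snd, Pi.add_apply,
      Pi.smul_apply, smul_eq_mul, div_eq_mul_inv]
    fun_prop

/-! ### The base point -/

/-- The Fermat cycle is a chain in the complement of the Fermat hypersurface. -/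
theorem fermatCycle_liesIn (hd : 0 < d) (ha : ∀ i, ∑ j, a i j = d) :
    (fermatCycle k d).LiesIn
      (hypersurfaceCompl d a (Param.toZ ((0, 0) : Param (k + 1) m))) := by
  have h1 : ∀ I : Finset (Fin (k + 1)), ∀ t, (fermatSimplex k d I).toFun t ∈
      hypersurfaceCompl d a (Param.toZ ((0, 0) : Param (k + 1) m)) := by
    intro I
    rw [liesIn_iff ha _ _ (isSmoothLift_fermatSimplex I)]
    intro t ht h
    rw [← fermatDeformation_twist] at h
    have := re_fermatDeformation_pos (z := twist d a (rootVec d I)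
      (Param.toZ ((0, 0) : Param (k + 1) m))) ha
      (fun j => by simp [twist, Param.toZ, rootVec_pow hd]) ht.1
      (fun h0 => by simpa [h0] using ht.2)
    rw [h] at this
    simp at this
  intro σ hσ
  obtain ⟨I, hI⟩ : ∃ I, fermatSimplex k d I = σ := by
    by_contra! hne
    rw [Finsupp.mem_support_iff] at hσ
    refine hσ ?_
    simp only [fermatCycle, Finsupp.smul_apply, Finsupp.finsetSum_apply]
    rw [Finset.sum_eq_zero fun I _ => Finsupp.single_eq_of_ne' (hne I), smul_zero]
  exact hI ▸ h1 I

theorem eventually_period_fermatCycle (hd : 0 < d) (ha : ∀ i, ∑ j, a i j = d)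
    {c : Fin (k + 1) → ℕ} {r : ℕ} (hc : ∀ j, 0 < c j) (hcr : ∑ j, c j = d * r) :
    ∀ᶠ q : Param (k + 1) m in 𝓝 (0, 0),
      period d a c r q.toZ (fermatCycle k d) = periodSeries d a c r q := by
  have h1 : ∀ᶠ q : Param (k + 1) m in 𝓝 (0, 0), ∀ j, |(q.2 j).im| < Real.pi := by
    rw [Filter.eventually_all]
    intro j
    exact ContinuousAt.eventually_lt (by fun_prop) (by fun_prop) (by simpa using Real.pi_pos)
  have h2 : ∀ᶠ q : Param (k + 1) m in 𝓝 (0, 0), ∀ j,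
      ∑ i, ‖q.1 i‖ < (Complex.exp (q.2 j)).re := by
    rw [Filter.eventually_all]
    intro j
    exact ContinuousAt.eventually_lt (by fun_prop) (by fun_prop) (by simp)
  filter_upwards [h1, h2] with q hq1 hq2
  exact period_fermatCycle_eq_periodSeries hd ha hc hcr
    (fun j => Complex.log_exp (neg_lt_of_abs_lt (hq1 j)) (le_of_abs_le (hq1 j).le)) hq2

end

/-! ### Linear simplices -/

section

variable {n q : ℕ}

/-- The linear combination of the vectors `V 0, …, V q` with real coefficients `t`. -/
def linPoint (V : Fin (q + 1) → Fin n → ℂ) (t : Fin (q + 1) → ℝ) : Fin n → ℂ :=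
  ∑ p, (t p : ℂ) • V p

theorem contDiff_linPoint (V : Fin (q + 1) → Fin n → ℂ) :
    ContDiff ℝ (⊤ : ℕ∞) (linPoint V) := by
  unfold linPoint
  refine ContDiff.sum fun p _ => ?_
  exact (Complex.ofRealCLM.contDiff.comp (contDiff_apply ℝ ℝ p)).smul contDiff_const

/-- The convex hull of the vectors avoids the origin. -/
def IsNondegenerate (V : Fin (q + 1) → Fin n → ℂ) : Prop :=
  ∀ t ∈ stdSimplex ℝ (Fin (q + 1)), linPoint V t ≠ 0

/-- The linear simplex with given vertices in projective space (or rather with given vectors over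
the vertices). -/
def linSimplex (V : Fin (q + 1) → Fin n → ℂ) (hV : IsNondegenerate V) : SmoothSimplex n q where
  toFun t := Projectivization.mk ℂ (linPoint V t.1) (hV t.1 t.2)
  smooth := ⟨linPoint V, contDiff_linPoint V, fun t => ⟨hV t.1 t.2, rfl⟩⟩

theorem isSmoothLift_linSimplex {V : Fin (q + 1) → Fin n → ℂ} (hV : IsNondegenerate V) :
    IsSmoothLift (linSimplex V hV).toFun (linPoint V) :=
  ⟨contDiff_linPoint V, fun t => ⟨hV t.1 t.2, rfl⟩⟩

theorem linPoint_insertNth_zero (V : Fin (q + 2) → Fin n → ℂ) (i : Fin (q + 2))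
    (t : Fin (q + 1) → ℝ) :
    linPoint V (i.insertNth (0 : ℝ) t) = linPoint (fun p => V (i.succAbove p)) t := by
  simp [linPoint, Fin.sum_univ_succAbove _ i]

theorem IsNondegenerate.face {V : Fin (q + 2) → Fin n → ℂ} (hV : IsNondegenerate V)
    (i : Fin (q + 2)) : IsNondegenerate fun p => V (i.succAbove p) := by
  intro t ht
  rw [← linPoint_insertNth_zero]
  exact hV _ (faceMap i ⟨t, ht⟩).2

theorem face_linSimplex {V : Fin (q + 2) → Fin n → ℂ} (hV : IsNondegenerate V)
    (i : Fin (q + 2)) : (linSimplex V hV).face i = linSimplex _ (hV.face i) := by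
  ext t : 2
  simp only [SmoothSimplex.face, linSimplex, faceMap, linPoint_insertNth_zero]

open Classical in
/-- The chain consisting of a linear simplex; it is `0` for degenerate vertices,
which keeps nondegeneracy proofs out of sums of chains. -/
def linChain (V : Fin (q + 1) → Fin n → ℂ) : Chain n q :=
  if hV : IsNondegenerate V then Finsupp.single (linSimplex V hV) 1 else 0

theorem linChain_of_isNondegenerate {V : Fin (q + 1) → Fin n → ℂ} (hV : IsNondegenerate V) :
    linChain V = Finsupp.single (linSimplex V hV) 1 := dif_pos hV

theorem boundary_linChain {V : Fin (q + 2) → Fin n → ℂ} (hV : IsNondegenerate V) :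
    boundary (linChain V) =
      ∑ i : Fin (q + 2), (-1 : ℚ) ^ (i : ℕ) • linChain fun p => V (i.succAbove p) := by
  rw [linChain_of_isNondegenerate hV, boundary, Finsupp.linearCombination_single, one_smul]
  refine Finset.sum_congr rfl fun i _ => ?_
  rw [linChain_of_isNondegenerate (hV.face i), face_linSimplex, Finsupp.smul_single, smul_eq_mul,
    mul_one]

theorem Chain.liesIn_iff_mem_supported {δ : Chain n q} {U : Set (Proj n)} :
    δ.LiesIn U ↔ δ ∈ Finsupp.supported ℚ ℚ {σ : SmoothSimplex n q | ∀ t, σ.toFun t ∈ U} := by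
  rw [Finsupp.mem_supported]
  rfl

end

section

variable {k m d : ℕ} {a : Fin m → Fin (k + 1) → ℕ}

theorem isNondegenerate_of_ne_zero (hd : 0 < d) (ha : ∀ i, ∑ j, a i j = d) {q : ℕ}
    {z : Fin m ⊕ Fin (k + 1) → ℂ} {V : Fin (q + 1) → Fin (k + 1) → ℂ}
    (hV : ∀ t ∈ stdSimplex ℝ (Fin (q + 1)), fermatDeformation d a z (linPoint V t) ≠ 0) :
    IsNondegenerate V := by
  intro t ht h
  refine hV t ht ?_
  have h0 := fermatDeformation_smul ha z 0 (linPoint V t)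
  rw [zero_smul, zero_pow hd.ne', zero_mul] at h0
  rwa [h]

theorem linChain_liesIn (ha : ∀ i, ∑ j, a i j = d) {q : ℕ}
    {z : Fin m ⊕ Fin (k + 1) → ℂ} {V : Fin (q + 1) → Fin (k + 1) → ℂ}
    (hV : ∀ t ∈ stdSimplex ℝ (Fin (q + 1)), fermatDeformation d a z (linPoint V t) ≠ 0) :
    (linChain V).LiesIn (hypersurfaceCompl d a z) := by
  rw [Chain.liesIn_iff_mem_supported]
  by_cases h : IsNondegenerate V
  · rw [linChain_of_isNondegenerate h]
    exact Finsupp.single_mem_supported ℚ _ ((liesIn_iff ha z _ (isSmoothLift_linSimplex h)).2 hV)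
  · rw [linChain, dif_neg h]
    exact Submodule.zero_mem _

/-! ### Cycles with vertices on the coordinate axes -/

/-- Vertices on the coordinate axes: the vertex with index `p` lies on the axis `e p`, and has
there the coordinate `ν p`, multiplied by the entry of `∏_{i ∈ I} σ_i`. Two vertices may lie on the
same axis. -/
def axisVertices (d : ℕ) (I : Finset (Fin (k + 1))) {q : ℕ} (e : Fin (q + 1) → Fin (k + 1))
    (ν : Fin (q + 1) → ℂ) (p : Fin (q + 1)) : Fin (k + 1) → ℂ :=
  Pi.single (e p) (rootVec d I (e p) * ν p)

theorem linPoint_axisVertices (I : Finset (Fin (k + 1))) {q : ℕ} (e : Fin (q + 1) → Fin (k + 1))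
    (ν : Fin (q + 1) → ℂ) (t : Fin (q + 1) → ℝ) (j : Fin (k + 1)) :
    linPoint (axisVertices d I e ν) t j =
      rootVec d I j * ∑ p with e p = j, (t p : ℂ) * ν p := by
  simp only [linPoint, axisVertices, Finset.sum_apply, Pi.smul_apply, smul_eq_mul]
  rw [Finset.sum_filter, Finset.mul_sum]
  refine Finset.sum_congr rfl fun p _ => ?_
  split_ifs with h
  · subst h; rw [Pi.single_eq_same]; ring
  · rw [Pi.single_eq_of_ne (Ne.symm h)]; ring

/-- The translate of the Fermat cycle by the diagonal matrix with entries `μ j`, built from linear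
simplices. -/
def scaledCycle (d : ℕ) (μ : Fin (k + 1) → ℂ) : Chain (k + 1) k :=
  -(d : ℚ) ^ k • ∑ I : Finset (Fin (k + 1)),
    (-1 : ℚ) ^ (k + 1 - I.card) • linChain (axisVertices d I id μ)

theorem linPoint_axisVertices_id (I : Finset (Fin (k + 1))) (μ : Fin (k + 1) → ℂ)
    (t : Fin (k + 1) → ℝ) :
    linPoint (axisVertices d I id μ) t = fun j => rootVec d I j * μ j * t j := by
  ext j
  rw [linPoint_axisVertices]
  simp only [id, Finset.sum_filter, Finset.sum_ite_eq', Finset.mem_univ, if_true]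
  ring

theorem scaledCycle_one : scaledCycle d (fun _ => 1) = fermatCycle k d := by
  unfold scaledCycle fermatCycle
  congr 1
  refine Finset.sum_congr rfl fun I _ => ?_
  have hV : IsNondegenerate (axisVertices d I id fun _ : Fin (k + 1) => 1) := by
    intro t ht
    obtain ⟨h, -⟩ := (isSmoothLift_fermatSimplex (d := d) I).2 ⟨t, ht⟩
    simpa only [linPoint_axisVertices_id, mul_one] using h
  rw [linChain_of_isNondegenerate hV, Finsupp.smul_single, smul_eq_mul, mul_one]
  congr 1
  ext t : 2
  obtain ⟨h, h'⟩ := (isSmoothLift_fermatSimplex (d := d) I).2 t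
  rw [← h']
  simp only [linSimplex, linPoint_axisVertices_id, mul_one]

/-- An alternating sum over subsets vanishes if membership of one element `j` is irrelevant. -/
theorem sum_signs_eq_zero {M : Type*} [AddCommGroup M] [Module ℚ M] (j : Fin (k + 1))
    (f : Finset (Fin (k + 1)) → M) (hf : ∀ I, j ∉ I → f (insert j I) = f I) :
    ∑ I : Finset (Fin (k + 1)), (-1 : ℚ) ^ (k + 1 - I.card) • f I = 0 := by
  have h1 : (Finset.univ : Finset (Fin (k + 1))) = insert j (Finset.univ.erase j) := by simp
  have h2 : j ∉ Finset.univ.erase j := by simp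
  rw [← Finset.powerset_univ, h1, Finset.sum_powerset_insert h2, ← Finset.sum_add_distrib]
  refine Finset.sum_eq_zero fun I hI => ?_
  have hI' := Finset.mem_powerset.1 hI
  have hj : j ∉ I := fun h => h2 (hI' h)
  have hc : I.card ≤ k := by
    have := Finset.card_le_card hI'
    simpa using this
  rw [hf I hj, Finset.card_insert_of_notMem hj, ← add_smul,
    show k + 1 - I.card = (k + 1 - (I.card + 1)) + 1 by omega, pow_succ]
  simp

/-- When the coordinates are rescaled so that the Fermat polynomial becomes `∑ y_j^d`, vertices on
the axes with coordinates near `1` span a simplex on which the polynomial has positive real part: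
each `y_j` is a nonnegative multiple of a mean of numbers in a disc about `1`. -/
theorem fermatDeformation_linPoint_ne_zero (hd : 0 < d) {ρ : ℝ}
    (hρ : ∀ v : ℂ, ‖v - 1‖ < ρ → 0 < (v ^ d).re) {q : ℕ} {l : Fin (k + 1) → ℂ}
    {e : Fin (q + 1) → Fin (k + 1)} {ν : Fin (q + 1) → ℂ}
    (hν : ∀ p, ‖Complex.exp (l (e p) / d) * ν p - 1‖ < ρ) (I : Finset (Fin (k + 1)))
    {t : Fin (q + 1) → ℝ} (ht : t ∈ stdSimplex ℝ (Fin (q + 1))) :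
    fermatDeformation d a (Param.toZ (0, l)) (linPoint (axisVertices d I e ν) t) ≠ 0 := by
  have hd' : (d : ℂ) ≠ 0 := by exact_mod_cast hd.ne'
  set y : Fin (k + 1) → ℂ := fun j =>
    ∑ p with e p = j, (t p : ℂ) * (Complex.exp (l (e p) / d) * ν p) with hy
  set τ : Fin (k + 1) → ℝ := fun j => ∑ p with e p = j, t p with hτ
  have h1 : fermatDeformation d a (Param.toZ (0, l)) (linPoint (axisVertices d I e ν) t) =
      ∑ j, y j ^ d := by
    simp only [fermatDeformation, Param.toZ, Sum.elim_inl, Sum.elim_inr, Pi.zero_apply, zero_mul,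
      Finset.sum_const_zero, zero_add]
    refine Finset.sum_congr rfl fun j _ => ?_
    rw [linPoint_axisVertices, mul_pow, rootVec_pow hd, one_mul]
    have h2 : Complex.exp (l j) = Complex.exp (l j / d) ^ d := by
      rw [← Complex.exp_nat_mul, mul_div_cancel₀ _ hd']
    rw [h2, ← mul_pow, Finset.mul_sum]
    congr 1
    refine Finset.sum_congr rfl fun p hp => ?_
    rw [(Finset.mem_filter.1 hp).2]
    ring
  have hτ0 : ∀ j, 0 ≤ τ j := fun j => Finset.sum_nonneg fun p _ => ht.1 p
  have hτ1 : ∑ j, τ j = 1 := by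
    rw [← ht.2]
    exact Finset.sum_fiberwise _ _ _
  have hpos : ∀ j, 0 < τ j → 0 < (y j ^ d).re := by
    intro j hj
    have hj' : (τ j : ℂ) ≠ 0 := by exact_mod_cast hj.ne'
    have h3 : ‖y j - τ j‖ < ρ * τ j := by
      have e1 : y j - τ j = ∑ p with e p = j,
          (t p : ℂ) * (Complex.exp (l (e p) / d) * ν p - 1) := by
        simp only [hy, hτ, mul_sub, mul_one, Finset.sum_sub_distrib, Complex.ofReal_sum]
      rw [e1, hτ, Finset.mul_sum]
      refine (norm_sum_le _ _).trans_lt ?_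
      obtain ⟨p, hp, hp0⟩ := Finset.exists_ne_zero_of_sum_ne_zero hj.ne'
      have hle : ∀ p, ‖(t p : ℂ) * (Complex.exp (l (e p) / d) * ν p - 1)‖ =
          ‖Complex.exp (l (e p) / d) * ν p - 1‖ * t p := fun p => by
        rw [norm_mul, Complex.norm_real, Real.norm_of_nonneg (ht.1 p), mul_comm]
      simp only [hle]
      exact Finset.sum_lt_sum (fun p _ => mul_le_mul_of_nonneg_right (hν p).le (ht.1 p))
        ⟨p, hp, mul_lt_mul_of_pos_right (hν p) (lt_of_le_of_ne (ht.1 p) (Ne.symm hp0))⟩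
    have h4 : ‖y j / τ j - 1‖ < ρ := by
      rw [div_sub_one hj', norm_div, Complex.norm_real, Real.norm_of_nonneg hj.le,
        div_lt_iff₀ hj]
      exact h3
    have h5 : y j ^ d = ((τ j ^ d : ℝ) : ℂ) * (y j / τ j) ^ d := by
      rw [Complex.ofReal_pow, ← mul_pow, mul_div_cancel₀ _ hj']
    rw [h5, Complex.re_ofReal_mul]
    exact mul_pos (pow_pos hj _) (hρ _ h4)
  have hzero : ∀ j, τ j = 0 → y j = 0 := by
    intro j hj
    refine Finset.sum_eq_zero fun p hp => ?_
    rw [(Finset.sum_eq_zero_iff_of_nonneg fun p _ => ht.1 p).1 hj p hp]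
    simp
  have hnonneg : ∀ j, 0 ≤ (y j ^ d).re := by
    intro j
    rcases (hτ0 j).eq_or_lt with h | h
    · simp [hzero j h.symm, hd.ne']
    · exact (hpos j h).le
  obtain ⟨j, -, hj⟩ := Finset.exists_ne_zero_of_sum_ne_zero (hτ1.trans_ne one_ne_zero)
  have : 0 < (∑ j, y j ^ d).re := by
    rw [Complex.re_sum]
    exact Finset.sum_pos' (fun j _ => hnonneg j)
      ⟨j, Finset.mem_univ _, hpos j (lt_of_le_of_ne (hτ0 j) (Ne.symm hj))⟩
  rw [h1]
  intro h
  simp [h] at this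

/-- The prism operator for a change of one vertex: the faces which keep both positions of that
vertex cancel in the alternating sum over the roots of unity. -/
theorem homologousIn_scaledCycle_update (hd : 0 < d) (ha : ∀ i, ∑ j, a i j = d) {ρ : ℝ}
    (hρ : ∀ v : ℂ, ‖v - 1‖ < ρ → 0 < (v ^ d).re) {l μ : Fin (k + 1) → ℂ}
    (hμ : ∀ j, ‖Complex.exp (l j / d) * μ j - 1‖ < ρ) (i : Fin (k + 1)) {u : ℂ}
    (hu : ‖Complex.exp (l i / d) * u - 1‖ < ρ) :
    HomologousIn (hypersurfaceCompl d a (Param.toZ (0, l))) (scaledCycle d μ)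
      (scaledCycle d (Function.update μ i u)) := by
  -- the prism has the new position of the vertex `i` inserted after the old one
  set e : Fin (k + 2) → Fin (k + 1) := i.succ.insertNth (α := fun _ => Fin (k + 1)) i id with he
  set ν : Fin (k + 2) → ℂ := i.succ.insertNth (α := fun _ => ℂ) u μ with hν
  have heν : ∀ p, ‖Complex.exp (l (e p) / d) * ν p - 1‖ < ρ := by
    intro p
    rcases Fin.eq_self_or_eq_succAbove i.succ p with rfl | ⟨j, rfl⟩
    · simpa [he, hν] using hu
    · simpa [he, hν] using hμ j
  have hne : ∀ I, ∀ t ∈ stdSimplex ℝ (Fin (k + 2)), fermatDeformation d a (Param.toZ (0, l))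
      (linPoint (axisVertices d I e ν) t) ≠ 0 := fun I t ht =>
    fermatDeformation_linPoint_ne_zero hd hρ heν I ht
  have hbd : ∀ I, boundary (linChain (axisVertices d I e ν)) =
      (-1 : ℚ) ^ (i : ℕ) • (linChain (axisVertices d I id (Function.update μ i u)) -
        linChain (axisVertices d I id μ)) +
      ∑ j ∈ Finset.univ.erase i, (-1 : ℚ) ^ (i.succ.succAbove j : ℕ) •
        linChain fun p => axisVertices d I e ν ((i.succ.succAbove j).succAbove p) := by
    intro I
    rw [boundary_linChain (isNondegenerate_of_ne_zero hd ha (hne I)),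
      Fin.sum_univ_succAbove _ i.succ, ← Finset.add_sum_erase _ _ (Finset.mem_univ i), ← add_assoc]
    congr 1
    have h1 : (fun p => axisVertices d I e ν (i.succ.succAbove p)) = axisVertices d I id μ := by
      ext p : 1
      simp [axisVertices, he, hν]
    have h2 : (fun p => axisVertices d I e ν (i.castSucc.succAbove p)) =
        axisVertices d I id (Function.update μ i u) := by
      ext p : 1
      by_cases hp : p = i
      · subst hp
        simp [axisVertices, he, hν]
      · have hp' : i.castSucc.succAbove p = i.succ.succAbove p := by
          have hp'' : (p : ℕ) ≠ i := fun h => hp (Fin.ext h)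
          simp only [Fin.succAbove, Fin.lt_def, Fin.val_castSucc, Fin.val_succ]
          split_ifs <;> first | rfl | omega
        simp [axisVertices, he, hν, hp', hp]
    rw [h1, Fin.succAbove_succ_self, h2, Fin.val_succ, Fin.val_castSucc, pow_succ, smul_sub]
    simp only [mul_neg, mul_one, neg_smul]
    abel
  refine ⟨(-(d : ℚ) ^ k * (-1) ^ (i : ℕ)) • ∑ I : Finset (Fin (k + 1)),
    (-1 : ℚ) ^ (k + 1 - I.card) • linChain (axisVertices d I e ν), ?_, ?_⟩
  · rw [Chain.liesIn_iff_mem_supported]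
    refine Submodule.smul_mem _ _ (Submodule.sum_mem _ fun I _ => Submodule.smul_mem _ _ ?_)
    rw [← Chain.liesIn_iff_mem_supported]
    exact linChain_liesIn ha (hne I)
  · rw [map_smul, map_sum]
    simp only [map_smul, hbd, smul_add, Finset.sum_add_distrib]
    have hcancel : ∑ I : Finset (Fin (k + 1)), (-1 : ℚ) ^ (k + 1 - I.card) •
        ∑ j ∈ Finset.univ.erase i, (-1 : ℚ) ^ (i.succ.succAbove j : ℕ) •
          linChain (fun p => axisVertices d I e ν ((i.succ.succAbove j).succAbove p)) = 0 := by
      simp only [Finset.smul_sum]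
      rw [Finset.sum_comm]
      refine Finset.sum_eq_zero fun j hj => ?_
      have hji : j ≠ i := Finset.ne_of_mem_erase hj
      refine sum_signs_eq_zero j (fun I => (-1 : ℚ) ^ (i.succ.succAbove j : ℕ) •
        linChain (fun p => axisVertices d I e ν ((i.succ.succAbove j).succAbove p))) fun I hI => ?_
      congr 2
      ext p : 1
      -- the face lacks the only vertex on the axis `j`
      have hep : e ((i.succ.succAbove j).succAbove p) ≠ j := by
        intro h
        rcases Fin.eq_self_or_eq_succAbove i.succ ((i.succ.succAbove j).succAbove p)
          with h' | ⟨j', h'⟩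
        · rw [h'] at h
          simp only [he, Fin.insertNth_apply_same] at h
          exact hji h.symm
        · have h'' := h'
          rw [h'] at h
          simp only [he, Fin.insertNth_apply_succAbove, id] at h
          rw [h] at h''
          exact Fin.succAbove_ne _ _ h''
      simp only [axisVertices, rootVec, Finset.mem_insert, hep, false_or]
    rw [hcancel, smul_zero, add_zero, scaledCycle, scaledCycle,
      ← smul_sub, ← Finset.sum_sub_distrib]
    have hsq : (-1 : ℚ) ^ (i : ℕ) * (-1) ^ (i : ℕ) = 1 := by rw [← mul_pow]; simp
    have hterm : ∀ I : Finset (Fin (k + 1)), (-1 : ℚ) ^ (k + 1 - I.card) • (-1 : ℚ) ^ (i : ℕ) •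
        (linChain (axisVertices d I id (Function.update μ i u)) -
          linChain (axisVertices d I id μ)) = (-1 : ℚ) ^ (i : ℕ) •
        ((-1 : ℚ) ^ (k + 1 - I.card) • linChain (axisVertices d I id (Function.update μ i u)) -
          (-1 : ℚ) ^ (k + 1 - I.card) • linChain (axisVertices d I id μ)) := fun I => by
      rw [smul_comm, smul_sub ((-1 : ℚ) ^ (k + 1 - I.card))]
    simp only [hterm, ← Finset.smul_sum]
    rw [smul_smul, mul_assoc, hsq, mul_one]

/-! ### Transport of the Fermat cycle -/

/-- All vertices can be moved, one after the other, as long as they stay near the real simplex. -/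
theorem IsDeformation.scaledCycle_of_close (hd : 0 < d) (ha : ∀ i, ∑ j, a i j = d) {ρ ε : ℝ}
    (hρ : ∀ v : ℂ, ‖v - 1‖ < ρ → 0 < (v ^ d).re) {l μ μ' : Fin (k + 1) → ℂ}
    (hμ : ∀ j, ‖Complex.exp (l j / d) * μ j - 1‖ < ρ)
    (hμ' : ∀ j, ‖Complex.exp (l j / d) * μ' j - 1‖ < ρ)
    (h : IsDeformation d a ε (0, l) (scaledCycle d μ)) :
    IsDeformation d a ε (0, l) (scaledCycle d μ') := by
  have key : ∀ T : Finset (Fin (k + 1)),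
      IsDeformation d a ε (0, l) (scaledCycle d (T.piecewise μ' μ)) := by
    intro T
    induction T using Finset.induction_on with
    | empty => simpa using h
    | insert i T _ ih =>
      rw [Finset.piecewise_insert]
      refine ih.homologous (homologousIn_scaledCycle_update hd ha hρ (fun j => ?_) i (hμ' i))
      by_cases hj : j ∈ T
      · simpa [hj] using hμ' j
      · simpa [hj] using hμ j
  simpa using key Finset.univ

theorem scaledCycle_liesIn (ha : ∀ i, ∑ j, a i j = d) {z : Fin m ⊕ Fin (k + 1) → ℂ}
    {μ : Fin (k + 1) → ℂ} (h : ∀ I, ∀ t ∈ stdSimplex ℝ (Fin (k + 1)),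
      fermatDeformation d a z (linPoint (axisVertices d I id μ) t) ≠ 0) :
    (scaledCycle d μ).LiesIn (hypersurfaceCompl d a z) := by
  rw [Chain.liesIn_iff_mem_supported]
  refine Submodule.smul_mem _ _ (Submodule.sum_mem _ fun I _ => Submodule.smul_mem _ _ ?_)
  rw [← Chain.liesIn_iff_mem_supported]
  exact linChain_liesIn ha (h I)

/-- Along the path `(0, s l)` the Fermat cycle is transported by the rescaling of coordinates that
keeps the Fermat polynomial constant. -/
theorem isDeformation_scaledCycle_zero (hd : 0 < d) (ha : ∀ i, ∑ j, a i j = d) {ε : ℝ}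
    (hε : 0 < ε) (l : Fin (k + 1) → ℂ) :
    IsDeformation d a ε (0, l) (scaledCycle d fun j => Complex.exp (-(l j / d))) := by
  obtain ⟨ρ, hρ0, hρ⟩ : ∃ ρ > 0, ∀ v : ℂ, ‖v - 1‖ < ρ → 0 < (v ^ d).re := by
    have h : ∀ᶠ v : ℂ in 𝓝 1, 0 < (v ^ d).re :=
      ContinuousAt.eventually_lt (by fun_prop) (by fun_prop) (by simp)
    obtain ⟨ρ, hρ0, hρ⟩ := Metric.eventually_nhds_iff.1 h
    exact ⟨ρ, hρ0, fun v hv => hρ (by rwa [dist_eq_norm])⟩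
  obtain ⟨η, hη0, hη⟩ : ∃ η > 0, ∀ s : ℝ, |s| < η → ∀ j,
      ‖Complex.exp (s * (l j / d)) - 1‖ < ρ := by
    have h : ∀ᶠ s : ℝ in 𝓝 0, ∀ j, ‖Complex.exp (s * (l j / d)) - 1‖ < ρ := by
      rw [Filter.eventually_all]
      exact fun j => ContinuousAt.eventually_lt (by fun_prop) (by fun_prop) (by simpa using hρ0)
    obtain ⟨η, hη0, hη⟩ := Metric.eventually_nhds_iff.1 h
    exact ⟨η, hη0, fun s hs => hη (by rwa [Real.dist_eq, sub_zero])⟩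
  obtain ⟨N, hN⟩ := exists_nat_one_div_lt hη0
  -- the path of parameters, and the factors `μ` for which `∑ z_{m+j} (μ_j x_j)^d` is constant on it
  set w : ℝ → Param (k + 1) m := fun s => (0, fun j => s * l j) with hw
  set M : ℝ → Fin (k + 1) → ℂ := fun s j => Complex.exp (-(s * (l j / d))) with hM
  have hclose : ∀ s s' : ℝ, |s - s'| < η → ∀ j,
      ‖Complex.exp ((w s).2 j / d) * M s' j - 1‖ < ρ := by
    intro s s' hs j
    have := hη _ hs j
    rw [hw, hM, ← Complex.exp_add]
    convert! this using 4
    push_cast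
    ring
  have hnear : ∀ s, w s ∈ nearFermat (k + 1) m ε := by
    intro s i j
    simp only [hw, Param.toZ, Sum.elim_inl, Sum.elim_inr, Pi.zero_apply, norm_zero]
    exact mul_pos hε (norm_pos_iff.2 (Complex.exp_ne_zero _))
  have hwc : Continuous w := by fun_prop
  have hstep : ∀ s s' : ℝ, |s - s'| < η → IsDeformation d a ε (w s) (scaledCycle d (M s)) →
      IsDeformation d a ε (w s') (scaledCycle d (M s')) := by
    intro s s' hs h
    have hη' : |s' - s| < η := by rwa [abs_sub_comm]
    have hsub : ∀ x ∈ segment ℝ s s', |x - s| < η := by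
      intro x hx
      have := abs_sub_left_of_mem_uIcc (segment_eq_uIcc s s' ▸ hx)
      exact this.trans_lt hη'
    have hjoin : JoinedIn {q | q ∈ nearFermat (k + 1) m ε ∧
        (scaledCycle d (M s)).LiesIn (hypersurfaceCompl d a q.toZ)} (w s) (w s') := by
      have h1 : JoinedIn (segment ℝ s s') s s' :=
        ((convex_segment s s').isPathConnected ⟨s, left_mem_segment ℝ s s'⟩).joinedIn _
          (left_mem_segment ℝ s s') _ (right_mem_segment ℝ s s')
      refine (h1.map_continuousOn hwc.continuousOn).mono ?_
      rintro _ ⟨x, hx, rfl⟩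
      exact ⟨hnear x, scaledCycle_liesIn ha fun I t ht =>
        fermatDeformation_linPoint_ne_zero hd hρ (fun p => hclose _ _ (hsub x hx) p) I ht⟩
    exact (h.transport hjoin).scaledCycle_of_close hd ha hρ (hclose _ _ hη')
      (hclose _ _ (by simpa using hη0))
  have hall : ∀ n : ℕ, IsDeformation d a ε (w (n / (N + 1))) (scaledCycle d (M (n / (N + 1)))) := by
    intro n
    induction n with
    | zero =>
      have h0 : w ((0 : ℕ) / (N + 1)) = (0, 0) := by simp [hw]; rfl
      have h1 : M ((0 : ℕ) / (N + 1)) = fun _ => 1 := by simp [hM]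
      rw [h0, h1, scaledCycle_one]
      exact IsDeformation.base
    | succ n ih =>
      refine hstep _ _ ?_ ih
      rw [← sub_div, abs_div, abs_of_pos (by positivity : (0 : ℝ) < N + 1)]
      convert! hN using 2
      push_cast
      rw [sub_add_cancel_left, abs_neg, abs_one]
  have hlast := hall (N + 1)
  have h1 : (((N + 1 : ℕ) : ℝ) / (N + 1)) = 1 := by
    push_cast
    exact div_self (by positivity)
  rw [h1] at hlast
  simpa [hw, hM] using hlast

/-- If `x` is at most `ε` times each of the `exp (L j)`, it is at most `ε` times their weighted
geometric mean with weights `α j / d`. -/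
theorem norm_mul_prod_exp_le (hd : 0 < d) {α : Fin (k + 1) → ℕ} (hα : ∑ j, α j = d) {x ε : ℝ}
    (hx : 0 ≤ x) (hε : 0 < ε) {L : Fin (k + 1) → ℝ} (h : ∀ j, x ≤ ε * Real.exp (L j)) :
    x * ∏ j, Real.exp (-(L j / d)) ^ α j ≤ ε := by
  have hd' : (d : ℝ) ≠ 0 := by exact_mod_cast hd.ne'
  refine le_of_pow_le_pow_left₀ hd.ne' hε.le ?_
  have e : ∀ y : ℝ, y ^ d = ∏ j, y ^ α j := fun y => by rw [Finset.prod_pow_eq_pow_sum, hα]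
  rw [mul_pow, e x, e ε, ← Finset.prod_pow, ← Finset.prod_mul_distrib]
  refine Finset.prod_le_prod (fun j _ => by positivity) fun j _ => ?_
  rw [← pow_mul, mul_comm (α j) d, pow_mul, ← mul_pow]
  refine pow_le_pow_left₀ (by positivity) ?_ _
  rw [← Real.exp_nat_mul, mul_neg, mul_div_cancel₀ _ hd', Real.exp_neg, ← div_eq_mul_inv,
    div_le_iff₀ (Real.exp_pos _)]
  exact h j

/-- The deformation of the Fermat cycle exists: once the Fermat part is reached by rescaling, the
coefficients `z_i` are turned on linearly, which does not require a change of the chain. -/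
theorem exists_isDeformation (hd : 0 < d) (ha : ∀ i, ∑ j, a i j = d) {ε : ℝ} (hε : 0 < ε)
    (hmε : m * ε < 1) {p : Param (k + 1) m} (hp : p ∈ nearFermat (k + 1) m ε) :
    ∃ δ, IsDeformation d a ε p δ := by
  obtain ⟨x, l⟩ := p
  have hd' : (d : ℂ) ≠ 0 := by exact_mod_cast hd.ne'
  refine ⟨_, (isDeformation_scaledCycle_zero hd ha hε l).transport ?_⟩
  set w : ℝ → Param (k + 1) m := fun s => (s • x, l) with hw
  have hwc : Continuous w := by fun_prop
  have h1 : JoinedIn (Icc (0 : ℝ) 1) 0 1 :=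
    ((convex_Icc (0 : ℝ) 1).isPathConnected ⟨0, by simp⟩).joinedIn _ (by simp) _ (by simp)
  have h2 := h1.map_continuousOn hwc.continuousOn
  have e0 : w 0 = (0, l) := by simp [hw]
  have e1 : w 1 = (x, l) := by simp [hw]
  rw [e0, e1] at h2
  refine h2.mono ?_
  rintro _ ⟨s, hs, rfl⟩
  have hle : ∀ i, ‖(s • x) i‖ ≤ ‖x i‖ := fun i => by
    rw [Pi.smul_apply, norm_smul, Real.norm_of_nonneg hs.1]
    exact mul_le_of_le_one_left (norm_nonneg _) hs.2
  have hmem : w s ∈ nearFermat (k + 1) m ε := fun i j => (hle i).trans_lt (hp i j)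
  refine ⟨hmem, scaledCycle_liesIn ha fun I t ht => ?_⟩
  rw [linPoint_axisVertices_id, ← fermatDeformation_twist]
  intro h
  have hpos := re_fermatDeformation_pos (z := twist d a
    (fun j => rootVec d I j * Complex.exp (-(l j / d))) (w s).toZ) ha ?_ ht.1
      (fun h0 => by simpa [h0] using ht.2)
  · rw [h] at hpos
    simp at hpos
  · intro j
    have hr : ((twist d a (fun j => rootVec d I j * Complex.exp (-(l j / d))) (w s).toZ)
        (Sum.inr j)).re = 1 := by
      simp only [twist, Sum.elim_inr, Param.toZ, hw]
      rw [mul_pow, rootVec_pow hd, one_mul, ← Complex.exp_nat_mul, mul_neg,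
        mul_div_cancel₀ _ hd', ← Complex.exp_add]
      simp
    rw [hr]
    refine lt_of_le_of_lt (Finset.sum_le_sum fun i _ => ?_)
      (b := ∑ _i : Fin m, ε) (by simpa using hmε)
    simp only [twist, Sum.elim_inl, norm_mul, norm_prod, norm_pow, norm_rootVec hd, one_mul,
      Complex.norm_exp]
    have hre : ∀ j, (-(l j / d)).re = -((l j).re / d) := fun j => by
      rw [Complex.neg_re, Complex.div_natCast_re]
    simp only [hre]
    refine norm_mul_prod_exp_le hd (ha i) (norm_nonneg _) hε fun j => ?_
    have := (hmem i j).le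
    simpa only [Param.toZ, Sum.elim_inr, hw, Complex.norm_exp] using this

end

/-! ### The Gamma series as partial sums of one series -/

section

variable {k m d : ℕ} {a : Fin m → Fin (k + 1) → ℕ}

theorem mem_latticeL_matrixA {u : Fin m ⊕ Fin (k + 1) → ℤ} :
    u ∈ latticeL (matrixA d a) ↔
      ∀ j, ∑ i, (a i j : ℤ) * u (Sum.inl i) + d * u (Sum.inr j) = 0 := by
  simp only [latticeL, LinearMap.mem_ker, Matrix.mulVecLin_apply, funext_iff, Matrix.mulVec,
    dotProduct, Fintype.sum_sum_type, matrixA, Matrix.of_apply, Sum.elim_inl, Sum.elim_inr,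
    ite_mul, zero_mul, Finset.sum_ite_eq, Finset.mem_univ, if_true, Pi.zero_apply]

/-- The term of the Gamma series is determined by the integral exponents of `z_1, …, z_m`. -/
theorem gammaTerm_eq (hd : 0 < d) (c : Fin (k + 1) → ℕ) (p : Fin m → ℤ)
    (l : Fin m ⊕ Fin (k + 1) → ℂ) {u : Fin m ⊕ Fin (k + 1) → ℤ}
    (hu : u ∈ latticeL (matrixA d a)) :
    gammaTerm (gammaExponent d a c p) l u =
      gammaTerm (gammaExponent d a c (p + fun i => u (Sum.inl i))) l 0 := by
  have hd' : (d : ℂ) ≠ 0 := by exact_mod_cast hd.ne'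
  have h : ∀ s, (u s : ℂ) + gammaExponent d a c p s =
      ((0 : Fin m ⊕ Fin (k + 1) → ℤ) s : ℂ) +
        gammaExponent d a c (p + fun i => u (Sum.inl i)) s := by
    rintro (i | j)
    · simp [gammaExponent, add_comm]
    · have := congrArg (Int.cast : ℤ → ℂ) (mem_latticeL_matrixA.1 hu j)
      push_cast at this
      simp only [gammaExponent, Sum.elim_inr, Pi.zero_apply, Pi.add_apply, Int.cast_zero,
        Int.cast_add, add_mul, Finset.sum_add_distrib, zero_add]
      simp only [mul_comm (a _ j : ℂ)] at this
      field_simp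
      linear_combination this
  simp only [gammaTerm, add_assoc, h]

/-- For nonnegative exponents the entries `1 / Γ(1 + κ_i)` are reciprocals of factorials. -/
theorem gammaTerm_natCast (c : Fin (k + 1) → ℕ) (κ : Fin m → ℕ) (l : Fin m ⊕ Fin (k + 1) → ℂ) :
    gammaTerm (gammaExponent d a c fun i => (κ i : ℤ)) l 0 =
      seriesTerm d a c κ (fun i => Complex.exp (l (Sum.inl i)), fun j => l (Sum.inr j)) := by
  have h1 : ∀ j, ((c j : ℂ) + ∑ i, (κ i : ℂ) * (a i j : ℂ)) = (expVec a c κ j : ℂ) := fun j => by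
    simp [expVec]
  simp only [gammaTerm, seriesTerm, Fintype.sum_sum_type, Fintype.prod_sum_type, gammaExponent,
    Sum.elim_inl, Sum.elim_inr, Pi.zero_apply, Int.cast_zero, zero_add, add_zero, Int.cast_natCast,
    h1, Complex.exp_add, Complex.exp_sum, Finset.prod_div_distrib, add_comm (1 : ℂ) (κ _ : ℂ),
    Complex.Gamma_nat_eq_factorial, Complex.exp_nat_mul, neg_div, ← sub_eq_add_neg]
  ring

/-- A negative exponent of some `z_i` gives a pole of `Γ`, at which the value `Γ = 0` makes the
term `0`. -/
theorem gammaTerm_eq_zero_of_neg (c : Fin (k + 1) → ℕ) {v : Fin m → ℤ} {i : Fin m} (hi : v i < 0)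
    (l : Fin m ⊕ Fin (k + 1) → ℂ) : gammaTerm (gammaExponent d a c v) l 0 = 0 := by
  obtain ⟨n, hn⟩ := Int.eq_ofNat_of_zero_le (show 0 ≤ -(v i + 1) by omega)
  have hv : (1 : ℂ) + (v i : ℂ) = -(n : ℂ) := by
    have := congrArg (Int.cast : ℤ → ℂ) hn
    push_cast at this
    linear_combination -this
  rw [gammaTerm, Finset.prod_eq_zero (Finset.mem_univ (Sum.inl i)), div_zero]
  simp only [gammaExponent, Sum.elim_inl, Pi.zero_apply, Int.cast_zero, add_zero, hv,
    Complex.Gamma_neg_nat_eq_zero]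

/-- If an entry of `c + h(v)` vanishes modulo `d`, the corresponding `1 - b_j / d` is an integer
`≤ 0`, a pole of `Γ`. -/
theorem gammaTerm_eq_zero_of_hMap (hd : 0 < d) {c : Fin (k + 1) → ℕ} (hc : ∀ j, 0 < c j)
    {v : Fin m → ℤ} {j : Fin (k + 1)} (hj : (c j : ZMod d) + hMap d a v j = 0)
    (l : Fin m ⊕ Fin (k + 1) → ℂ) : gammaTerm (gammaExponent d a c v) l 0 = 0 := by
  by_cases hv : ∃ i, v i < 0
  · obtain ⟨i, hi⟩ := hv
    exact gammaTerm_eq_zero_of_neg c hi l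
  push Not at hv
  have hd' : (d : ℂ) ≠ 0 := by exact_mod_cast hd.ne'
  lift v to Fin m → ℕ using hv
  have h1 : ((expVec a c v j : ℕ) : ZMod d) = 0 := by
    rw [← hj]
    simp [expVec, hMap]
  obtain ⟨b, hb⟩ := (ZMod.natCast_eq_zero_iff _ _).1 h1
  obtain ⟨n, rfl⟩ : ∃ n, b = n + 1 := by
    refine ⟨b - 1, (Nat.sub_add_cancel ?_).symm⟩
    rcases Nat.eq_zero_or_pos b with rfl | h
    · have := expVec_pos (a := a) hc v j
      omega
    · exact h
  have h2 : (c j : ℂ) + ∑ i, (v i : ℂ) * (a i j : ℂ) = d * (n + 1) := by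
    have := congrArg (Nat.cast : ℕ → ℂ) hb
    simpa [expVec] using this
  rw [gammaTerm, Finset.prod_eq_zero (Finset.mem_univ (Sum.inr j)), div_zero]
  simp only [gammaExponent, Sum.elim_inr, Pi.zero_apply, Int.cast_zero, add_zero,
    Int.cast_natCast, h2]
  rw [show (1 : ℂ) + -(d * (n + 1)) / d = -(n : ℂ) by field_simp; ring,
    Complex.Gamma_neg_nat_eq_zero]

/-- The exponents of `z_1, …, z_m` in the Gamma series of `p` form the coset of `p` modulo the
kernel of `h`. -/
theorem range_latticeL (p : Fin m → ℤ) :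
    range (fun u : latticeL (matrixA d a) => p + fun i => u.1 (Sum.inl i)) =
      {v | hMap d a v = hMap d a p} := by
  have hsub : ∀ v : Fin m → ℤ, ∀ j, hMap d a v j = hMap d a p j ↔
      (d : ℤ) ∣ ∑ i, (v i - p i) * a i j := fun v j => by
    rw [← ZMod.intCast_zmod_eq_zero_iff_dvd, ← sub_eq_zero]
    simp [hMap, sub_mul]
  ext v
  simp only [mem_range, mem_ofPred_eq]
  constructor
  · rintro ⟨u, rfl⟩
    ext j
    rw [hsub]
    refine ⟨-u.1 (Sum.inr j), ?_⟩
    have := mem_latticeL_matrixA.1 u.2 j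
    simp only [Pi.add_apply, add_sub_cancel_left, mul_comm _ (a _ j : ℤ)]
    linarith
  · intro h
    have h' : ∀ j, ∃ w, ∑ i, (v i - p i) * (a i j : ℤ) = d * w := fun j =>
      (hsub v j).1 (congrFun h j)
    choose w hw using h'
    refine ⟨⟨Sum.elim (v - p) (-w), mem_latticeL_matrixA.2 fun j => ?_⟩, ?_⟩
    · have := hw j
      simp only [mul_comm _ (a _ j : ℤ)] at this
      simp only [Sum.elim_inl, Sum.elim_inr, Pi.sub_apply, Pi.neg_apply]
      linarith
    · ext i
      simp

/-- An element of `L_A` is determined by its first `m` entries. -/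
theorem injective_latticeL (hd : 0 < d) (p : Fin m → ℤ) :
    Function.Injective fun u : latticeL (matrixA d a) => p + fun i => u.1 (Sum.inl i) := by
  intro u u' h
  have h1 : ∀ i, u.1 (Sum.inl i) = u'.1 (Sum.inl i) := fun i => by
    have := congrFun h i
    simpa using this
  have hd' : (d : ℤ) ≠ 0 := by exact_mod_cast hd.ne'
  ext s
  rcases s with i | j
  · exact h1 i
  · have e1 := mem_latticeL_matrixA.1 u.2 j
    have e2 := mem_latticeL_matrixA.1 u'.2 j
    simp only [h1] at e1
    exact mul_left_cancel₀ hd' (by linarith)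

/-- The cosets of the representatives partition `ℤ^m`; the cosets outside `P_c` and the vectors with
a negative entry contribute nothing, so that the Gamma series add up to one series over `ℕ^m`. -/
theorem summable_gammaTerm_and_sum_gammaSeries (hd : 0 < d) {c : Fin (k + 1) → ℕ}
    (hc : ∀ j, 0 < c j) {l : Fin m ⊕ Fin (k + 1) → ℂ}
    (hs : Summable fun κ => seriesTerm d a c κ
      (fun i => Complex.exp (l (Sum.inl i)), fun j => l (Sum.inr j)))
    {Q : Finset (Fin m → ℤ)} (hQ : IsRepresentatives d a Q) :
    (∀ p, Summable fun u : latticeL (matrixA d a) =>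
      gammaTerm (gammaExponent d a c p) l u.1) ∧
    ∑ p ∈ setP d a c Q, gammaSeries (matrixA d a) (gammaExponent d a c p) l =
      ∑' κ, seriesTerm d a c κ
        (fun i => Complex.exp (l (Sum.inl i)), fun j => l (Sum.inr j)) := by
  classical
  set f : (Fin m → ℤ) → ℂ := fun v => gammaTerm (gammaExponent d a c v) l 0 with hf
  have hcast : Function.Injective fun (κ : Fin m → ℕ) (i : Fin m) => (κ i : ℤ) :=
    fun κ κ' h => funext fun i => Int.ofNat_inj.1 (congrFun h i)
  have hzero : ∀ v ∉ range fun (κ : Fin m → ℕ) (i : Fin m) => (κ i : ℤ), f v = 0 := by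
    intro v hv
    by_contra hne
    refine hv ?_
    have : ∀ i, 0 ≤ v i := fun i => by
      by_contra! hi
      exact hne (gammaTerm_eq_zero_of_neg c hi l)
    exact ⟨fun i => (v i).toNat, funext fun i => Int.toNat_of_nonneg (this i)⟩
  simp only [← gammaTerm_natCast c _ l] at hs ⊢
  have hfs : Summable f := (hcast.summable_iff hzero).1 hs
  have htsum : ∑' κ : Fin m → ℕ, gammaTerm (gammaExponent d a c fun i => (κ i : ℤ)) l 0 =
      ∑' v, f v := by
    refine hcast.tsum_eq (f := f) fun v hv => ?_
    by_contra h
    exact hv (hzero v h)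
  have hterm : ∀ (p : Fin m → ℤ) (u : latticeL (matrixA d a)),
      gammaTerm (gammaExponent d a c p) l u.1 = f (p + fun i => u.1 (Sum.inl i)) :=
    fun p u => gammaTerm_eq hd c p l u.2
  have hser : ∀ p : Fin m → ℤ, gammaSeries (matrixA d a) (gammaExponent d a c p) l =
      ∑' v, {v | hMap d a v = hMap d a p}.indicator f v := by
    intro p
    rw [gammaSeries, ← range_latticeL p,
      ← (injective_latticeL hd p).tsum_eq support_indicator_subset]
    exact tsum_congr fun u => by rw [hterm, indicator_of_mem (mem_range_self u)]
  refine ⟨fun p => ?_, ?_⟩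
  · simp only [hterm]
    exact hfs.comp_injective (injective_latticeL hd p)
  · simp only [hser]
    rw [htsum, ← Summable.tsum_finsetSum fun p _ => hfs.indicator _]
    refine tsum_congr fun v => ?_
    obtain ⟨q, ⟨hqQ, hq⟩, huniq⟩ := hQ v
    have hne : ∀ p ∈ setP d a c Q, p ≠ q → {v | hMap d a v = hMap d a p}.indicator f v = 0 := by
      intro p hp hpq
      have hv : v ∉ {v | hMap d a v = hMap d a p} := by
        intro h
        rw [mem_ofPred_eq] at h
        exact hpq (huniq p ⟨(Finset.mem_filter.1 hp).1, h.symm⟩)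
      exact indicator_of_notMem hv _
    by_cases hqP : q ∈ setP d a c Q
    · rw [Finset.sum_eq_single_of_mem q hqP hne]
      have hv : v ∈ {v | hMap d a v = hMap d a q} := hq.symm
      exact indicator_of_mem hv _
    · rw [Finset.sum_eq_zero fun p hp => hne p hp fun h => hqP (h ▸ hp)]
      have : ∃ j, (c j : ZMod d) + hMap d a v j = 0 := by
        by_contra! h
        refine hqP (Finset.mem_filter.2 ⟨hqQ, fun j => ?_⟩)
        rw [hq]
        exact h j
      obtain ⟨j, hj⟩ := this
      exact (gammaTerm_eq_zero_of_hMap hd hc hj l).symm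

end

end FermatPeriod

end

theorem lemma3p6 (k m d : ℕ) (hd : 0 < d) (a : Fin m → Fin (k + 1) → ℕ)
    (ha : ∀ i, ∑ j, a i j = d) :
    ∃ ε : ℝ, 0 < ε ∧
      ∀ l : Fin m ⊕ Fin (k + 1) → ℂ,
        (∀ i j, ‖Complex.exp (l (Sum.inl i))‖ < ε * ‖Complex.exp (l (Sum.inr j))‖) →
        (∃ δ, FermatPeriod.IsDeformation d a ε
          (fun i => Complex.exp (l (Sum.inl i)), fun j => l (Sum.inr j)) δ) ∧
        ∀ δ, FermatPeriod.IsDeformation d a ε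
          (fun i => Complex.exp (l (Sum.inl i)), fun j => l (Sum.inr j)) δ →
        ∀ (c : Fin (k + 1) → ℕ) (r : ℕ), (∀ j, 0 < c j) → ∑ j, c j = d * r →
        ∀ Q : Finset (Fin m → ℤ), FermatPeriod.IsRepresentatives d a Q →
          (∀ p ∈ FermatPeriod.setP d a c Q,
            Summable fun u : FermatPeriod.latticeL (FermatPeriod.matrixA d a) =>
              FermatPeriod.gammaTerm (FermatPeriod.gammaExponent d a c p) l u.1) ∧
          FermatPeriod.period d a c r (fun i => Complex.exp (l i)) δ =
            (-1 : ℂ) ^ r / (Nat.factorial (r - 1) : ℂ) *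
              (2 * (Real.pi : ℂ) * Complex.I) ^ (k + 1) *
              ∑ p ∈ FermatPeriod.setP d a c Q,
                FermatPeriod.gammaSeries (FermatPeriod.matrixA d a)
                  (FermatPeriod.gammaExponent d a c p) l := by
  have hm : (0 : ℝ) < m + 1 := by positivity
  have hmε : (m : ℝ) * (1 / (m + 1)) < 1 := by
    rw [mul_one_div, div_lt_one hm]
    exact lt_add_one _
  -- any `ε` with `m ε < 1` works
  refine ⟨1 / (m + 1), by positivity, fun l hl => ⟨?_, fun δ hδ c r hc hcr Q hQ => ?_⟩⟩
  · exact FermatPeriod.exists_isDeformation hd ha (by positivity) hmε fun i j => hl i j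
  · have hmem : ((fun i => Complex.exp (l (Sum.inl i)), fun j => l (Sum.inr j)) :
        FermatPeriod.Param (k + 1) m) ∈ FermatPeriod.nearFermat (k + 1) m (1 / (m + 1)) :=
      fun i j => hl i j
    obtain ⟨h1, h2⟩ := FermatPeriod.summable_gammaTerm_and_sum_gammaSeries hd hc
      (FermatPeriod.summable_norm_seriesTerm hd ha hc hmε.le hmem).of_norm hQ
    refine ⟨fun p _ => h1 p, ?_⟩
    have hz : (fun i => Complex.exp (l i)) = FermatPeriod.Param.toZ
        ((fun i => Complex.exp (l (Sum.inl i)), fun j => l (Sum.inr j)) :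
          FermatPeriod.Param (k + 1) m) := by
      funext s
      rcases s with i | j <;> rfl
    rw [hz, h2]
    exact (hδ.period_eq ha hc hcr
      (FermatPeriod.holomorphicOnLines_periodSeries hd ha hc r hmε.le)
      (FermatPeriod.fermatCycle_liesIn hd ha)
      (FermatPeriod.eventually_period_fermatCycle hd ha hc hcr)).2.self_of_nhds
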